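/- A $p$-cycle ($p\ge 3$) is a finite connected $2$-regular graph with $p$ vertices. A polyhedral map $K$ on a finite vertex set $V$ is a collection of cycles (the faces) with vertices in $V$ such that: any two distinct faces are disjoint, or meet in exactly one vertex, or meet in exactly one edge together with its two ends; for each vertex $v$ the faces containing $v$ can be listed without repetition as $F_1,\dots,F_m$, $m\ge 3$, so that $F_1\cap F_2,\dots,F_{m-1}\cap F_m, F_m\cap F_1$ are $m$ distinct edges at $v$; and the graph formed by all edges is connected. Its Euler characteristic is the number of vertices minus the number of edges plus the number of faces. It is orientable if its faces (as cycles) can be oriented so that each edge common to two faces is traversed by them in opposite directions. Two polyhedral maps are isomorphic if there is a bijection between their vertex sets that carries faces to faces in both directions. A polyhedral map is semi-equivelar if the cyclic sequence of the sizes of the faces around a vertex is the same for all vertices (up to the choice of starting point and direction). It is equivelar if moreover all its faces have the same size. Theorem. Up to isomorphism there are exactly $11$ semi-equivelar, non-equivelar polyhedral maps of Euler characteristic $0$ with at most $15$ vertices. Exactly six of them are orientable and exactly five are non-orientable. -/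

import Mathlib

namespace SEM

/-- The graph on `V` whose edges join `c i` to `c (i + 1)`, for `i` in `ℤ/p`. -/
def closedCurve {V : Type*} {p : ℕ} (c : ZMod p → V) : SimpleGraph V :=
  SimpleGraph.fromRel fun u w => ∃ i, u = c i ∧ w = c (i + 1)

/-- `F` is a `p`-cycle, `p ≥ 3`: a cycle graph on `p` distinct elements of `V`.
Its vertex set is `F.support`, the set of endpoints of its edges. -/
def IsCycleOfLength {V : Type*} (F : SimpleGraph V) (p : ℕ) : Prop :=
  3 ≤ p ∧ ∃ c : ZMod p → V, Function.Injective c ∧ F = closedCurve c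

/-- `d` is one of the two orientations of the cycle `F`: `d u w` says that `F` is traversed
from `u` to the next vertex `w`. -/
def IsCycleOrientation {V : Type*} (F : SimpleGraph V) (d : V → V → Prop) : Prop :=
  ∃ p, 3 ≤ p ∧ ∃ c : ZMod p → V, Function.Injective c ∧ F = closedCurve c ∧
    ∀ u w, d u w ↔ ∃ i, u = c i ∧ w = c (i + 1)

/-- A two-dimensional polyhedral complex with vertices in `V`: a collection of cycles of length
at least `3` (the faces) such that two different cycles are disjoint, or have exactly one vertex
in common, or have exactly one edge (with its two ends) in common. -/
structure PolyhedralComplex (V : Type*) where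
  faces : Set (SimpleGraph V)
  isCycle : ∀ F ∈ faces, ∃ p, IsCycleOfLength F p
  inter : ∀ F ∈ faces, ∀ G ∈ faces, F ≠ G →
    F.support ∩ G.support = ∅ ∨
    (∃ v, F.support ∩ G.support = {v}) ∨
    (∃ u v, F.Adj u v ∧ G.Adj u v ∧ F.support ∩ G.support = {u, v})

namespace PolyhedralComplex

variable {V W : Type*}

/-- The number of vertices (equivalently, of edges) of a cycle. -/
noncomputable def faceSize (F : SimpleGraph V) : ℕ := F.support.ncard

/-- The faces that contain the vertex `v`. -/
def facesAt (K : PolyhedralComplex V) (v : V) : Set (SimpleGraph V) :=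
  {F | F ∈ K.faces ∧ v ∈ F.support}

/-- The edge graph of `K`: the union of all faces. -/
def edgeGraph (K : PolyhedralComplex V) : SimpleGraph V := sSup K.faces

/-- `f 0, f 1, …, f (m - 1)` are the faces of `K` at `v`, without repetition, in a cyclic order
around `v`: consecutive faces `f i`, `f (i + 1)` share the edge from `v` to `w (i + 1)`, and
these `m` edges are different. -/
def IsUmbrella (K : PolyhedralComplex V) (v : V) {m : ℕ}
    (f : ZMod m → SimpleGraph V) (w : ZMod m → V) : Prop :=
  3 ≤ m ∧ Function.Injective f ∧ Function.Injective w ∧ Set.range f = K.facesAt v ∧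
    ∀ i, (f i).Adj v (w i) ∧ (f i).Adj v (w (i + 1))

/-- `K` is a polyhedral map with vertex set `V`: a connected finite polyhedral 2-manifold. -/
def IsMap (K : PolyhedralComplex V) : Prop :=
  Finite V ∧ K.edgeGraph.Connected ∧
    ∀ v, ∃ (m : ℕ) (f : ZMod m → SimpleGraph V) (w : ZMod m → V), K.IsUmbrella v f w

/-- All vertices have the same face-sequence: there is one cyclic sequence `a` such that the
faces at each vertex, in a cyclic order around that vertex, have sizes `a 0, …, a (m - 1)`. -/
def IsSemiEquivelar (K : PolyhedralComplex V) : Prop :=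
  ∃ (m : ℕ) (a : ZMod m → ℕ), ∀ v, ∃ (f : ZMod m → SimpleGraph V) (w : ZMod m → V),
    K.IsUmbrella v f w ∧ ∀ i, faceSize (f i) = a i

/-- All faces have the same number of vertices, and all vertices lie in the same number of
faces. -/
def IsEquivelar (K : PolyhedralComplex V) : Prop :=
  ∃ p q : ℕ, (∀ F ∈ K.faces, faceSize F = p) ∧ ∀ v, (K.facesAt v).ncard = q

/-- Number of vertices minus number of edges plus number of faces. -/
noncomputable def eulerChar (K : PolyhedralComplex V) : ℤ :=
  (Nat.card V : ℤ) - (K.edgeGraph.edgeSet.ncard : ℤ) + (K.faces.ncard : ℤ)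

/-- The faces can be oriented coherently: an edge common to two faces is traversed by them in
opposite directions. -/
def IsOrientable (K : PolyhedralComplex V) : Prop :=
  ∃ d : SimpleGraph V → V → V → Prop,
    (∀ F ∈ K.faces, IsCycleOrientation F (d F)) ∧
    ∀ F ∈ K.faces, ∀ G ∈ K.faces, F ≠ G → ∀ u w, d F u w → ¬ d G u w

/-- Isomorphism: a bijection of the vertices that carries faces to faces in both directions
(hence also edges to edges, each edge being an edge of a face). -/
def Isomorphic (K : PolyhedralComplex V) (L : PolyhedralComplex W) : Prop :=
  ∃ e : V ≃ W, ∀ F : SimpleGraph V, F ∈ K.faces ↔ F.map e.toEmbedding ∈ L.faces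

end PolyhedralComplex

end SEM

/-! Let `a` be the face sequence, of length `m`, of a map with `n` vertices and Euler characteristic
0. There are `n * m / 2` edges, and counting incidences of vertices and faces, each weighted by the
inverse of the face size, gives `n * ∑ 1 / a i` faces. Hence `2 * ∑ 1 / a i = m - 2`. Since all `a i
≥ 3`, the case `m ≥ 6` forces `a i = 3` throughout, an equivelar map; so `3 ≤ m ≤ 5` (`le_five`).
The faces at a vertex meet outside it only in the far ends of the edges they share there, so `∑ (a i
- 2) ≤ n - 1 ≤ 14` (`sum_sub_two_lt`). Moreover a size `p` that occurs `k` times in the sequence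
satisfies `p ∣ n * k` (`dvd_card_mul`). A finite check of these conditions leaves seven face
sequences, each with a bound for `n` (`exists_searchType`).

For each of them all maps are generated by a backtracking search, run by the kernel. It starts with
one face and repeatedly picks an edge that lies in a single known face. The other face at this edge
is added in every possible way, where unused vertices receive the least new label. A branch is
dropped when a consequence of the axioms or of the face sequence fails: two faces with two common
vertices share the edge between them, an edge lies in two faces, and the number, sizes and cyclic
neighbourhoods of the faces at a vertex are prescribed. Such tests only have to be necessary
conditions. Labels stay below 16, so relations between labels are stored as bit matrices in natural
numbers.

Completeness of the search is an invariant: `Realizes K φ st S` says that the labelling `φ`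
identifies the state `st` with a set `S` of faces of the given map `K`. Whatever face `K` has at the
chosen edge, one branch adds exactly that face (`extend_sound`, `pushFace_realizes`), and no test
fails on it. When no open edge is left, the umbrellas and connectedness show that `S` consists of
all faces. So `K` is described by a leaf of the search (`search_sound`), and every leaf is checked
to be a relabelling of one of eleven listed maps.

Those maps are verified from explicit vertex links. A coherent listing of the faces proves
orientability. A walk of directed edges that must all have the same sign, but leads from an edge to
its reversal, disproves it. The number of vertices together with counts of common neighbours of
nonadjacent vertices tells the eleven maps apart. -/

namespace SEM

/-! ### The search program -/

/-- Evaluate `n` to a literal before passing it on, so that the kernel shares its value. -/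
def force {α : Sort*} (n : ℕ) (k : ℕ → α) : α := Nat.rec (k 0) (fun p _ => k (Nat.succ p)) n

/-- Evaluate the spine of a list before passing it on. -/
def forceList {α β : Type*} (l : List α) (k : List α → β) : β :=
  List.rec (motive := fun _ => (List α → β) → β) (fun k => k [])
    (fun a _ ih k => ih fun t => k (a :: t)) l k

def getBit (m i : ℕ) : Bool := Nat.beq (Nat.land (Nat.shiftRight m i) 1) 1

def getRow (m a : ℕ) : ℕ := Nat.land (Nat.shiftRight m (Nat.mul 16 a)) 65535

def single (a : ℕ) : ℕ := Nat.shiftLeft 1 a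

def headOr {α : Type*} (d : α) (l : List α) : α := List.rec d (fun a _ _ => a) l

def lastOr {α : Type*} (d : α) (l : List α) : α :=
  List.rec (motive := fun _ => α → α) (fun d => d) (fun a _ ih _ => ih a) l d

/-- The triples (predecessor, element, successor) of a path that comes from `p` and goes on to
`s`. -/
def cornersFrom {α : Type*} (s p : α) (l : List α) : List (α × α × α) :=
  List.rec (motive := fun _ => α → List (α × α × α)) (fun _ => [])
    (fun a t ih p => (p, a, headOr s t) :: ih a) l p

/-- The triples (predecessor, element, successor) of a closed path. -/
def corners {α : Type*} (l : List α) : List (α × α × α) :=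
  List.rec [] (fun a t _ => cornersFrom a (lastOr a t) (a :: t)) l

/-- Bounds on a map: number of vertices, degree, number of faces of each size at a vertex (four bits
per size), allowed sizes of three consecutive faces at a vertex (a bit per `tripleCode`), face sizes. -/
structure LocalSpec where
  bound : ℕ
  deg : ℕ
  caps : ℕ
  triples : ℕ
  sizes : List ℕ

/-- A set of faces on the labels below `nv`, with bit matrices (rows of 16 bits) of the pairs that no
further face may have as an edge, may contain, or has to contain as an edge, the mask of the labels
with all faces listed, and for each label its neighbours in each listed face and the face size. -/
structure State where
  nv : ℕ
  full : ℕ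
  edgeObs : ℕ
  pairObs : ℕ
  opn : ℕ
  cor : List (List (ℕ × ℕ × ℕ))
  faces : List (List ℕ)

def allL {α : Type*} (p : α → Bool) (l : List α) : Bool :=
  List.rec true (fun a _ ih => bif p a then ih else false) l

def foldL {α β : Type*} (f : β → α → β) (l : List α) (b : β) : β :=
  List.rec (motive := fun _ => β → β) (fun b => b) (fun a _ ih b => ih (f b a)) l b

def toMask (l : List ℕ) : ℕ := foldL (fun m a => Nat.lor m (single a)) l 0

def pairMask (f : List ℕ) : ℕ :=
  force (toMask f) fun fm => foldL (fun m a => Nat.lor m (Nat.shiftLeft fm (Nat.mul 16 a))) f 0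

/-- For the corners of a closed path this is the symmetric adjacency matrix of the polygon. It is
unchanged by rotation and reversal of the path, so it also serves to compare polygons. -/
def edgeMask (cs : List (ℕ × ℕ × ℕ)) : ℕ :=
  foldL (fun m c => Nat.lor m (Nat.shiftLeft
    (Nat.lor (single c.1) (single c.2.2)) (Nat.mul 16 c.2.1))) cs 0

def nth {α : Type*} (l : List (List α)) (i : ℕ) : List α :=
  Nat.rec (motive := fun _ => List (List α) → List α)
    (fun l => List.rec [] (fun a _ _ => a) l)
    (fun _ ih l => List.rec [] (fun _ t _ => ih t) l) i l

def pushAt {α : Type*} (x : α) (l : List (List α)) (i : ℕ) : List (List α) :=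
  Nat.rec (motive := fun _ => List (List α) → List (List α))
    (fun l => List.rec [[x]] (fun a t _ => (x :: a) :: t) l)
    (fun _ ih l => List.rec ([] :: ih []) (fun a t _ => a :: ih t) l) i l

def lengthL {α : Type*} (l : List α) : ℕ := List.rec 0 (fun _ _ ih => Nat.succ ih) l

def pushCorners (s : ℕ) (cs : List (ℕ × ℕ × ℕ)) (cor : List (List (ℕ × ℕ × ℕ))) :
    List (List (ℕ × ℕ × ℕ)) :=
  foldL (fun cor c => pushAt (c.1, c.2.2, s) cor c.2.1) cs cor

/-- The size of the listed face that shares with the corner `(x, y, s)` the edge to `x`, or `0`. -/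
def acrossSize (C : List (ℕ × ℕ × ℕ)) (x y : ℕ) : ℕ :=
  List.rec 0 (fun d _ ih =>
    bif bif Nat.beq d.1 x then !Nat.beq d.2.1 y
      else bif Nat.beq d.2.1 x then !Nat.beq d.1 y else false
    then d.2.2 else ih) C

/-- The value 0 for `p` or `q` stands for a neighbouring face that is not known yet. -/
def tripleCode (p s q : ℕ) : ℕ := Nat.add (Nat.mul 256 p) (Nat.add (Nat.mul 16 s) q)

def countSize (C : List (ℕ × ℕ × ℕ)) (s : ℕ) : ℕ :=
  List.rec 0 (fun d _ ih => bif Nat.beq d.2.2 s then Nat.succ ih else ih) C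

def capOf (sp : LocalSpec) (s : ℕ) : ℕ := Nat.land (Nat.shiftRight sp.caps (Nat.mul 4 s)) 15

/-- Whether two corners at the same vertex have an edge in common. -/
def meets (c d : ℕ × ℕ × ℕ) : Bool :=
  bif Nat.beq d.1 c.1 then true else bif Nat.beq d.2.1 c.1 then true else
  bif Nat.beq d.1 c.2.1 then true else Nat.beq d.2.1 c.2.1

/-- Whether the corners `C` listed at the vertex `a` respect the specification, given that they
did so before the corner `c` was added. -/
def vertexOK (sp : LocalSpec) (opn : ℕ) (c : ℕ × ℕ × ℕ) (C : List (ℕ × ℕ × ℕ)) (a : ℕ) : Bool :=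
  bif bif Nat.beq (getRow opn a) 0 then Nat.beq (lengthL C) sp.deg
    else Nat.blt (lengthL C) sp.deg
  then bif Nat.ble (countSize C c.2.2) (capOf sp c.2.2) then
    allL (fun d => bif meets c d then
      getBit sp.triples (tripleCode (acrossSize C d.1 d.2.1) d.2.2 (acrossSize C d.2.1 d.1))
      else true) C
    else false
  else false

/-- A vertex of a listed face with no open edge has its whole umbrella listed, because the umbrella
is cyclic. -/
def newFull (opn : ℕ) (f : List ℕ) : ℕ :=
  foldL (fun m a => bif Nat.beq (getRow opn a) 0 then Nat.lor m (single a) else m) f 0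

/-- Add the face `f` to the state and continue with `k`, unless a vertex of `f` is in conflict with
the specification. -/
def addFace (sp : LocalSpec) (st : State) (s nv : ℕ) (f : List ℕ) (k : State → Bool) : Bool :=
  forceList (corners f) fun cs =>
  force (edgeMask cs) fun em =>
  force (Nat.xor st.opn em) fun opn =>
  forceList (pushCorners s cs st.cor) fun cor =>
  bif allL (fun c => vertexOK sp opn (c.1, c.2.2, s) (nth cor c.2.1) c.2.1) cs then
    force (pairMask f) fun pm =>
    force (Nat.lor st.full (newFull opn f)) fun full =>
    force (Nat.lor st.edgeObs (Nat.lor (Nat.xor pm em) (Nat.land st.opn em))) fun e =>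
    force (Nat.lor st.pairObs pm) fun p =>
    k ⟨nv, full, e, p, opn, cor, f :: st.faces⟩
  else true

/-- Try all `x` below `bound` that are old labels or the least new one, and not in `forb`. -/
def forLabels (bound nv forb : ℕ) (k : ℕ → ℕ → Bool) : Bool :=
  bif Nat.rec true (fun x ih =>
    bif bif getBit forb x then true else force x fun x => k x nv then ih else false) nv
  then (bif Nat.blt nv bound then k nv (Nat.succ nv) else true)
  else false

/-- All ways to continue the path `x :: path` from `v`, which has `r + 1` more vertices. Labels in
`fx` must not come next, labels in `fv` must not come last. -/
def extend (sp : LocalSpec) (full e p v fv : ℕ) (k : ℕ → List ℕ → Bool) (r : ℕ) :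
    ℕ → ℕ → ℕ → ℕ → List ℕ → Bool :=
  Nat.rec (motive := fun _ => ℕ → ℕ → ℕ → ℕ → List ℕ → Bool)
    (fun nv fx mid x path =>
      force (Nat.lor fx (Nat.lor fv (Nat.lor full (Nat.lor mid (Nat.lor
        (Nat.lor (getRow e x) (single x)) (Nat.lor (getRow e v) (single v))))))) fun forb =>
      forLabels sp.bound nv forb fun y nv' => force nv' fun nv' => k nv' (y :: x :: path))
    (fun _ ih nv fx mid x path =>
      force (Nat.lor fx (Nat.lor full (Nat.lor mid (Nat.lor (Nat.lor (getRow e x) (single x))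
        (Nat.lor (getRow p v) (single v)))))) fun forb =>
      force (Nat.lor mid (Nat.lor (getRow p x) (single x))) fun mid' =>
      forLabels sp.bound nv forb fun y nv' => force nv' fun nv' => ih nv' 0 mid' y (x :: path)) r

/-- An element of `mask` below `nv` that lies in as many listed faces as possible. -/
def busiest (cor : List (List (ℕ × ℕ × ℕ))) (nv : ℕ) (mask : ℕ → Bool) : ℕ :=
  Prod.snd (Nat.rec (motive := fun _ => ℕ × ℕ) (0, 0) (fun a ih =>
    bif mask a then
      force (lengthL (nth cor a)) fun s => bif Nat.blt ih.1 s then (s, a) else ih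
    else ih) nv)

/-- If a single face is missing at a vertex with the open neighbours `r`, then that face has the
neighbours `r`: the labels excluded by this. -/
def lastFaceObs (sp : LocalSpec) (C : List (ℕ × ℕ × ℕ)) (r : ℕ) : ℕ :=
  bif Nat.beq (Nat.succ (lengthL C)) sp.deg then Nat.xor 65535 r else 0

def sizeFits (sp : LocalSpec) (C : List (ℕ × ℕ × ℕ)) (s : ℕ) : Bool :=
  Nat.blt (countSize C s) (capOf sp s)

/-- Add a face at an edge that lies in a single listed face, in all possible ways, until there is no
such edge; check that then `leaf` holds. -/
def search (sp : LocalSpec) (leaf : State → Bool) (fuel : ℕ) : State → Bool :=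
  Nat.rec (motive := fun _ => State → Bool) (fun _ => false)
    (fun _ ih st =>
      bif Nat.beq st.opn 0 then leaf st else
        force (busiest st.cor st.nv fun a => !Nat.beq (getRow st.opn a) 0) fun v =>
        force (getRow st.opn v) fun rv =>
        force (busiest st.cor st.nv (getBit rv)) fun w =>
        force (lastFaceObs sp (nth st.cor v) rv) fun fv =>
        force (lastFaceObs sp (nth st.cor w) (getRow st.opn w)) fun fw =>
        bif getBit rv w then
          allL (fun s =>
            bif sizeFits sp (nth st.cor v) s && sizeFits sp (nth st.cor w) s then
              extend sp st.full st.edgeObs st.pairObs v fv (fun nv f =>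
                addFace sp st s nv f ih) (Nat.sub s 3) st.nv fw 0 w [v]
            else true) sp.sizes
        else false) fuel

def emptyState : State := ⟨0, 0, 0, 0, 0, [], []⟩

/-- Search through all maps that contain a given face of size `s`. -/
def searchAll (sp : LocalSpec) (s : ℕ) (leaf : State → Bool) : Bool :=
  addFace sp emptyState s s (List.range s) (search sp leaf 50)

/-- Addition instead of bitwise or makes each block of four bits count the occurrences of a size. -/
def capsOf (l : List ℕ) : ℕ := foldL (fun m s => Nat.add m (single (Nat.mul 4 s))) l 0

/-- The direction around a vertex is not fixed and neighbouring faces may be unknown. Hence the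
reversed triples and those with 0 at either end are allowed as well. -/
def triplesOf (l : List ℕ) : ℕ :=
  foldL (fun m c => foldL (fun m i => Nat.lor m (single i)) [
    tripleCode c.1 c.2.1 c.2.2, tripleCode c.2.2 c.2.1 c.1, tripleCode 0 c.2.1 c.2.2,
    tripleCode c.2.2 c.2.1 0, tripleCode 0 c.2.1 c.1, tripleCode c.1 c.2.1 0,
    tripleCode 0 c.2.1 0] m) (corners l) 0

def specOf (bound : ℕ) (l : List ℕ) : LocalSpec :=
  ⟨bound, l.length, capsOf l, triplesOf l, l.dedup⟩

end SEM

/-! ### Cycles as closed curves and as lists of vertices -/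

namespace SEM
open Function

section Curves
variable {V : Type*} {p : ℕ} {c : ZMod p → V}

theorem zmod_one_ne_zero (hp : 3 ≤ p) : (1 : ZMod p) ≠ 0 := by
  have : Fact (1 < p) := ⟨by omega⟩
  exact one_ne_zero

theorem zmod_two_ne_zero (hp : 3 ≤ p) : (2 : ZMod p) ≠ 0 := by
  intro h
  have : ((2 : ℕ) : ZMod p) = 0 := by exact_mod_cast h
  rw [ZMod.natCast_eq_zero_iff] at this
  exact absurd (Nat.le_of_dvd (by norm_num) this) (by omega)

theorem closedCurve_adj (hp : 3 ≤ p) (hc : Injective c) {u w : V} :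
    (closedCurve c).Adj u w ↔ ∃ i, (u = c i ∧ w = c (i + 1)) ∨ (u = c i ∧ w = c (i - 1)) := by
  unfold closedCurve
  rw [SimpleGraph.fromRel_adj]
  constructor
  · rintro ⟨-, ⟨i, hi⟩ | ⟨i, h1, h2⟩⟩
    · exact ⟨i, Or.inl hi⟩
    · exact ⟨i + 1, Or.inr ⟨h2, by simpa using h1⟩⟩
  · have h1 := zmod_one_ne_zero hp
    rintro ⟨i, ⟨rfl, rfl⟩ | ⟨rfl, rfl⟩⟩
    · exact ⟨fun h => h1 (by simpa using hc h), Or.inl ⟨i, rfl, rfl⟩⟩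
    · refine ⟨fun h => h1 ?_, Or.inr ⟨i - 1, rfl, by simp⟩⟩
      have := hc h
      rw [eq_sub_iff_add_eq] at this
      simpa using this

theorem closedCurve_adj_apply (hp : 3 ≤ p) (hc : Injective c) {i : ZMod p} {w : V} :
    (closedCurve c).Adj (c i) w ↔ w = c (i + 1) ∨ w = c (i - 1) := by
  rw [closedCurve_adj hp hc]
  constructor
  · rintro ⟨j, ⟨h, rfl⟩ | ⟨h, rfl⟩⟩ <;> rw [hc h] <;> simp
  · rintro (h | h)
    · exact ⟨i, Or.inl ⟨rfl, h⟩⟩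
    · exact ⟨i, Or.inr ⟨rfl, h⟩⟩

theorem mem_support_closedCurve (hp : 3 ≤ p) (hc : Injective c) {u : V} :
    u ∈ (closedCurve c).support ↔ u ∈ Set.range c := by
  rw [SimpleGraph.mem_support]
  constructor
  · rintro ⟨w, h⟩
    obtain ⟨i, ⟨rfl, -⟩ | ⟨rfl, -⟩⟩ := (closedCurve_adj hp hc).1 h <;> exact ⟨i, rfl⟩
  · rintro ⟨i, rfl⟩
    exact ⟨_, (closedCurve_adj_apply hp hc).2 (Or.inl rfl)⟩

theorem faceSize_closedCurve (hp : 3 ≤ p) (hc : Injective c) :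
    PolyhedralComplex.faceSize (closedCurve c) = p := by
  have : (closedCurve c).support = Set.range c := by
    ext u; exact mem_support_closedCurve hp hc
  rw [PolyhedralComplex.faceSize, this, ← Set.image_univ, Set.ncard_image_of_injective _ hc,
    Set.ncard_univ, Nat.card_zmod]

theorem closedCurve_succ_ne_pred (hp : 3 ≤ p) (hc : Injective c) (i : ZMod p) :
    c (i + 1) ≠ c (i - 1) := by
  intro h
  refine zmod_two_ne_zero hp ?_
  have := hc h
  rw [eq_sub_iff_add_eq] at this
  have h2 : i + (1 + 1) = i := by rw [← add_assoc]; exact this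
  have := add_eq_left.1 h2
  rw [one_add_one_eq_two] at this
  exact this

/-- Composing a closed curve with a rotation or reflection does not change the graph. -/
theorem closedCurve_add (c : ZMod p → V) (k : ZMod p) :
    closedCurve (fun i => c (i + k)) = closedCurve c := by
  unfold closedCurve
  congr 1
  ext u w
  constructor
  · rintro ⟨i, h1, h2⟩
    exact ⟨i + k, h1, by rw [h2]; ring_nf⟩
  · rintro ⟨i, h1, h2⟩
    exact ⟨i - k, by simpa using h1, by rw [h2]; ring_nf⟩

theorem closedCurve_sub (c : ZMod p → V) (k : ZMod p) :
    closedCurve (fun i => c (k - i)) = closedCurve c := by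
  unfold closedCurve
  ext u w
  rw [SimpleGraph.fromRel_adj, SimpleGraph.fromRel_adj]
  refine and_congr_right fun _ => or_comm.trans (or_congr ?_ ?_)
  · constructor
    · rintro ⟨i, h1, h2⟩
      exact ⟨k - (i + 1), h2, by rw [h1]; ring_nf⟩
    · rintro ⟨i, h1, h2⟩
      exact ⟨k - (i + 1), by rw [h2]; congr 1; ring, by rw [h1]; ring_nf⟩
  · constructor
    · rintro ⟨i, h1, h2⟩
      exact ⟨k - (i + 1), h2, by rw [h1]; ring_nf⟩
    · rintro ⟨i, h1, h2⟩
      exact ⟨k - (i + 1), by rw [h2]; congr 1; ring, by rw [h1]; ring_nf⟩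

/-- Every edge of a closed curve is the edge from position `-1` to position `-2` of a curve with
the same graph. -/
theorem exists_closedCurve_of_adj (hp : 3 ≤ p) (hc : Injective c) {v w : V}
    (h : (closedCurve c).Adj v w) :
    ∃ d : ZMod p → V, Injective d ∧ closedCurve d = closedCurve c ∧ d (-1) = v ∧ d (-2) = w := by
  obtain ⟨i, ⟨rfl, rfl⟩ | ⟨rfl, rfl⟩⟩ := (closedCurve_adj hp hc).1 h
  · refine ⟨fun j => c ((i - 1) - j), fun a b hab => by simpa using hc hab,
      closedCurve_sub _ _, by ring_nf, by ring_nf⟩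
  · refine ⟨fun j => c (j + (i + 1)), fun a b hab => by simpa using hc hab,
      closedCurve_add _ _, by ring_nf, by ring_nf⟩

end Curves

section Lists
variable {V W : Type*}

@[simp] theorem headOr_nil (d : V) : headOr d [] = d := rfl
@[simp] theorem headOr_cons (d a : V) (l : List V) : headOr d (a :: l) = a := rfl
@[simp] theorem lastOr_nil (d : V) : lastOr d [] = d := rfl
@[simp] theorem lastOr_cons (d a : V) (l : List V) : lastOr d (a :: l) = lastOr a l := rfl
@[simp] theorem cornersFrom_nil (s p : V) : cornersFrom s p [] = [] := rfl
@[simp] theorem cornersFrom_cons (s p a : V) (l : List V) :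
    cornersFrom s p (a :: l) = (p, a, headOr s l) :: cornersFrom s a l := rfl
@[simp] theorem corners_nil : corners ([] : List V) = [] := rfl
theorem corners_cons (a : V) (l : List V) :
    corners (a :: l) = cornersFrom a (lastOr a l) (a :: l) := rfl

theorem length_cornersFrom (s p : V) (l : List V) : (cornersFrom s p l).length = l.length := by
  induction l generalizing p with
  | nil => rfl
  | cons a t ih => simp [ih]

@[simp] theorem length_corners (l : List V) : (corners l).length = l.length := by
  cases l with
  | nil => rfl
  | cons a t => rw [corners_cons, length_cornersFrom]

theorem map_center_cornersFrom (s p : V) (l : List V) :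
    (cornersFrom s p l).map (fun c => c.2.1) = l := by
  induction l generalizing p with
  | nil => rfl
  | cons a t ih => simp [ih]

theorem map_center_corners (l : List V) : (corners l).map (fun c => c.2.1) = l := by
  cases l with
  | nil => rfl
  | cons a t => rw [corners_cons, map_center_cornersFrom]

theorem map_headOr (g : V → W) (d : V) (l : List V) : g (headOr d l) = headOr (g d) (l.map g) := by
  cases l <;> rfl

theorem map_lastOr (g : V → W) (d : V) (l : List V) : g (lastOr d l) = lastOr (g d) (l.map g) := by
  induction l generalizing d with
  | nil => rfl
  | cons a t ih => exact ih a

theorem cornersFrom_map (g : V → W) (s p : V) (l : List V) :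
    cornersFrom (g s) (g p) (l.map g) =
      (cornersFrom s p l).map fun c => (g c.1, g c.2.1, g c.2.2) := by
  induction l generalizing p with
  | nil => rfl
  | cons a t ih => rw [List.map_cons, cornersFrom_cons, ih, ← map_headOr]; rfl

theorem corners_map (g : V → W) (l : List V) :
    corners (l.map g) = (corners l).map fun c => (g c.1, g c.2.1, g c.2.2) := by
  cases l with
  | nil => rfl
  | cons a t =>
    rw [List.map_cons, corners_cons, corners_cons, ← map_lastOr, ← List.map_cons, cornersFrom_map]

theorem getElem_cornersFrom (s p : V) (l : List V) (i : ℕ) (h : i < (cornersFrom s p l).length) :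
    (cornersFrom s p l)[i] =
      ((p :: l).getD i s, (p :: l).getD (i + 1) s, (p :: l).getD (i + 2) s) := by
  induction l generalizing p i with
  | nil => simp at h
  | cons a t ih =>
    cases i with
    | zero => cases t <;> simp
    | succ i => simpa using ih a i (by simpa using h)

theorem lastOr_eq_getD (d : V) (l : List V) : lastOr d l = (d :: l).getD l.length d := by
  induction l generalizing d with
  | nil => rfl
  | cons a t ih =>
    rw [lastOr_cons, ih, List.length_cons, List.getD_cons_succ]
    simp [List.getD_eq_getElem?_getD]

/-- Addition and subtraction in `Fin (k + 1)` wrap around, which accounts for the first and the last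
corner of the closed path. -/
theorem getElem_corners {k : ℕ} {l : List V} (hl : l.length = k + 1) (i : Fin (k + 1)) :
    (corners l)[i.val]'(by rw [length_corners, hl]; exact i.2) =
      (l[(i - 1).val]'(by rw [hl]; exact (i - 1).2), l[i.val]'(by rw [hl]; exact i.2),
        l[(i + 1).val]'(by rw [hl]; exact (i + 1).2)) := by
  obtain ⟨a, t, rfl⟩ : ∃ a t, l = a :: t := by
    cases l with
    | nil => simp at hl
    | cons a t => exact ⟨a, t, rfl⟩
  have ht : t.length = k := by simpa using hl
  have hg := getElem_cornersFrom a (lastOr a t) (a :: t) i.val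
    (by rw [length_cornersFrom, hl]; exact i.2)
  have : (corners (a :: t))[i.val]'(by rw [length_corners, hl]; exact i.2) =
    (cornersFrom a (lastOr a t) (a :: t))[i.val]'(by rw [length_cornersFrom, hl]; exact i.2) := rfl
  rw [this, hg]
  have hi := i.2
  refine Prod.ext ?_ (Prod.ext ?_ ?_)
  · simp only [Fin.coe_sub_one]
    split_ifs with h0
    · subst h0
      have : k < (a :: t).length := by omega
      rw [← List.getD_eq_getElem _ a this, lastOr_eq_getD, ht]
      rfl
    · obtain ⟨j, hj⟩ : ∃ j, i.val = j + 1 := Nat.exists_eq_succ_of_ne_zero fun h => h0 (Fin.ext h)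
      have : j < (a :: t).length := by omega
      simp only [hj, Nat.add_sub_cancel]
      rw [← List.getD_eq_getElem _ a this]
      rfl
  · have : i.val < (a :: t).length := by omega
    rw [← List.getD_eq_getElem _ a this]
    rfl
  · simp only [Fin.val_add_one]
    split_ifs with h0
    · subst h0
      simp [ht]
    · have hik : i.val ≠ k := fun h => h0 (Fin.ext h)
      have : i.val + 1 < (a :: t).length := by omega
      rw [← List.getD_eq_getElem _ a this]
      rfl

/-- The closed polygon through the elements of a list. -/
def polygon (l : List V) : SimpleGraph V :=
  SimpleGraph.fromRel fun u w => ∃ p, (p, u, w) ∈ corners l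

/-- The closed curve through the elements of a list. -/
def curveOf {k : ℕ} (l : List V) (hl : l.length = k + 1) (i : ZMod (k + 1)) : V :=
  l[(show Fin (k + 1) from i).val]'(by rw [hl]; exact (show Fin (k + 1) from i).2)

/-- The bridge between lists and curves. It rests on `ZMod (k + 1)` being `Fin (k + 1)` by
definition. -/
theorem mem_corners_iff {k : ℕ} {l : List V} (hl : l.length = k + 1) {c : V × V × V} :
    c ∈ corners l ↔ ∃ i, c = (curveOf l hl (i - 1), curveOf l hl i, curveOf l hl (i + 1)) := by
  rw [List.mem_iff_getElem]
  constructor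
  · rintro ⟨i, hi, rfl⟩
    rw [length_corners, hl] at hi
    exact ⟨(⟨i, hi⟩ : Fin (k + 1)), getElem_corners hl ⟨i, hi⟩⟩
  · rintro ⟨i, rfl⟩
    exact ⟨(show Fin (k + 1) from i).val, by
      rw [length_corners, hl]; exact (show Fin (k + 1) from i).2, getElem_corners hl i⟩

theorem curveOf_injective {k : ℕ} {l : List V} (hl : l.length = k + 1) (hn : l.Nodup) :
    Injective (curveOf l hl) := by
  intro i j hij
  exact Fin.ext ((hn.getElem_inj_iff).1 hij)

theorem mem_range_curveOf {k : ℕ} {l : List V} (hl : l.length = k + 1) {x : V} :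
    x ∈ Set.range (curveOf l hl) ↔ x ∈ l := by
  rw [List.mem_iff_getElem]
  constructor
  · rintro ⟨i, rfl⟩
    exact ⟨_, _, rfl⟩
  · rintro ⟨i, hi, rfl⟩
    exact ⟨(⟨i, hl ▸ hi⟩ : Fin (k + 1)), rfl⟩

theorem exists_corner_iff {k : ℕ} {l : List V} (hl : l.length = k + 1) {u w : V} :
    (∃ p, (p, u, w) ∈ corners l) ↔ ∃ i, u = curveOf l hl i ∧ w = curveOf l hl (i + 1) := by
  simp only [mem_corners_iff hl, Prod.mk.injEq]
  constructor
  · rintro ⟨p, i, -, h⟩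
    exact ⟨i, h⟩
  · rintro ⟨i, h⟩
    exact ⟨_, i, rfl, h⟩

theorem polygon_eq {k : ℕ} {l : List V} (hl : l.length = k + 1) :
    polygon l = closedCurve (curveOf l hl) := by
  unfold polygon closedCurve
  simp only [exists_corner_iff hl]

theorem isCycleOrientation_polygon {l : List V} (hn : l.Nodup) (h3 : 3 ≤ l.length) :
    IsCycleOrientation (polygon l) fun u w => ∃ p, (p, u, w) ∈ corners l := by
  obtain ⟨k, hl⟩ : ∃ k, l.length = k + 1 := ⟨l.length - 1, by omega⟩
  exact ⟨k + 1, by omega, _, curveOf_injective hl hn, polygon_eq hl,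
    fun _ _ => exists_corner_iff hl⟩

theorem isCycle_polygon {l : List V} (hn : l.Nodup) (h3 : 3 ≤ l.length) :
    IsCycleOfLength (polygon l) l.length := by
  obtain ⟨k, hl⟩ : ∃ k, l.length = k + 1 := ⟨l.length - 1, by omega⟩
  rw [hl]
  exact ⟨by omega, _, curveOf_injective hl hn, polygon_eq hl⟩

theorem mem_support_polygon {l : List V} (hn : l.Nodup) (h3 : 3 ≤ l.length) {x : V} :
    x ∈ (polygon l).support ↔ x ∈ l := by
  obtain ⟨k, hl⟩ : ∃ k, l.length = k + 1 := ⟨l.length - 1, by omega⟩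
  rw [polygon_eq hl, mem_support_closedCurve (by omega) (curveOf_injective hl hn),
    mem_range_curveOf hl]

theorem faceSize_polygon {l : List V} (hn : l.Nodup) (h3 : 3 ≤ l.length) :
    PolyhedralComplex.faceSize (polygon l) = l.length := by
  obtain ⟨k, hl⟩ : ∃ k, l.length = k + 1 := ⟨l.length - 1, by omega⟩
  rw [polygon_eq hl, faceSize_closedCurve (by omega) (curveOf_injective hl hn), hl]

/-- The neighbours of a vertex of a polygon. -/
theorem polygon_adj_of_corner {l : List V} (hn : l.Nodup) (h3 : 3 ≤ l.length) {a b c : V}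
    (h : (a, b, c) ∈ corners l) {x : V} : (polygon l).Adj b x ↔ x = a ∨ x = c := by
  obtain ⟨k, hl⟩ : ∃ k, l.length = k + 1 := ⟨l.length - 1, by omega⟩
  obtain ⟨i, hi⟩ := (mem_corners_iff hl).1 h
  obtain ⟨rfl, rfl, rfl⟩ : a = _ ∧ b = _ ∧ c = _ := by simpa using hi
  rw [polygon_eq hl, closedCurve_adj_apply (by omega) (curveOf_injective hl hn), or_comm]

theorem ne_of_corner {l : List V} (hn : l.Nodup) (h3 : 3 ≤ l.length) {a b c : V}
    (h : (a, b, c) ∈ corners l) : a ≠ c := by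
  obtain ⟨k, hl⟩ : ∃ k, l.length = k + 1 := ⟨l.length - 1, by omega⟩
  obtain ⟨i, hi⟩ := (mem_corners_iff hl).1 h
  obtain ⟨rfl, rfl, rfl⟩ : a = _ ∧ b = _ ∧ c = _ := by simpa using hi
  exact (closedCurve_succ_ne_pred (by omega) (curveOf_injective hl hn) i).symm

theorem mem_of_corner {l : List V} {a b c : V} (h : (a, b, c) ∈ corners l) :
    a ∈ l ∧ b ∈ l ∧ c ∈ l := by
  obtain ⟨k, hl⟩ : ∃ k, l.length = k + 1 := by
    cases l with
    | nil => simp at h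
    | cons a t => exact ⟨_, rfl⟩
  obtain ⟨i, hi⟩ := (mem_corners_iff hl).1 h
  obtain ⟨rfl, rfl, rfl⟩ : a = _ ∧ b = _ ∧ c = _ := by simpa using hi
  simp only [← mem_range_curveOf hl]
  exact ⟨⟨_, rfl⟩, ⟨_, rfl⟩, ⟨_, rfl⟩⟩

theorem exists_corner {l : List V} {b : V} (h : b ∈ l) : ∃ a c, (a, b, c) ∈ corners l := by
  rw [← map_center_corners l, List.mem_map] at h
  obtain ⟨⟨a, b, c⟩, h, rfl⟩ := h
  exact ⟨a, c, h⟩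

/-- The vertices of a closed curve. -/
def listOf {k : ℕ} (c : ZMod (k + 1) → V) : List V :=
  List.ofFn fun i : Fin (k + 1) => c (show ZMod (k + 1) from i)

theorem length_listOf {k : ℕ} (c : ZMod (k + 1) → V) : (listOf c).length = k + 1 :=
  List.length_ofFn

theorem nodup_listOf {k : ℕ} {c : ZMod (k + 1) → V} (hc : Injective c) : (listOf c).Nodup :=
  List.nodup_ofFn.2 hc

theorem polygon_listOf {k : ℕ} (c : ZMod (k + 1) → V) : polygon (listOf c) = closedCurve c := by
  rw [polygon_eq (length_listOf c)]
  congr 1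
  ext i
  exact List.getElem_ofFn _

theorem exists_polygon {F : SimpleGraph V} {p : ℕ} (h : IsCycleOfLength F p) :
    ∃ l : List V, l.Nodup ∧ 3 ≤ l.length ∧ l.length = p ∧ F = polygon l := by
  obtain ⟨h3, c, hc, rfl⟩ := h
  obtain ⟨k, rfl⟩ : ∃ k, p = k + 1 := ⟨p - 1, by omega⟩
  exact ⟨listOf c, nodup_listOf hc, by rwa [length_listOf], length_listOf c,
    (polygon_listOf c).symm⟩

/-- Every edge of a cycle is the edge between the last two vertices of a polygon. -/
theorem exists_polygon_of_adj {F : SimpleGraph V} {p : ℕ} (h : IsCycleOfLength F p) {v w : V}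
    (hvw : F.Adj v w) : ∃ l : List V, (l ++ [w, v]).Nodup ∧ l.length + 2 = p ∧ 1 ≤ l.length ∧
      F = polygon (l ++ [w, v]) := by
  obtain ⟨h3, c, hc, rfl⟩ := h
  obtain ⟨d, hd, hdc, rfl, rfl⟩ := exists_closedCurve_of_adj h3 hc hvw
  obtain ⟨k, rfl⟩ : ∃ k, p = k + 1 + 1 := ⟨p - 2, by omega⟩
  -- As `ZMod (k + 1 + 1)` unfolds to `Fin (k + 1 + 1)`, the positions `-1` and `-2` are the last
  -- two places of the list.
  have e1 : (-1 : Fin (k + 1 + 1)) = Fin.last (k + 1) :=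
    (eq_neg_of_add_eq_zero_left (Fin.last_add_one _)).symm
  have e2 : (-1 : Fin (k + 1 + 1)) - 1 = Fin.castSucc (Fin.last k) := by
    rw [e1]
    refine Fin.ext ((Fin.coe_sub_one _).trans ?_)
    simp [Fin.ext_iff]
  have e1' : (-1 : ZMod (k + 1 + 1)) = (show ZMod (k + 1 + 1) from Fin.last (k + 1)) := e1
  have e2' : (-2 : ZMod (k + 1 + 1)) =
      (show ZMod (k + 1 + 1) from Fin.castSucc (Fin.last k)) := by
    refine Eq.trans ?_ e2
    change (-2 : ZMod (k + 1 + 1)) = (-1 : ZMod (k + 1 + 1)) - 1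
    ring
  have key : listOf d = List.ofFn (fun i : Fin k => d (show ZMod (k + 1 + 1) from
      Fin.castSucc (Fin.castSucc i))) ++ [d (-2), d (-1)] := by
    rw [listOf, List.ofFn_succ', List.ofFn_succ', e1', e2']
    simp only [List.concat_eq_append, List.append_assoc, List.cons_append, List.nil_append]
  refine ⟨_, key ▸ nodup_listOf hd, by rw [List.length_ofFn], by rw [List.length_ofFn]; omega, ?_⟩
  rw [← key, polygon_listOf, hdc]

theorem map_polygon (e : V ↪ W) (l : List V) : (polygon l).map e = polygon (l.map e) := by
  ext u w
  unfold polygon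
  rw [SimpleGraph.map_adj, SimpleGraph.fromRel_adj, corners_map]
  constructor
  · rintro ⟨a, b, hab, rfl, rfl⟩
    rw [SimpleGraph.fromRel_adj] at hab
    refine ⟨fun h => hab.1 (e.injective h), ?_⟩
    rcases hab.2 with ⟨p, hp⟩ | ⟨p, hp⟩
    · exact Or.inl ⟨e p, List.mem_map.2 ⟨_, hp, rfl⟩⟩
    · exact Or.inr ⟨e p, List.mem_map.2 ⟨_, hp, rfl⟩⟩
  · simp only [List.mem_map, Prod.mk.injEq]
    rintro ⟨hne, ⟨p, ⟨a, b, c⟩, h, -, rfl, rfl⟩ | ⟨p, ⟨a, b, c⟩, h, -, rfl, rfl⟩⟩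
    · exact ⟨b, c, SimpleGraph.fromRel_adj _ _ _ |>.2
        ⟨fun h => hne (by rw [h]), Or.inl ⟨_, h⟩⟩, rfl, rfl⟩
    · exact ⟨c, b, SimpleGraph.fromRel_adj _ _ _ |>.2
        ⟨fun h => hne (by rw [h]), Or.inr ⟨_, h⟩⟩, rfl, rfl⟩

end Lists
end SEM

/-! ### Meaning of the bit operations and list functions of the program -/

namespace SEM
open Function

section Evaluation

@[simp] theorem force_eq {α : Sort*} (n : ℕ) (k : ℕ → α) : force n k = k n := by
  cases n <;> rfl

@[simp] theorem forceList_eq {α β : Type*} (l : List α) (k : List α → β) :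
    forceList l k = k l := by
  induction l generalizing k with
  | nil => rfl
  | cons a t ih => exact ih _

@[simp] theorem allL_eq {α : Type*} (p : α → Bool) (l : List α) : allL p l = l.all p := by
  induction l with
  | nil => rfl
  | cons a t ih =>
    have : allL p (a :: t) = bif p a then allL p t else false := rfl
    rw [this, ih, List.all_cons]
    cases p a <;> rfl

@[simp] theorem lengthL_eq {α : Type*} (l : List α) : lengthL l = l.length := by
  induction l with
  | nil => rfl
  | cons a t ih => exact congrArg Nat.succ ih

theorem getBit_eq (m i : ℕ) : getBit m i = m.testBit i := by
  have h : getBit m i = Nat.beq (m >>> i &&& 1) 1 := rfl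
  rw [h, Nat.testBit, Nat.and_comm 1, Nat.and_one_is_mod]
  rcases Nat.mod_two_eq_zero_or_one (m >>> i) with h | h <;> rw [h] <;> rfl

theorem getBit_zero (i : ℕ) : getBit 0 i = false := by rw [getBit_eq, Nat.zero_testBit]

theorem getBit_lor (m n i : ℕ) : getBit (Nat.lor m n) i = (getBit m i || getBit n i) := by
  simp only [getBit_eq]; exact Nat.testBit_or m n i

theorem getBit_land (m n i : ℕ) : getBit (Nat.land m n) i = (getBit m i && getBit n i) := by
  simp only [getBit_eq]; exact Nat.testBit_and m n i

theorem getBit_xor (m n i : ℕ) : getBit (Nat.xor m n) i = (getBit m i ^^ getBit n i) := by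
  simp only [getBit_eq]; exact Nat.testBit_xor m n i

theorem getBit_single (a i : ℕ) : getBit (single a) i = true ↔ i = a := by
  have : single a = 2 ^ a := (Nat.shiftLeft_eq 1 a).trans (one_mul _)
  rw [getBit_eq, this, Nat.testBit_two_pow, decide_eq_true_iff, eq_comm]

theorem getBit_shiftLeft (m k i : ℕ) :
    getBit (Nat.shiftLeft m k) i = true ↔ k ≤ i ∧ getBit m (i - k) = true := by
  rw [getBit_eq, getBit_eq]
  have := Nat.testBit_shiftLeft m (i := k) (j := i)
  rw [show Nat.shiftLeft m k = m <<< k from rfl, this]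
  simp

theorem getBit_getRow (m a b : ℕ) :
    getBit (getRow m a) b = true ↔ b < 16 ∧ getBit m (16 * a + b) = true := by
  have h : getRow m a = (m >>> (16 * a)) &&& (2 ^ 16 - 1) := rfl
  rw [getBit_eq, getBit_eq, h, Nat.testBit_and, Nat.testBit_shiftRight,
    Nat.testBit_two_pow_sub_one]
  simp [and_comm]

/-- Membership in a row of a shifted small mask. -/
theorem getBit_shiftLeft_row {m : ℕ} (hm : ∀ i, getBit m i = true → i < 16) {a a' b : ℕ}
    (hb : b < 16) :
    getBit (Nat.shiftLeft m (Nat.mul 16 a')) (16 * a + b) = true ↔ a = a' ∧ getBit m b = true := by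
  rw [getBit_shiftLeft, show Nat.mul 16 a' = 16 * a' from rfl]
  constructor
  · rintro ⟨h1, h2⟩
    have := hm _ h2
    obtain rfl : a = a' := by omega
    refine ⟨rfl, ?_⟩
    rwa [Nat.add_sub_cancel_left] at h2
  · rintro ⟨rfl, h⟩
    exact ⟨by omega, by rwa [Nat.add_sub_cancel_left]⟩

theorem getBit_foldL_lor {α : Type*} (g : α → ℕ) (l : List α) (m i : ℕ) :
    getBit (foldL (fun m a => Nat.lor m (g a)) l m) i = true ↔
      getBit m i = true ∨ ∃ a ∈ l, getBit (g a) i = true := by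
  induction l generalizing m with
  | nil => simp [foldL]
  | cons a t ih =>
    refine (ih (Nat.lor m (g a))).trans ?_
    rw [getBit_lor]
    simp [or_assoc]

theorem getBit_toMask (l : List ℕ) (i : ℕ) : getBit (toMask l) i = true ↔ i ∈ l := by
  unfold toMask
  rw [getBit_foldL_lor, getBit_zero]
  simp [getBit_single]

/-- Labels below 16 keep the rows of the matrix from overlapping, so position `16 * a + b`
determines the pair. -/
theorem getBit_pairMask {f : List ℕ} (hf : ∀ a ∈ f, a < 16) {a b : ℕ} (hb : b < 16) :
    getBit (pairMask f) (16 * a + b) = true ↔ a ∈ f ∧ b ∈ f := by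
  unfold pairMask
  rw [force_eq, getBit_foldL_lor, getBit_zero]
  have : ∀ a', getBit (Nat.shiftLeft (toMask f) (Nat.mul 16 a')) (16 * a + b) = true ↔
      a = a' ∧ b ∈ f := fun a' => by
    rw [getBit_shiftLeft_row (fun i hi => hf i ((getBit_toMask f i).1 hi)) hb, getBit_toMask]
  simp only [this, Bool.false_eq_true, false_or]
  constructor
  · rintro ⟨a', ha', rfl, hb⟩
    exact ⟨ha', hb⟩
  · rintro ⟨ha, hb⟩
    exact ⟨a, ha, rfl, hb⟩

theorem getBit_edgeMask {cs : List (ℕ × ℕ × ℕ)} (hcs : ∀ c ∈ cs, c.1 < 16 ∧ c.2.2 < 16) {a b : ℕ}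
    (hb : b < 16) : getBit (edgeMask cs) (16 * a + b) = true ↔
      ∃ c ∈ cs, c.2.1 = a ∧ (b = c.1 ∨ b = c.2.2) := by
  unfold edgeMask
  rw [getBit_foldL_lor, getBit_zero]
  simp only [Bool.false_eq_true, false_or]
  refine exists_congr fun c => and_congr_right fun hc => ?_
  rw [getBit_shiftLeft_row _ hb, getBit_lor, Bool.or_eq_true, getBit_single, getBit_single,
    eq_comm]
  intro i
  rw [getBit_lor, Bool.or_eq_true, getBit_single, getBit_single]
  rintro (rfl | rfl)
  exacts [(hcs c hc).1, (hcs c hc).2]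

theorem nth_zero_cons {α : Type*} (a : List α) (t : List (List α)) : nth (a :: t) 0 = a := rfl
theorem nth_succ_cons {α : Type*} (a : List α) (t : List (List α)) (i : ℕ) :
    nth (a :: t) (i + 1) = nth t i := rfl
theorem nth_nil {α : Type*} (i : ℕ) : nth ([] : List (List α)) i = [] := by
  cases i <;> rfl

theorem nth_pushAt {α : Type*} (x : α) (l : List (List α)) (i j : ℕ) :
    nth (pushAt x l i) j = if j = i then x :: nth l j else nth l j := by
  induction i generalizing l j with
  | zero =>
    cases l with
    | nil =>
      have : pushAt x [] 0 = [[x]] := rfl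
      rw [this]
      cases j with
      | zero => simp [nth_zero_cons, nth_nil]
      | succ j => simp [nth_succ_cons, nth_nil]
    | cons a t =>
      have : pushAt x (a :: t) 0 = (x :: a) :: t := rfl
      rw [this]
      cases j with
      | zero => simp [nth_zero_cons]
      | succ j => simp [nth_succ_cons]
  | succ i ih =>
    cases l with
    | nil =>
      have : pushAt x [] (i + 1) = [] :: pushAt x [] i := rfl
      rw [this]
      cases j with
      | zero => simp [nth_zero_cons, nth_nil]
      | succ j => simp [nth_succ_cons, nth_nil, ih]
    | cons a t =>
      have : pushAt x (a :: t) (i + 1) = a :: pushAt x t i := rfl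
      rw [this]
      cases j with
      | zero => simp [nth_zero_cons]
      | succ j => simp [nth_succ_cons, ih]

theorem pushCorners_cons (s : ℕ) (c : ℕ × ℕ × ℕ) (cs : List (ℕ × ℕ × ℕ))
    (cor : List (List (ℕ × ℕ × ℕ))) :
    pushCorners s (c :: cs) cor = pushCorners s cs (pushAt (c.1, c.2.2, s) cor c.2.1) := rfl

theorem nth_pushCorners_of_notMem (s : ℕ) (cs : List (ℕ × ℕ × ℕ)) (cor : List (List (ℕ × ℕ × ℕ)))
    (a : ℕ) (h : a ∉ cs.map fun c => c.2.1) : nth (pushCorners s cs cor) a = nth cor a := by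
  induction cs generalizing cor with
  | nil => rfl
  | cons c cs ih =>
    simp only [List.map_cons, List.mem_cons, not_or] at h
    rw [pushCorners_cons, ih _ h.2, nth_pushAt, if_neg h.1]

theorem nth_pushCorners_of_mem (s : ℕ) (cs : List (ℕ × ℕ × ℕ)) (cor : List (List (ℕ × ℕ × ℕ)))
    (hcs : (cs.map fun c => c.2.1).Nodup) {c : ℕ × ℕ × ℕ} (hc : c ∈ cs) :
    nth (pushCorners s cs cor) c.2.1 = (c.1, c.2.2, s) :: nth cor c.2.1 := by
  induction cs generalizing cor with
  | nil => simp at hc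
  | cons d cs ih =>
    simp only [List.map_cons, List.nodup_cons] at hcs
    rw [pushCorners_cons]
    rcases List.mem_cons.1 hc with rfl | hc
    · rw [nth_pushCorners_of_notMem _ _ _ _ hcs.1, nth_pushAt, if_pos rfl]
    · rw [ih _ hcs.2 hc, nth_pushAt, if_neg]
      rintro h
      exact hcs.1 (h ▸ List.mem_map_of_mem hc)

theorem getBit_newFull (opn : ℕ) (f : List ℕ) (i : ℕ) :
    getBit (newFull opn f) i = true ↔ i ∈ f ∧ getRow opn i = 0 := by
  have h : ∀ m, getBit (foldL (fun m a => bif Nat.beq (getRow opn a) 0 then Nat.lor m (single a)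
      else m) f m) i = true ↔ getBit m i = true ∨ (i ∈ f ∧ getRow opn i = 0) := by
    induction f with
    | nil => simp [foldL]
    | cons a t ih =>
      intro m
      refine (ih _).trans ?_
      by_cases ha : getRow opn a = 0
      · have : Nat.beq (getRow opn a) 0 = true := by rw [ha]; rfl
        beta_reduce
        rw [this, cond_true, getBit_lor, Bool.or_eq_true, getBit_single, List.mem_cons]
        constructor
        · rintro ((h | rfl) | h)
          exacts [Or.inl h, Or.inr ⟨Or.inl rfl, ha⟩, Or.inr ⟨Or.inr h.1, h.2⟩]
        · rintro (h | ⟨rfl | h, h'⟩)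
          exacts [Or.inl (Or.inl h), Or.inl (Or.inr rfl), Or.inr ⟨h, h'⟩]
      · have : Nat.beq (getRow opn a) 0 = false := by
          rw [Bool.eq_false_iff]; exact fun h => ha (Nat.eq_of_beq_eq_true h)
        beta_reduce
        rw [this, cond_false, List.mem_cons]
        constructor
        · rintro (h | h)
          exacts [Or.inl h, Or.inr ⟨Or.inr h.1, h.2⟩]
        · rintro (h | ⟨rfl | h, h'⟩)
          exacts [Or.inl h, absurd h' ha, Or.inr ⟨h, h'⟩]
  have := h 0
  rwa [getBit_zero, Bool.false_eq_true, false_or] at this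

theorem getRow_eq_zero (m a : ℕ) : getRow m a = 0 ↔ ∀ b < 16, getBit m (16 * a + b) = false := by
  constructor
  · intro h b hb
    rw [Bool.eq_false_iff]
    intro h'
    have := (getBit_getRow m a b).2 ⟨hb, h'⟩
    rw [h, getBit_zero] at this
    exact absurd this (by decide)
  · intro h
    refine Nat.eq_of_testBit_eq fun i => ?_
    rw [← getBit_eq, ← getBit_eq, getBit_zero, Bool.eq_false_iff]
    intro h'
    obtain ⟨h1, h2⟩ := (getBit_getRow m a i).1 h'
    rw [h i h1] at h2
    exact absurd h2 (by decide)

end Evaluation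

/-! ### Local structure of polyhedral maps -/

namespace PolyhedralComplex
variable {V : Type*} {K : PolyhedralComplex V}

/-- Of the three kinds of intersection only a common edge has two different vertices. Every
exclusion of vertex pairs in the search comes from here. -/
theorem adj_of_common {F G : SimpleGraph V} (hF : F ∈ K.faces) (hG : G ∈ K.faces) (hne : F ≠ G)
    {u v : V} (huv : u ≠ v) (h1 : u ∈ F.support) (h2 : v ∈ F.support) (h3 : u ∈ G.support)
    (h4 : v ∈ G.support) : F.Adj u v ∧ G.Adj u v := by
  have hu : u ∈ F.support ∩ G.support := ⟨h1, h3⟩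
  have hv : v ∈ F.support ∩ G.support := ⟨h2, h4⟩
  rcases K.inter F hF G hG hne with h | ⟨x, h⟩ | ⟨a, b, ha, hb, h⟩
  · rw [h] at hu
    exact absurd hu (Set.notMem_empty _)
  · rw [h, Set.mem_singleton_iff] at hu hv
    exact absurd (hu.trans hv.symm) huv
  · rw [h, Set.mem_insert_iff, Set.mem_singleton_iff] at hu hv
    rcases hu with rfl | rfl <;> rcases hv with rfl | rfl
    exacts [absurd rfl huv, ⟨ha, hb⟩, ⟨ha.symm, hb.symm⟩, absurd rfl huv]

theorem exists_nbrs {F : SimpleGraph V} (hF : F ∈ K.faces) {v : V} (hv : v ∈ F.support) :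
    ∃ a b, a ≠ b ∧ ∀ x, F.Adj v x ↔ x = a ∨ x = b := by
  obtain ⟨p, hp⟩ := K.isCycle F hF
  obtain ⟨l, hn, h3, -, rfl⟩ := exists_polygon hp
  obtain ⟨a, b, h⟩ := exists_corner ((mem_support_polygon hn h3).1 hv)
  exact ⟨a, b, ne_of_corner hn h3 h, fun x => polygon_adj_of_corner hn h3 h⟩

theorem eq_or_eq_of_adj {F : SimpleGraph V} (hF : F ∈ K.faces) {v a b x : V} (ha : F.Adj v a)
    (hb : F.Adj v b) (hab : a ≠ b) (hx : F.Adj v x) : x = a ∨ x = b := by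
  obtain ⟨c, d, -, h⟩ := exists_nbrs hF ((SimpleGraph.mem_support _).2 ⟨a, ha⟩)
  rw [h] at ha hb hx
  rcases ha with rfl | rfl <;> rcases hb with rfl | rfl <;> tauto

theorem exists_mem_support {F : SimpleGraph V} (hF : F ∈ K.faces) : ∃ v, v ∈ F.support := by
  obtain ⟨p, hp⟩ := K.isCycle F hF
  obtain ⟨l, hn, h3, -, rfl⟩ := exists_polygon hp
  obtain ⟨a, ha⟩ : ∃ a, a ∈ l := List.exists_mem_of_length_pos (by omega)
  exact ⟨a, (mem_support_polygon hn h3).2 ha⟩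

section Umbrella
variable {v : V} {m : ℕ} {f : ZMod m → SimpleGraph V} {w : ZMod m → V}

theorem IsUmbrella.mem (h : K.IsUmbrella v f w) (i : ZMod m) : f i ∈ K.faces :=
  (h.2.2.2.1 ▸ Set.mem_range_self i : f i ∈ K.facesAt v).1

theorem IsUmbrella.adj_iff (h : K.IsUmbrella v f w) {i : ZMod m} {x : V} :
    (f i).Adj v x ↔ x = w i ∨ x = w (i + 1) := by
  obtain ⟨h3, hf, hw, hr, ha⟩ := h
  constructor
  · intro hx
    refine eq_or_eq_of_adj (IsUmbrella.mem ⟨h3, hf, hw, hr, ha⟩ i) (ha i).1 (ha i).2 ?_ hx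
    intro h
    exact zmod_one_ne_zero h3 (by simpa using hw h)
  · rintro (rfl | rfl)
    exacts [(ha i).1, (ha i).2]

theorem IsUmbrella.exists_eq (h : K.IsUmbrella v f w) {F : SimpleGraph V} (hF : F ∈ K.faces)
    (hv : v ∈ F.support) : ∃ i, F = f i := by
  have : F ∈ Set.range f := h.2.2.2.1 ▸ ⟨hF, hv⟩
  exact this.imp fun _ => Eq.symm

theorem IsUmbrella.exists_of_adj (h : K.IsUmbrella v f w) {F : SimpleGraph V} (hF : F ∈ K.faces)
    {x : V} (hx : F.Adj v x) : ∃ i, x = w i ∧ (F = f i ∨ F = f (i - 1)) := by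
  obtain ⟨i, rfl⟩ := h.exists_eq hF ((SimpleGraph.mem_support _).2 ⟨x, hx⟩)
  rcases h.adj_iff.1 hx with rfl | rfl
  · exact ⟨i, rfl, Or.inl rfl⟩
  · exact ⟨i + 1, rfl, Or.inr (by simp)⟩

/-- The face `f j` contains at `v` just the edges to `w j` and `w (j + 1)`, and `w` is injective. So
the edge to `w i` belongs to two consecutive faces of the umbrella and to no others. -/
theorem IsUmbrella.adj_edge_iff (h : K.IsUmbrella v f w) {F : SimpleGraph V} (hF : F ∈ K.faces)
    {i : ZMod m} : F.Adj v (w i) ↔ F = f i ∨ F = f (i - 1) := by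
  constructor
  · intro hx
    obtain ⟨j, hj, hj'⟩ := h.exists_of_adj hF hx
    rwa [h.2.2.1 hj]
  · rintro (rfl | rfl)
    · exact (h.2.2.2.2 i).1
    · simpa using (h.2.2.2.2 (i - 1)).2

theorem IsUmbrella.pred_ne (h : K.IsUmbrella v f w) (i : ZMod m) : f (i - 1) ≠ f i := by
  intro h'
  exact zmod_one_ne_zero h.1 (by simpa using h.2.1 h')

theorem IsUmbrella.ncard (h : K.IsUmbrella v f w) : (K.facesAt v).ncard = m := by
  rw [← h.2.2.2.1, ← Set.image_univ, Set.ncard_image_of_injective _ h.2.1, Set.ncard_univ,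
    Nat.card_zmod]

/-- Consecutive faces of the umbrella share an edge at `v`. Starting from one face in `S`, the
closure property carries membership once around the cycle. -/
theorem IsUmbrella.subset_of_closed (h : K.IsUmbrella v f w) {S : Set (SimpleGraph V)}
    {F : SimpleGraph V} (hF : F ∈ K.faces) (hFS : F ∈ S) (hv : v ∈ F.support)
    (hS : ∀ F ∈ K.faces, F ∈ S → ∀ x, F.Adj v x → ∀ G ∈ K.faces, G.Adj v x → G ∈ S) :
    K.facesAt v ⊆ S := by
  obtain ⟨i, rfl⟩ := h.exists_eq hF hv
  have step : ∀ n : ℕ, f (i + n) ∈ S := by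
    intro n
    induction n with
    | zero => simpa using hFS
    | succ n ih =>
      refine hS _ (h.mem _) ih _ (h.2.2.2.2 _).2 _ (h.mem _) ?_
      have := (h.2.2.2.2 (i + n + 1)).1
      push_cast
      rwa [← add_assoc]
  have : NeZero m := ⟨by have := h.1; omega⟩
  rintro G ⟨hG, hGv⟩
  obtain ⟨j, rfl⟩ := h.exists_eq hG hGv
  have := step (j - i).val
  rwa [ZMod.natCast_zmod_val, add_sub_cancel] at this

end Umbrella

/-- In the umbrella at `u` the edge to `v` separates two consecutive faces. Hence every edge lies in
exactly two faces. -/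
theorem IsMap.exists_other (hK : K.IsMap) {F : SimpleGraph V} (hF : F ∈ K.faces) {u v : V}
    (h : F.Adj u v) : ∃ G ∈ K.faces, G ≠ F ∧ G.Adj u v ∧
      ∀ H ∈ K.faces, H.Adj u v → H = F ∨ H = G := by
  obtain ⟨m, f, w, hu⟩ := hK.2.2 u
  obtain ⟨i, rfl, rfl | rfl⟩ := hu.exists_of_adj hF h
  · exact ⟨f (i - 1), hu.mem _, hu.pred_ne i, (hu.adj_edge_iff (hu.mem _)).2 (Or.inr rfl),
      fun H hH hHa => (hu.adj_edge_iff hH).1 hHa⟩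
  · exact ⟨f i, hu.mem _, (hu.pred_ne i).symm, (hu.adj_edge_iff (hu.mem _)).2 (Or.inl rfl),
      fun H hH hHa => ((hu.adj_edge_iff hH).1 hHa).symm⟩

theorem IsMap.facesAt_subset (hK : K.IsMap) {S : Set (SimpleGraph V)} {v : V}
    {F : SimpleGraph V} (hF : F ∈ K.faces) (hFS : F ∈ S) (hv : v ∈ F.support)
    (hS : ∀ F ∈ K.faces, F ∈ S → ∀ x, F.Adj v x → ∀ G ∈ K.faces, G.Adj v x → G ∈ S) :
    K.facesAt v ⊆ S := by
  obtain ⟨m, f, w, hu⟩ := hK.2.2 v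
  exact hu.subset_of_closed hF hFS hv hS

theorem edgeGraph_adj {u v : V} : K.edgeGraph.Adj u v ↔ ∃ F ∈ K.faces, F.Adj u v := by
  unfold edgeGraph
  rw [SimpleGraph.sSup_adj]

/-- A set of faces closed under crossing edges contains with one face at a vertex all faces at it.
Along a path in the connected edge graph this property passes from vertex to vertex. -/
theorem IsMap.eq_faces_of_closed (hK : K.IsMap) {S : Set (SimpleGraph V)} (hSK : S ⊆ K.faces)
    (hne : S.Nonempty)
    (hS : ∀ F ∈ S, ∀ u x, F.Adj u x → ∀ G ∈ K.faces, G.Adj u x → G ∈ S) : S = K.faces := by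
  refine hSK.antisymm fun G hG => ?_
  have star : ∀ F ∈ S, ∀ v ∈ F.support, K.facesAt v ⊆ S := fun F hF v hv =>
    hK.facesAt_subset (hSK hF) hF hv fun F _ hFS x => hS F hFS v x
  obtain ⟨F, hF⟩ := hne
  obtain ⟨u, hu⟩ := exists_mem_support (hSK hF)
  obtain ⟨v, hv⟩ := exists_mem_support hG
  have key : ∀ x, Relation.ReflTransGen K.edgeGraph.Adj u x → ∃ F ∈ S, x ∈ F.support := by
    intro x hx
    induction hx with
    | refl => exact ⟨F, hF, hu⟩
    | tail _ hbc ih =>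
      obtain ⟨F, hF, hb⟩ := ih
      obtain ⟨H, hH, hbc⟩ := edgeGraph_adj.1 hbc
      exact ⟨H, star F hF _ hb ⟨hH, (SimpleGraph.mem_support _).2 ⟨_, hbc⟩⟩,
        (SimpleGraph.mem_support _).2 ⟨_, hbc.symm⟩⟩
  obtain ⟨F', hF', hv'⟩ := key v ((SimpleGraph.reachable_iff_reflTransGen _ _).1
    (hK.2.1.preconnected u v))
  exact star F' hF' v hv' ⟨hG, hv⟩

/-- The map `K` satisfies the local conditions that the search uses. -/
structure Respects (K : PolyhedralComplex V) (sp : LocalSpec) : Prop where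
  isMap : K.IsMap
  card_le : Nat.card V ≤ sp.bound
  bound_le : sp.bound ≤ 15
  deg : ∀ v, (K.facesAt v).ncard = sp.deg
  size_mem : ∀ F ∈ K.faces, faceSize F ∈ sp.sizes
  cap : ∀ v s, {F ∈ K.facesAt v | faceSize F = s}.ncard ≤ capOf sp s
  triple : ∀ F ∈ K.faces, ∀ G ∈ K.faces, ∀ H ∈ K.faces, ∀ v x y, x ≠ y → F.Adj v x → F.Adj v y →
    G ≠ F → G.Adj v x → H ≠ F → H.Adj v y → ∀ p q, (p = 0 ∨ p = faceSize G) →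
    (q = 0 ∨ q = faceSize H) → getBit sp.triples (tripleCode p (faceSize F) q) = true

end PolyhedralComplex
end SEM

/-! ### The invariant of the search and the tests at a vertex -/

namespace SEM
open Function
namespace PolyhedralComplex
variable {V : Type*} {K : PolyhedralComplex V}

/-- `c` records the neighbours of the vertex labelled `a` in the face `F`, and the size of `F`. -/
structure IsCorner (φ : ℕ → V) (nv a : ℕ) (c : ℕ × ℕ × ℕ) (F : SimpleGraph V) : Prop where
  lt₁ : c.1 < nv
  lt₂ : c.2.1 < nv
  ne : c.1 ≠ c.2.1
  adj₁ : F.Adj (φ a) (φ c.1)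
  adj₂ : F.Adj (φ a) (φ c.2.1)
  size : faceSize F = c.2.2

/-- The labelling `φ` of some vertices of `K` turns the faces listed in `st` into the set `S` of
faces of `K`, and what `st` records about the faces outside of `S` is correct. -/
structure Realizes (K : PolyhedralComplex V) (φ : ℕ → V) (st : State) (S : Set (SimpleGraph V)) :
    Prop where
  inj : ∀ a < st.nv, ∀ b < st.nv, φ a = φ b → a = b
  mem_iff : ∀ F, F ∈ S ↔ ∃ l ∈ st.faces, F = polygon (l.map φ)
  lt : ∀ l ∈ st.faces, ∀ a ∈ l, a < st.nv
  sub : S ⊆ K.faces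
  label : ∀ F ∈ S, ∀ x ∈ F.support, ∃ a < st.nv, φ a = x
  full : ∀ a, getBit st.full a = true → a < st.nv ∧ K.facesAt (φ a) ⊆ S
  edgeObs : ∀ a < 16, ∀ b < 16, getBit st.edgeObs (16 * a + b) = true →
    a < st.nv ∧ b < st.nv ∧ ∀ F ∈ K.faces, F ∉ S → ¬F.Adj (φ a) (φ b)
  pairObs : ∀ a < 16, ∀ b < 16, getBit st.pairObs (16 * a + b) = true →
    a < st.nv ∧ b < st.nv ∧ ∀ F ∈ K.faces, F ∉ S → φ a ∈ F.support → φ b ∈ F.support →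
      φ a ≠ φ b → F.Adj (φ a) (φ b)
  opn : ∀ a < 16, ∀ b < 16, getBit st.opn (16 * a + b) = true →
    a < st.nv ∧ b < st.nv ∧ (∃ F ∈ S, F.Adj (φ a) (φ b)) ∧
      ∃ F ∈ K.faces, F ∉ S ∧ F.Adj (φ a) (φ b)
  closed : ∀ a < st.nv, ∀ b < st.nv, getBit st.opn (16 * a + b) = false → ∀ F ∈ S,
    F.Adj (φ a) (φ b) → ∀ G ∈ K.faces, G.Adj (φ a) (φ b) → G ∈ S
  cor : ∀ a < st.nv, ∃ Fs : List (SimpleGraph V), Fs.Nodup ∧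
    (∀ F, F ∈ Fs ↔ F ∈ S ∧ φ a ∈ F.support) ∧
    List.Forall₂ (IsCorner φ st.nv a) (nth st.cor a) Fs
  cor_nil : ∀ a, st.nv ≤ a → nth st.cor a = []

theorem exists_of_forall₂ {α β : Type*} {R : α → β → Prop} {l : List α} {l' : List β}
    (h : List.Forall₂ R l l') {a : α} (ha : a ∈ l) : ∃ b ∈ l', R a b := by
  induction h with
  | nil => simp at ha
  | cons hab _ ih =>
    rcases List.mem_cons.1 ha with rfl | ha
    · exact ⟨_, List.mem_cons_self, hab⟩
    · obtain ⟨b, hb, h⟩ := ih ha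
      exact ⟨b, List.mem_cons_of_mem _ hb, h⟩

theorem ncard_setOf_mem {α : Type*} {l : List α} (h : l.Nodup) : {x | x ∈ l}.ncard = l.length := by
  classical
  have : {x | x ∈ l} = (l.toFinset : Set α) := by ext; simp
  rw [this, Set.ncard_coe_finset, List.toFinset_card_of_nodup h]

theorem IsMap.finite_faces (hK : K.IsMap) : K.faces.Finite := by
  have := hK.1
  exact Set.toFinite _

theorem countSize_cons (d : ℕ × ℕ × ℕ) (C : List (ℕ × ℕ × ℕ)) (s : ℕ) :
    countSize (d :: C) s = bif Nat.beq d.2.2 s then Nat.succ (countSize C s) else countSize C s :=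
  rfl

theorem acrossSize_cons (d : ℕ × ℕ × ℕ) (C : List (ℕ × ℕ × ℕ)) (x y : ℕ) :
    acrossSize (d :: C) x y = bif bif Nat.beq d.1 x then !Nat.beq d.2.1 y
      else bif Nat.beq d.2.1 x then !Nat.beq d.1 y else false
    then d.2.2 else acrossSize C x y := rfl

theorem acrossSize_eq (C : List (ℕ × ℕ × ℕ)) (x y : ℕ) : acrossSize C x y = 0 ∨
    ∃ d ∈ C, acrossSize C x y = d.2.2 ∧ ((d.1 = x ∧ d.2.1 ≠ y) ∨ (d.2.1 = x ∧ d.1 ≠ y)) := by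
  have hb : ∀ a b, Nat.beq a b = decide (a = b) := fun a b => by
    rw [Bool.eq_iff_iff, decide_eq_true_iff, Nat.beq_eq]
  induction C with
  | nil => exact Or.inl rfl
  | cons d C ih =>
    rw [acrossSize_cons]
    simp only [hb]
    by_cases h : ((d.1 = x ∧ d.2.1 ≠ y) ∨ (d.2.1 = x ∧ d.1 ≠ y))
    · by_cases h1 : d.1 = x <;> by_cases h2 : d.2.1 = x <;> by_cases h3 : d.1 = y <;>
        by_cases h4 : d.2.1 = y <;> simp_all
    · have : (bif decide (d.1 = x) then !decide (d.2.1 = y)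
          else bif decide (d.2.1 = x) then !decide (d.1 = y) else false) = false := by
        by_cases h1 : d.1 = x <;> by_cases h2 : d.2.1 = x <;> by_cases h3 : d.1 = y <;>
        by_cases h4 : d.2.1 = y <;> simp_all
      rw [this, cond_false]
      rcases ih with ih | ⟨e, he, h'⟩
      · exact Or.inl ih
      · exact Or.inr ⟨e, List.mem_cons_of_mem _ he, h'⟩

theorem countSize_eq {φ : ℕ → V} {nv a : ℕ} {C : List (ℕ × ℕ × ℕ)} {Fs : List (SimpleGraph V)}
    (h : List.Forall₂ (IsCorner φ nv a) C Fs) (s : ℕ) :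
    countSize C s = (Fs.filter fun F => decide (faceSize F = s)).length := by
  induction h with
  | nil => rfl
  | @cons c F C Fs hc _ ih =>
    rw [countSize_cons, List.filter_cons, hc.size, ih]
    by_cases hs : c.2.2 = s
    · rw [hs, Nat.beq_refl, cond_true]; simp
    · have : Nat.beq c.2.2 s = false := by
        rw [Bool.eq_false_iff]; exact fun h => hs (Nat.eq_of_beq_eq_true h)
      rw [this, cond_false]; simp [hs]

namespace Realizes
variable {sp : LocalSpec} {φ : ℕ → V} {st : State} {S : Set (SimpleGraph V)}

/-- The labels in use name different vertices. -/
theorem nv_le (h : Realizes K φ st S) (hK : K.Respects sp) : st.nv ≤ sp.bound := by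
  have := hK.isMap.1
  have hi : Injective fun i : Fin st.nv => φ i := fun a b hab =>
    Fin.ext (h.inj _ a.2 _ b.2 hab)
  have := Nat.card_le_card_of_injective _ hi
  rw [Nat.card_eq_fintype_card, Fintype.card_fin] at this
  exact this.trans hK.card_le

theorem nv_lt (h : Realizes K φ st S) (hK : K.Respects sp) : st.nv < 16 := by
  have h1 := h.nv_le hK
  have h2 := hK.bound_le
  omega

/-- A vertex without open edges that lies in a listed face has all its faces listed. -/
theorem facesAt_subset (hK : K.Respects sp) {nv opn : ℕ} (hnv : nv < 16) (hS : S ⊆ K.faces)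
    (label : ∀ F ∈ S, ∀ x ∈ F.support, ∃ a < nv, φ a = x)
    (closed : ∀ a < nv, ∀ b < nv, getBit opn (16 * a + b) = false → ∀ F ∈ S,
      F.Adj (φ a) (φ b) → ∀ G ∈ K.faces, G.Adj (φ a) (φ b) → G ∈ S) {a : ℕ} (ha : a < nv)
    (hrow : getRow opn a = 0) {F : SimpleGraph V} (hF : F ∈ S) (haF : φ a ∈ F.support) :
    K.facesAt (φ a) ⊆ S := by
  refine hK.isMap.facesAt_subset (hS hF) hF haF fun G _ hGS x hx H hH hHx => ?_
  obtain ⟨b, hb, rfl⟩ := label G hGS x ((SimpleGraph.mem_support _).2 ⟨_, hx.symm⟩)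
  exact closed a ha b hb ((getRow_eq_zero _ _).1 hrow b (hb.trans hnv)) G hGS hx H hH hHx

theorem length_cor (h : Realizes K φ st S) {a : ℕ} (ha : a < st.nv) :
    (nth st.cor a).length = (S ∩ K.facesAt (φ a)).ncard := by
  obtain ⟨Fs, hn, hFs, hc⟩ := h.cor a ha
  rw [hc.length_eq, ← ncard_setOf_mem hn]
  congr 1
  ext F
  simp only [Set.mem_ofPred_eq, hFs, Set.mem_inter_iff, facesAt]
  exact ⟨fun ⟨h1, h2⟩ => ⟨h1, h.sub h1, h2⟩, fun ⟨h1, _, h2⟩ => ⟨h1, h2⟩⟩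

/-- `X` is left free for two uses: all faces of size `s` at the vertex, for the test after a face
has been added, and those other than the missing face, for the test before. -/
theorem countSize_le (h : Realizes K φ st S) (hK : K.Respects sp) {a : ℕ} (ha : a < st.nv)
    {s : ℕ} {X : Set (SimpleGraph V)} (hX : X ⊆ K.faces)
    (hSX : ∀ F ∈ S, φ a ∈ F.support → faceSize F = s → F ∈ X) :
    countSize (nth st.cor a) s ≤ X.ncard := by
  obtain ⟨Fs, hn, hFs, hc⟩ := h.cor a ha
  rw [countSize_eq hc, ← ncard_setOf_mem (hn.filter _)]
  refine Set.ncard_le_ncard ?_ (hK.isMap.finite_faces.subset hX)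
  intro F hF
  simp only [Set.mem_ofPred_eq, List.mem_filter, decide_eq_true_eq, hFs] at hF
  exact hSX F hF.1.1 hF.1.2 hF.2

theorem exists_across (h : Realizes K φ st S) (hK : K.Respects sp) {a : ℕ} (ha : a < st.nv)
    {F : SimpleGraph V} (hF : F ∈ K.faces) {x y : ℕ} (hx : x < st.nv) (hy : y < st.nv)
    (hxy : x ≠ y) (hFx : F.Adj (φ a) (φ x)) (hFy : F.Adj (φ a) (φ y)) :
    ∃ G ∈ K.faces, G ≠ F ∧ G.Adj (φ a) (φ x) ∧
      (acrossSize (nth st.cor a) x y = 0 ∨ acrossSize (nth st.cor a) x y = faceSize G) := by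
  obtain ⟨Fs, hn, hFs, hc⟩ := h.cor a ha
  rcases acrossSize_eq (nth st.cor a) x y with h0 | ⟨d, hd, hd', hdx⟩
  · obtain ⟨G, hG, hGF, hGx, -⟩ := hK.isMap.exists_other hF hFx
    exact ⟨G, hG, hGF, hGx, Or.inl h0⟩
  · obtain ⟨G, hG, hcG⟩ := exists_of_forall₂ hc hd
    refine ⟨G, h.sub ((hFs G).1 hG).1, ?_, ?_, Or.inr (hd'.trans hcG.size.symm)⟩
    -- If the corner found belonged to `F` itself, its two different ends would be `x` and `y`,
    -- against the condition that one end is `x` and the other is not `y`.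
    · rintro rfl
      have key : ∀ z < st.nv, G.Adj (φ a) (φ z) → z = x ∨ z = y := fun z hz hGz =>
        (eq_or_eq_of_adj hF hFx hFy (fun e => hxy (h.inj _ hx _ hy e)) hGz).imp
          (h.inj _ hz _ hx) (h.inj _ hz _ hy)
      have h1 := key _ hcG.lt₁ hcG.adj₁
      have h2 := key _ hcG.lt₂ hcG.adj₂
      have h3 := hcG.ne
      rcases hdx with ⟨e1, e2⟩ | ⟨e1, e2⟩ <;> grind
    · rcases hdx with ⟨rfl, -⟩ | ⟨rfl, -⟩
      exacts [hcG.adj₁, hcG.adj₂]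

/-- The conditions hold for every corner listed at the vertex, whatever `c` is. The comparison with
`c` in `vertexOK` merely skips corners whose neighbourhood has not changed. -/
theorem vertexOK_eq_true (h : Realizes K φ st S) (hK : K.Respects sp) {a : ℕ} (ha : a < st.nv)
    {F : SimpleGraph V} (hF : F ∈ S) (haF : φ a ∈ F.support) (c : ℕ × ℕ × ℕ) :
    vertexOK sp st.opn c (nth st.cor a) a = true := by
  have h1 : (bif Nat.beq (getRow st.opn a) 0 then Nat.beq (lengthL (nth st.cor a)) sp.deg
    else Nat.blt (lengthL (nth st.cor a)) sp.deg) = true := by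
    rw [lengthL_eq, h.length_cor ha]
    by_cases hr : getRow st.opn a = 0
    · rw [hr, Nat.beq_refl, cond_true, Nat.beq_eq, Set.inter_eq_right.2, hK.deg]
      exact facesAt_subset hK (h.nv_lt hK) h.sub h.label h.closed ha hr hF haF
    · have : Nat.beq (getRow st.opn a) 0 = false := by
        rw [Bool.eq_false_iff]; exact fun h => hr (Nat.eq_of_beq_eq_true h)
      rw [this, cond_false, ← hK.deg (φ a)]
      rw [getRow_eq_zero] at hr
      push Not at hr
      obtain ⟨b, hb, hr⟩ := hr
      obtain ⟨-, -, -, G, hG, hGS, hGa⟩ := h.opn a (ha.trans (h.nv_lt hK)) b hb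
        (by simpa using hr)
      refine (decide_eq_true_iff (p := _ < _)).1 ?_ |> fun (h : _ < _) => by
        simpa [Nat.blt] using h
      refine decide_eq_true (Set.ncard_lt_ncard ?_
        (hK.isMap.finite_faces.subset fun F hF => hF.1))
      refine ⟨Set.inter_subset_right, fun hsub => hGS ?_⟩
      exact (hsub ⟨hG, (SimpleGraph.mem_support _).2 ⟨_, hGa⟩⟩).1
  have h2 : Nat.ble (countSize (nth st.cor a) c.2.2) (capOf sp c.2.2) = true := by
    refine Nat.ble_eq_true_of_le ((h.countSize_le hK ha (s := c.2.2)
      (X := {F ∈ K.facesAt (φ a) | faceSize F = c.2.2}) (fun F hF => hF.1.1) ?_).trans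
      (hK.cap _ _))
    exact fun F hF haF hs => ⟨⟨h.sub hF, haF⟩, hs⟩
  unfold vertexOK
  rw [h1, cond_true, h2, cond_true, allL_eq, List.all_eq_true]
  intro d hd
  obtain ⟨Fs, hn, hFs, hc⟩ := h.cor a ha
  obtain ⟨D, hD, hcD⟩ := exists_of_forall₂ hc hd
  have hDK := h.sub ((hFs D).1 hD).1
  obtain ⟨G, hG, hGD, hGx, hp⟩ :=
    h.exists_across hK ha hDK hcD.lt₁ hcD.lt₂ hcD.ne hcD.adj₁ hcD.adj₂
  obtain ⟨H, hH, hHD, hHx, hq⟩ :=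
    h.exists_across hK ha hDK hcD.lt₂ hcD.lt₁ hcD.ne.symm hcD.adj₂ hcD.adj₁
  have := hK.triple D hDK G hG H hH (φ a) (φ d.1) (φ d.2.1)
    (fun e => hcD.ne (h.inj _ hcD.lt₁ _ hcD.lt₂ e)) hcD.adj₁ hcD.adj₂ hGD hGx hHD hHx _ _ hp hq
  rw [hcD.size] at this
  rw [this]
  cases meets c d <;> rfl

end Realizes
end PolyhedralComplex
end SEM

/-! ### Adding a face or a label to a state -/

namespace SEM
open Function
namespace PolyhedralComplex
variable {V : Type*} {K : PolyhedralComplex V}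
namespace Realizes
variable {sp : LocalSpec} {φ : ℕ → V} {st : State} {S : Set (SimpleGraph V)}

theorem beq_eq_false {a b : ℕ} (h : a ≠ b) : Nat.beq a b = false := by
  rw [Bool.eq_false_iff]; exact fun h' => h (Nat.eq_of_beq_eq_true h')

/-- The state after the face `f` has been added to `st`. -/
def pushFace (st : State) (f : List ℕ) : State :=
  let em := edgeMask (corners f)
  let opn := Nat.xor st.opn em
  { nv := st.nv
    full := Nat.lor st.full (newFull opn f)
    edgeObs := Nat.lor st.edgeObs (Nat.lor (Nat.xor (pairMask f) em) (Nat.land st.opn em))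
    pairObs := Nat.lor st.pairObs (pairMask f)
    opn := opn
    cor := pushCorners f.length (corners f) st.cor
    faces := f :: st.faces }

theorem nodup_map (h : Realizes K φ st S) {f : List ℕ} (hf : f.Nodup) (hlt : ∀ a ∈ f, a < st.nv) :
    (f.map φ).Nodup :=
  hf.map_on fun a ha b hb hab => h.inj a (hlt a ha) b (hlt b hb) hab

/-- An edge lies in exactly two faces, so the exclusive or with the edges of the new face opens an
edge at its first face and closes it at its second. The pairs excluded from further faces come from
`adj_of_common`, and from edges whose two faces are both listed. -/
theorem pushFace_realizes (h : Realizes K φ st S) (hK : K.Respects sp) {f : List ℕ}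
    (hf : f.Nodup) (h3 : 3 ≤ f.length) (hlt : ∀ a ∈ f, a < st.nv)
    (hFK : polygon (f.map φ) ∈ K.faces) (hFS : polygon (f.map φ) ∉ S) :
    Realizes K φ (pushFace st f) (insert (polygon (f.map φ)) S) := by
  have hnv := h.nv_lt hK
  have hnd := h.nodup_map hf hlt
  have h3' : 3 ≤ (f.map φ).length := by rwa [List.length_map]
  set F := polygon (f.map φ) with hF
  have hsupp : ∀ a < st.nv, φ a ∈ F.support ↔ a ∈ f := by
    intro a ha
    rw [hF, mem_support_polygon hnd h3', List.mem_map]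
    constructor
    · rintro ⟨b, hb, hab⟩
      rwa [← h.inj _ (hlt b hb) _ ha hab]
    · exact fun ha => ⟨a, ha, rfl⟩
  have hcor : ∀ c ∈ corners f, ∀ x, F.Adj (φ c.2.1) x ↔ x = φ c.1 ∨ x = φ c.2.2 := by
    intro c hc x
    refine polygon_adj_of_corner hnd h3' ?_
    rw [corners_map]
    exact List.mem_map.2 ⟨c, hc, rfl⟩
  have hcmem : ∀ c ∈ corners f, c.1 ∈ f ∧ c.2.1 ∈ f ∧ c.2.2 ∈ f := fun c hc => mem_of_corner hc
  have hem : ∀ a < 16, ∀ b < 16, getBit (edgeMask (corners f)) (16 * a + b) = true ↔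
      a < st.nv ∧ b < st.nv ∧ F.Adj (φ a) (φ b) := by
    intro a ha b hb
    rw [getBit_edgeMask (fun c hc => ⟨(hlt _ (hcmem c hc).1).trans hnv,
      (hlt _ (hcmem c hc).2.2).trans hnv⟩) hb]
    constructor
    · rintro ⟨c, hc, rfl, rfl | rfl⟩
      · exact ⟨hlt _ (hcmem c hc).2.1, hlt _ (hcmem c hc).1, (hcor c hc _).2 (Or.inl rfl)⟩
      · exact ⟨hlt _ (hcmem c hc).2.1, hlt _ (hcmem c hc).2.2, (hcor c hc _).2 (Or.inr rfl)⟩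
    · rintro ⟨ha, hb, hab⟩
      have haf := (hsupp a ha).1 ((SimpleGraph.mem_support _).2 ⟨_, hab⟩)
      obtain ⟨p, n, hc⟩ := exists_corner haf
      refine ⟨_, hc, rfl, ((hcor _ hc _).1 hab).imp (h.inj _ hb _ (hlt _ (hcmem _ hc).1))
        (h.inj _ hb _ (hlt _ (hcmem _ hc).2.2))⟩
  have hpm : ∀ a < 16, ∀ b < 16, getBit (pairMask f) (16 * a + b) = true ↔
      a < st.nv ∧ b < st.nv ∧ φ a ∈ F.support ∧ φ b ∈ F.support := by
    intro a ha b hb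
    rw [getBit_pairMask (fun a ha => (hlt a ha).trans hnv) hb]
    constructor
    · rintro ⟨ha, hb⟩
      exact ⟨hlt a ha, hlt b hb, (hsupp a (hlt a ha)).2 ha, (hsupp b (hlt b hb)).2 hb⟩
    · rintro ⟨ha, hb, ha', hb'⟩
      exact ⟨(hsupp a ha).1 ha', (hsupp b hb).1 hb'⟩
  have hsub : insert F S ⊆ K.faces := Set.insert_subset hFK h.sub
  have hlabel : ∀ G ∈ insert F S, ∀ x ∈ G.support, ∃ a < st.nv, φ a = x := by
    intro G hG x hx
    rcases Set.mem_insert_iff.1 hG with rfl | hG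
    · obtain ⟨a, ha, rfl⟩ := List.mem_map.1 ((mem_support_polygon hnd h3').1 hx)
      exact ⟨a, hlt a ha, rfl⟩
    · exact h.label G hG x hx
  -- An open edge already lies in a face of `S`. If it is an edge of `F` too, then these are its
  -- only two faces.
  have hboth : ∀ a < 16, ∀ b < 16, getBit st.opn (16 * a + b) = true →
      F.Adj (φ a) (φ b) → ∀ G ∈ K.faces, G.Adj (φ a) (φ b) → G ∈ insert F S := by
    intro a ha b hb ho hab G hG hGa
    obtain ⟨-, -, ⟨F₁, hF₁, hF₁a⟩, -⟩ := h.opn a ha b hb ho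
    obtain ⟨G', -, -, -, hall⟩ := hK.isMap.exists_other (h.sub hF₁) hF₁a
    have hFF₁ : F ≠ F₁ := fun e => hFS (e ▸ hF₁)
    obtain rfl : F = G' := (hall F hFK hab).resolve_left hFF₁
    rcases hall G hG hGa with rfl | rfl
    exacts [Set.mem_insert_of_mem _ hF₁, Set.mem_insert _ _]
  have hclosed : ∀ a < st.nv, ∀ b < st.nv,
      getBit (Nat.xor st.opn (edgeMask (corners f))) (16 * a + b) = false → ∀ F₁ ∈ insert F S,
      F₁.Adj (φ a) (φ b) → ∀ G ∈ K.faces, G.Adj (φ a) (φ b) → G ∈ insert F S := by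
    intro a ha b hb hx F₁ hF₁ hF₁a G hG hGa
    rw [getBit_xor] at hx
    cases ho : getBit st.opn (16 * a + b)
    · rw [ho, Bool.false_xor] at hx
      have hnot : ¬F.Adj (φ a) (φ b) := fun hab => by
        rw [(hem a (ha.trans hnv) b (hb.trans hnv)).2 ⟨ha, hb, hab⟩] at hx
        exact absurd hx (by decide)
      rcases Set.mem_insert_iff.1 hF₁ with rfl | hF₁
      · exact absurd hF₁a hnot
      · exact Set.mem_insert_of_mem _ (h.closed a ha b hb ho F₁ hF₁ hF₁a G hG hGa)
    · rw [ho, Bool.true_xor, Bool.not_eq_false', hem a (ha.trans hnv) b (hb.trans hnv)] at hx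
      exact hboth a (ha.trans hnv) b (hb.trans hnv) ho hx.2.2 G hG hGa
  refine ⟨h.inj, ?_, ?_, hsub, hlabel, ?_, ?_, ?_, ?_, hclosed, ?_, ?_⟩
  · intro G
    rw [Set.mem_insert_iff, h.mem_iff]
    simp [pushFace, hF]
  · intro l hl a ha
    rcases List.mem_cons.1 hl with rfl | hl
    · exact hlt a ha
    · exact h.lt l hl a ha
  · intro a ha
    rcases Bool.or_eq_true _ _ ▸ (getBit_lor _ _ _).symm.trans ha with ha | ha
    · exact ⟨(h.full a ha).1, (h.full a ha).2.trans (Set.subset_insert _ _)⟩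
    · obtain ⟨haf, hrow⟩ := (getBit_newFull _ _ _).1 ha
      exact ⟨hlt a haf, facesAt_subset hK hnv hsub hlabel hclosed (hlt a haf) hrow
        (Set.mem_insert _ _) ((hsupp a (hlt a haf)).2 haf)⟩
  · intro a ha b hb hbit
    change getBit (Nat.lor _ (Nat.lor (Nat.xor _ _) (Nat.land _ _))) _ = true at hbit
    rw [getBit_lor, getBit_lor, getBit_xor, getBit_land, Bool.or_eq_true, Bool.or_eq_true] at hbit
    rcases hbit with hbit | hbit | hbit
    · obtain ⟨h1, h2, h4⟩ := h.edgeObs a ha b hb hbit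
      exact ⟨h1, h2, fun G hG hGS => h4 G hG fun hGS' => hGS (Set.mem_insert_of_mem _ hGS')⟩
    -- `pairMask f` contains `edgeMask (corners f)`, so their exclusive or marks the nonadjacent
    -- pairs of the new face. No other face can have such a pair as an edge.
    · have he : getBit (pairMask f) (16 * a + b) = true ∧ ¬F.Adj (φ a) (φ b) := by
        cases hp : getBit (pairMask f) (16 * a + b)
        · rw [hp, Bool.false_xor] at hbit
          obtain ⟨h1, h2, hadj⟩ := (hem a ha b hb).1 hbit
          have := (hpm a ha b hb).2 ⟨h1, h2, (SimpleGraph.mem_support _).2 ⟨_, hadj⟩,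
            (SimpleGraph.mem_support _).2 ⟨_, hadj.symm⟩⟩
          rw [hp] at this
          exact absurd this (by decide)
        · refine ⟨rfl, fun hadj => ?_⟩
          have h12 := (hpm a ha b hb).1 hp
          rw [hp, (hem a ha b hb).2 ⟨h12.1, h12.2.1, hadj⟩] at hbit
          exact absurd hbit (by decide)
      obtain ⟨h1, h2, h4, h5⟩ := (hpm a ha b hb).1 he.1
      refine ⟨h1, h2, fun G hG hGS hadj => he.2 ?_⟩
      exact (adj_of_common hFK hG (fun e => hGS (e ▸ Set.mem_insert _ _)) hadj.ne h4 h5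
        ((SimpleGraph.mem_support _).2 ⟨_, hadj⟩)
        ((SimpleGraph.mem_support _).2 ⟨_, hadj.symm⟩)).1
    · rw [Bool.and_eq_true, hem a ha b hb] at hbit
      exact ⟨hbit.2.1, hbit.2.2.1, fun G hG hGS hadj =>
        hGS (hboth a ha b hb hbit.1 hbit.2.2.2 G hG hadj)⟩
  · intro a ha b hb hbit
    change getBit (Nat.lor _ _) _ = true at hbit
    rw [getBit_lor, Bool.or_eq_true] at hbit
    rcases hbit with hbit | hbit
    · obtain ⟨h1, h2, h4⟩ := h.pairObs a ha b hb hbit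
      exact ⟨h1, h2, fun G hG hGS => h4 G hG fun hGS' => hGS (Set.mem_insert_of_mem _ hGS')⟩
    · obtain ⟨h1, h2, h4, h5⟩ := (hpm a ha b hb).1 hbit
      refine ⟨h1, h2, fun G hG hGS ha' hb' hne => ?_⟩
      exact (adj_of_common hFK hG (fun e => hGS (e ▸ Set.mem_insert _ _)) hne h4 h5 ha' hb').2
  · intro a ha b hb hbit
    change getBit (Nat.xor _ _) _ = true at hbit
    rw [getBit_xor] at hbit
    cases ho : getBit st.opn (16 * a + b)
    · rw [ho, Bool.false_xor, hem a ha b hb] at hbit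
      obtain ⟨h1, h2, hadj⟩ := hbit
      obtain ⟨G, hG, hGF, hGa, -⟩ := hK.isMap.exists_other hFK hadj
      refine ⟨h1, h2, ⟨F, Set.mem_insert _ _, hadj⟩, G, hG, fun hGS => ?_, hGa⟩
      rcases Set.mem_insert_iff.1 hGS with e | hGS
      · exact hGF e
      · exact hFS (h.closed a h1 b h2 ho G hGS hGa F hFK hadj)
    · obtain ⟨h1, h2, ⟨F₁, hF₁, hF₁a⟩, G, hG, hGS, hGa⟩ := h.opn a ha b hb ho
      refine ⟨h1, h2, ⟨F₁, Set.mem_insert_of_mem _ hF₁, hF₁a⟩, G, hG, fun hGS' => ?_, hGa⟩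
      rcases Set.mem_insert_iff.1 hGS' with rfl | hGS'
      · rw [ho, (hem a ha b hb).2 ⟨h1, h2, hGa⟩] at hbit
        exact absurd hbit (by decide)
      · exact hGS hGS'
  · intro a ha
    obtain ⟨Fs, hn, hFs, hc⟩ := h.cor a ha
    by_cases haf : a ∈ f
    · obtain ⟨p, n, hcr⟩ := exists_corner haf
      refine ⟨F :: Fs, List.nodup_cons.2 ⟨fun hm => hFS ((hFs F).1 hm).1, hn⟩, ?_, ?_⟩
      · intro G
        rw [List.mem_cons, Set.mem_insert_iff, hFs]
        constructor
        · rintro (rfl | ⟨h1, h2⟩)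
          exacts [⟨Or.inl rfl, (hsupp a ha).2 haf⟩, ⟨Or.inr h1, h2⟩]
        · rintro ⟨rfl | h1, h2⟩
          exacts [Or.inl rfl, Or.inr ⟨h1, h2⟩]
      · have : nth (pushFace st f).cor a = (p, n, f.length) :: nth st.cor a :=
          nth_pushCorners_of_mem f.length (corners f) st.cor
            (by rw [map_center_corners]; exact hf) hcr
        rw [this]
        refine List.Forall₂.cons ⟨hlt _ (hcmem _ hcr).1, hlt _ (hcmem _ hcr).2.2,
          ne_of_corner hf h3 hcr, (hcor _ hcr _).2 (Or.inl rfl), (hcor _ hcr _).2 (Or.inr rfl),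
          ?_⟩ hc
        rw [hF, faceSize_polygon hnd h3', List.length_map]
    · refine ⟨Fs, hn, ?_, ?_⟩
      · intro G
        rw [hFs, Set.mem_insert_iff]
        constructor
        · rintro ⟨h1, h2⟩
          exact ⟨Or.inr h1, h2⟩
        · rintro ⟨rfl | h1, h2⟩
          exacts [absurd ((hsupp a ha).1 h2) haf, ⟨h1, h2⟩]
      · have : nth (pushFace st f).cor a = nth st.cor a :=
          nth_pushCorners_of_notMem f.length (corners f) st.cor a
            (by rw [map_center_corners]; exact haf)
        rwa [this]
  · intro a ha
    have : nth (pushFace st f).cor a = nth st.cor a :=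
      nth_pushCorners_of_notMem f.length (corners f) st.cor a
        (by rw [map_center_corners]; exact fun haf => absurd (hlt a haf) (not_lt.2 ha))
    rw [this]
    exact h.cor_nil a ha

/-- New labels may be introduced without any change to the listed faces. -/
theorem relabel (h : Realizes K φ st S) {ψ : ℕ → V} {nv : ℕ} (hnv : st.nv ≤ nv)
    (hψ : ∀ a < st.nv, ψ a = φ a) (hinj : ∀ a < nv, ∀ b < nv, ψ a = ψ b → a = b) :
    Realizes K ψ { st with nv := nv } S := by
  refine ⟨hinj, ?_, fun l hl a ha => (h.lt l hl a ha).trans_le hnv, h.sub, ?_, ?_, ?_, ?_, ?_, ?_,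
    ?_, fun a ha => h.cor_nil a (hnv.trans ha)⟩
  · intro F
    rw [h.mem_iff]
    refine exists_congr fun l => and_congr_right fun hl => ?_
    rw [List.map_congr_left fun a ha => hψ a (h.lt l hl a ha)]
  · intro F hF x hx
    obtain ⟨a, ha, rfl⟩ := h.label F hF x hx
    exact ⟨a, ha.trans_le hnv, hψ a ha⟩
  · intro a ha
    obtain ⟨h1, h2⟩ := h.full a ha
    exact ⟨h1.trans_le hnv, by rwa [hψ a h1]⟩
  · intro a ha b hb hbit
    obtain ⟨h1, h2, h3⟩ := h.edgeObs a ha b hb hbit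
    exact ⟨h1.trans_le hnv, h2.trans_le hnv, by rwa [hψ a h1, hψ b h2]⟩
  · intro a ha b hb hbit
    obtain ⟨h1, h2, h3⟩ := h.pairObs a ha b hb hbit
    exact ⟨h1.trans_le hnv, h2.trans_le hnv, by rwa [hψ a h1, hψ b h2]⟩
  · intro a ha b hb hbit
    obtain ⟨h1, h2, h3⟩ := h.opn a ha b hb hbit
    exact ⟨h1.trans_le hnv, h2.trans_le hnv, by rwa [hψ a h1, hψ b h2]⟩
  · intro a ha b hb hbit F hF hab
    obtain ⟨a', ha', e⟩ := h.label F hF _ ((SimpleGraph.mem_support _).2 ⟨_, hab⟩)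
    obtain ⟨b', hb', e'⟩ := h.label F hF _ ((SimpleGraph.mem_support _).2 ⟨_, hab.symm⟩)
    obtain rfl : a' = a := hinj _ (ha'.trans_le hnv) _ ha ((hψ a' ha').trans e)
    obtain rfl : b' = b := hinj _ (hb'.trans_le hnv) _ hb ((hψ b' hb').trans e')
    rw [hψ _ ha', hψ _ hb'] at hab ⊢
    exact h.closed a' ha' b' hb' hbit F hF hab
  · intro a ha
    by_cases ha' : a < st.nv
    · obtain ⟨Fs, hn, hFs, hc⟩ := h.cor a ha'
      refine ⟨Fs, hn, by rwa [hψ a ha'], hc.imp fun c F hcF => ⟨hcF.lt₁.trans_le hnv,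
        hcF.lt₂.trans_le hnv, hcF.ne, ?_, ?_, hcF.size⟩⟩
      · rw [hψ a ha', hψ _ hcF.lt₁]; exact hcF.adj₁
      · rw [hψ a ha', hψ _ hcF.lt₂]; exact hcF.adj₂
    · refine ⟨[], List.nodup_nil, fun F => ?_, ?_⟩
      · simp only [List.not_mem_nil, false_iff, not_and]
        intro hF hx
        obtain ⟨b, hb, e⟩ := h.label F hF _ hx
        have := hinj _ (hb.trans_le hnv) _ ha ((hψ b hb).trans e)
        omega
      · have : nth st.cor a = [] := h.cor_nil a (not_lt.1 ha')
        change List.Forall₂ _ (nth st.cor a) _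
        rw [this]
        exact List.Forall₂.nil

/-- `addFace` returns `true` without calling `k` when it meets a conflict. In a state realized by a
map there is none, so the value `true` was produced by `k`. -/
theorem addFace_eq_true (h : Realizes K φ st S) (hK : K.Respects sp) {f : List ℕ} {nv : ℕ}
    (hnv : nv = st.nv) (hf : f.Nodup) (h3 : 3 ≤ f.length) (hlt : ∀ a ∈ f, a < st.nv)
    (hFK : polygon (f.map φ) ∈ K.faces) (hFS : polygon (f.map φ) ∉ S) {k : State → Bool}
    (hk : addFace sp st f.length nv f k = true) : k (pushFace st f) = true := by
  subst hnv
  have h' := h.pushFace_realizes hK hf h3 hlt hFK hFS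
  unfold addFace at hk
  simp only [forceList_eq, force_eq] at hk
  have : allL (fun c => vertexOK sp (Nat.xor st.opn (edgeMask (corners f)))
      (c.1, c.2.2, f.length) (nth (pushCorners f.length (corners f) st.cor) c.2.1) c.2.1)
      (corners f) = true := by
    rw [allL_eq, List.all_eq_true]
    intro c hc
    have hcf := (mem_of_corner (a := c.1) (b := c.2.1) (c := c.2.2) hc).2.1
    refine h'.vertexOK_eq_true hK (hlt _ hcf) (Set.mem_insert _ _) ?_ _
    refine (mem_support_polygon (h.nodup_map hf hlt) (by rwa [List.length_map])).2 ?_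
    exact List.mem_map_of_mem hcf
  rw [this, cond_true] at hk
  exact hk

end Realizes
end PolyhedralComplex
end SEM

/-! ### Completeness of the search -/

namespace SEM
open Function

section Corners
variable {V : Type*}

theorem mem_cornersFrom_append (s p : V) (A : List V) (a b c : V) (B : List V) :
    (a, b, c) ∈ cornersFrom s p (A ++ a :: b :: c :: B) := by
  induction A generalizing p with
  | nil => simp
  | cons d A ih => exact List.mem_cons_of_mem _ (ih d)

theorem mem_cornersFrom_last (s p : V) (A : List V) (a b : V) :
    (a, b, s) ∈ cornersFrom s p (A ++ [a, b]) := by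
  induction A generalizing p with
  | nil => simp
  | cons d A ih => exact List.mem_cons_of_mem _ (ih d)

theorem mem_corners_append (A : List V) (a b c : V) (B : List V) :
    (a, b, c) ∈ corners (A ++ a :: b :: c :: B) := by
  cases A with
  | nil => exact mem_cornersFrom_append _ _ [] _ _ _ _
  | cons d A => exact mem_cornersFrom_append _ _ (d :: A) _ _ _ _

theorem mem_corners_last (h : V) (A : List V) (a b : V) :
    (a, b, h) ∈ corners (h :: A ++ [a, b]) :=
  mem_cornersFrom_last h _ (h :: A) a b

end Corners

theorem forLabels_spec {bound nv forb : ℕ} {k : ℕ → ℕ → Bool}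
    (h : forLabels bound nv forb k = true) :
    (∀ x < nv, getBit forb x = false → k x nv = true) ∧
      (nv < bound → k nv (nv + 1) = true) := by
  have key : ∀ n, (Nat.rec true (fun x ih => bif bif getBit forb x then true else
      force x fun x => k x nv then ih else false) n : Bool) = true →
      ∀ x < n, getBit forb x = false → k x nv = true := by
    intro n
    induction n with
    | zero => intro _ x hx; omega
    | succ n ih =>
      intro hn x hx hb
      change (bif bif getBit forb n then true else force n fun x => k x nv then _ else false)
        = true at hn
      rw [force_eq, Bool.cond_eq_true_distrib] at hn
      rcases Nat.lt_succ_iff_lt_or_eq.1 hx with hx | rfl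
      · refine ih ?_ x hx hb
        revert hn
        cases (bif getBit forb n then true else k n nv) <;> simp
      · rw [hb] at hn
        revert hn
        cases h : k x nv <;> simp
  unfold forLabels at h
  rw [Bool.cond_eq_true_distrib] at h
  revert h
  cases hr : (Nat.rec true (fun x ih => bif bif getBit forb x then true else
      force x fun x => k x nv then ih else false) nv : Bool)
  · simp
  · intro h
    refine ⟨key nv hr, fun hlt => ?_⟩
    have : Nat.blt nv bound = true := by simpa [Nat.blt] using hlt
    simpa [this] using h

theorem extend_zero (sp : LocalSpec) (full e p v fv : ℕ) (k : ℕ → List ℕ → Bool)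
    (nv fx mid x : ℕ) (path : List ℕ) : extend sp full e p v fv k 0 nv fx mid x path =
      forLabels sp.bound nv (Nat.lor fx (Nat.lor fv (Nat.lor full (Nat.lor mid (Nat.lor
        (Nat.lor (getRow e x) (single x)) (Nat.lor (getRow e v) (single v)))))))
        fun y nv' => k nv' (y :: x :: path) := by
  simp [extend]

theorem extend_succ (sp : LocalSpec) (full e p v fv : ℕ) (k : ℕ → List ℕ → Bool)
    (r nv fx mid x : ℕ) (path : List ℕ) : extend sp full e p v fv k (r + 1) nv fx mid x path =
      forLabels sp.bound nv (Nat.lor fx (Nat.lor full (Nat.lor mid (Nat.lor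
        (Nat.lor (getRow e x) (single x)) (Nat.lor (getRow p v) (single v))))))
        fun y nv' => extend sp full e p v fv k r nv' 0 (Nat.lor mid (Nat.lor (getRow p x)
          (single x))) y (x :: path) := by
  simp [extend]

namespace PolyhedralComplex
variable {V : Type*} {K : PolyhedralComplex V}
namespace Realizes
variable {sp : LocalSpec} {φ : ℕ → V} {st : State} {S : Set (SimpleGraph V)}

/-- Every vertex has a label, or can be given the next one. -/
theorem exists_label {nv : ℕ} (h : Realizes K φ { st with nv := nv } S) (hK : K.Respects sp)
    (y : V) {forb : ℕ} {k : ℕ → ℕ → Bool} (hk : forLabels sp.bound nv forb k = true)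
    (hforb : ∀ b < nv, φ b = y → getBit forb b = false) :
    ∃ (ψ : ℕ → V) (nv' b : ℕ), nv ≤ nv' ∧ b < nv' ∧ ψ b = y ∧ (∀ a < nv, ψ a = φ a) ∧
      (∀ a < nv', a < nv ∨ ψ a = y) ∧ Realizes K ψ { st with nv := nv' } S ∧ k b nv' = true := by
  obtain ⟨hk1, hk2⟩ := forLabels_spec hk
  by_cases hy : ∃ b < nv, φ b = y
  · obtain ⟨b, hb, rfl⟩ := hy
    exact ⟨φ, nv, b, le_rfl, hb, rfl, fun _ _ => rfl, fun a ha => Or.inl ha, h,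
      hk1 b hb (hforb b hb rfl)⟩
  · push Not at hy
    have hψ : ∀ a < nv, Function.update φ nv y a = φ a := fun a ha =>
      Function.update_of_ne ha.ne _ _
    have hψy : Function.update φ nv y nv = y := Function.update_self _ _ _
    have h' : Realizes K (Function.update φ nv y) { st with nv := nv + 1 } S := by
      refine h.relabel (nv := nv + 1) (Nat.le_succ _) hψ ?_
      intro a ha b hb hab
      rcases Nat.lt_succ_iff_lt_or_eq.1 ha with ha | rfl <;>
        rcases Nat.lt_succ_iff_lt_or_eq.1 hb with hb | rfl
      · rw [hψ a ha, hψ b hb] at hab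
        exact h.inj a ha b hb hab
      · rw [hψ a ha, hψy] at hab
        exact absurd hab (hy a ha)
      · rw [hψ b hb, hψy] at hab
        exact absurd hab.symm (hy b hb)
      · rfl
    refine ⟨_, nv + 1, nv, Nat.le_succ _, Nat.lt_succ_self _, hψy, hψ, ?_, h', hk2 ?_⟩
    · intro a ha
      rcases Nat.lt_succ_iff_lt_or_eq.1 ha with ha | rfl
      exacts [Or.inl ha, Or.inr hψy]
    · exact h'.nv_le hK

/-- The vertices of `F` still to be found are `ys`, with the next one at the end, because the path
grows at its head. The three conditions on masks say that they exclude no vertex of `F`: `mid`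
concerns all of `ys`, `fx` the next vertex, which is joined to `x`, and `fv` the final one, which is
joined to `v`. Since labels may be created on the way, `φ` varies in the induction. -/
theorem extend_sound (hK : K.Respects sp) {F : SimpleGraph V} (hF : F ∈ K.faces) (hFS : F ∉ S)
    {v fv : ℕ} {k : ℕ → List ℕ → Bool} (r : ℕ) : ∀ (nv fx mid x : ℕ) (path q : List ℕ) (w : ℕ)
    (φ : ℕ → V) (ys : List V), Realizes K φ { st with nv := nv } S →
    F = polygon (ys ++ (x :: path).map φ) → (ys ++ (x :: path).map φ).Nodup →
    ys.length = r + 1 → x :: path = q ++ [w, v] → (∀ a ∈ x :: path, a < nv) →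
    (∀ b < nv, getBit mid b = true → φ b ∉ ys) →
    (∀ b < nv, getBit fx b = true → ys.getLast? ≠ some (φ b)) →
    (∀ b < nv, getBit fv b = true → ys.head? ≠ some (φ b)) →
    extend sp st.full st.edgeObs st.pairObs v fv k r nv fx mid x path = true →
    ∃ (ψ : ℕ → V) (nv' : ℕ) (f : List ℕ), Realizes K ψ { st with nv := nv' } S ∧ f.Nodup ∧
      f.length = (x :: path).length + (r + 1) ∧ (∀ a ∈ f, a < nv') ∧
      F = polygon (f.map ψ) ∧ k nv' f = true := by
  induction r with
  | zero =>
    intro nv fx mid x path q w φ ys h hFp hnd hlen hq hlt hmid hfx hfv hk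
    obtain ⟨y, rfl⟩ := List.length_eq_one_iff.1 hlen
    have hnv : nv < 16 := h.nv_lt hK
    have h3 : 3 ≤ ([y] ++ (x :: path).map φ).length := by
      rw [hq]; simp
    obtain ⟨p₀, path', rfl⟩ : ∃ p₀ path', path = p₀ :: path' := by
      cases path with
      | nil =>
        have := congrArg List.length hq
        simp at this
      | cons a t => exact ⟨a, t, rfl⟩
    have hcx : F.Adj (φ x) y := by
      rw [hFp]
      exact (polygon_adj_of_corner hnd h3 (mem_corners_append [] y (φ x) (φ p₀) _)).2 (Or.inl rfl)
    have hcv : F.Adj (φ v) y := by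
      have : (φ w, φ v, y) ∈ corners ([y] ++ (x :: p₀ :: path').map φ) := by
        rw [hq]
        have := mem_corners_last y (q.map φ) (φ w) (φ v)
        simpa using this
      rw [hFp]
      exact (polygon_adj_of_corner hnd h3 this).2 (Or.inr rfl)
    have hv : v < nv := hlt v (by rw [hq]; simp)
    have hx : x < nv := hlt x (by simp)
    rw [extend_zero] at hk
    obtain ⟨ψ, nv', b, hnv', hb, hby, hψ, -, h', hkb⟩ := h.exists_label hK y hk (by
      intro b hb hby
      subst hby
      rw [Bool.eq_false_iff]
      intro hbit
      have hyF : φ b ∈ F.support := (SimpleGraph.mem_support _).2 ⟨_, hcx.symm⟩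
      simp only [getBit_lor, Bool.or_eq_true] at hbit
      rcases hbit with hbit | hbit | hbit | hbit | (hbit | hbit) | hbit | hbit
      · exact hfx b hb hbit (by simp)
      · exact hfv b hb hbit (by simp)
      · exact hFS ((h.full b hbit).2 ⟨hF, hyF⟩)
      · exact hmid b hb hbit (by simp)
      · exact (h.edgeObs x (hx.trans hnv) b (hb.trans hnv)
          ((getBit_getRow _ _ _).1 hbit).2).2.2 F hF hFS hcx
      · rw [getBit_single] at hbit
        exact hcx.ne (by rw [hbit])
      · exact (h.edgeObs v (hv.trans hnv) b (hb.trans hnv)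
          ((getBit_getRow _ _ _).1 hbit).2).2.2 F hF hFS hcv
      · rw [getBit_single] at hbit
        exact hcv.ne (by rw [hbit]))
    have hmap : (b :: x :: p₀ :: path').map ψ = [y] ++ (x :: p₀ :: path').map φ := by
      rw [List.map_cons, hby, List.map_congr_left fun a ha => hψ a (hlt a ha)]
      rfl
    refine ⟨ψ, nv', _, h', ?_, ?_, ?_, ?_, hkb⟩
    · rw [← hmap] at hnd
      exact hnd.of_map
    · simp
    · intro a ha
      rcases List.mem_cons.1 ha with rfl | ha
      exacts [hb, (hlt a ha).trans_le hnv']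
    · rw [hmap, hFp]
  | succ r ih =>
    intro nv fx mid x path q w φ ys h hFp hnd hlen hq hlt hmid hfx hfv hk
    obtain ⟨ys, y, rfl⟩ : ∃ zs y, ys = zs ++ [y] := by
      rcases List.eq_nil_or_concat ys with rfl | ⟨zs, y, rfl⟩
      · simp at hlen
      · exact ⟨zs, y, by simp⟩
    have hlen' : ys.length = r + 1 := by simpa using hlen
    obtain ⟨y₀, ys', rfl⟩ : ∃ a t, ys = a :: t := by
      cases ys with
      | nil => simp at hlen'
      | cons a t => exact ⟨a, t, rfl⟩
    have hnv : nv < 16 := h.nv_lt hK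
    have h3 : 3 ≤ ((y₀ :: ys' ++ [y]) ++ (x :: path).map φ).length := by
      rw [hq]; simp; omega
    obtain ⟨p₀, path', rfl⟩ : ∃ p₀ path', path = p₀ :: path' := by
      cases path with
      | nil =>
        have := congrArg List.length hq
        simp at this
      | cons a t => exact ⟨a, t, rfl⟩
    have hcx : ∀ z, F.Adj (φ x) z ↔ z = y ∨ z = φ p₀ := by
      intro z
      rw [hFp]
      refine polygon_adj_of_corner hnd h3 ?_
      have := mem_corners_append (y₀ :: ys') y (φ x) (φ p₀) (path'.map φ)
      simpa using this
    have hcv : ∀ z, F.Adj (φ v) z ↔ z = φ w ∨ z = y₀ := by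
      intro z
      have : (φ w, φ v, y₀) ∈ corners ((y₀ :: ys' ++ [y]) ++ (x :: p₀ :: path').map φ) := by
        rw [hq]
        have := mem_corners_last y₀ (ys' ++ [y] ++ q.map φ) (φ w) (φ v)
        simpa using this
      rw [hFp]
      exact polygon_adj_of_corner hnd h3 this
    have hv : v < nv := hlt v (by rw [hq]; simp)
    have hx : x < nv := hlt x (by simp)
    have hw : φ w ∈ (x :: p₀ :: path').map φ := List.mem_map_of_mem (by rw [hq]; simp)
    have hvm : φ v ∈ (x :: p₀ :: path').map φ := List.mem_map_of_mem (by rw [hq]; simp)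
    obtain ⟨hnd1, hnd2, hnd3⟩ := List.nodup_append.1 hnd
    obtain ⟨hnd4, -, hnd5⟩ := List.nodup_append.1 hnd1
    have hyy : y ∉ y₀ :: ys' := fun hm => hnd5 y hm y (by simp) rfl
    have hsupp : ∀ z ∈ (y₀ :: ys' ++ [y]) ++ (x :: p₀ :: path').map φ, z ∈ F.support := by
      intro z hz
      rw [hFp]
      exact (mem_support_polygon hnd h3).2 hz
    rw [extend_succ] at hk
    obtain ⟨ψ, nv', b, hnv', hb, hby, hψ, hnew, h', hkb⟩ := h.exists_label hK y hk (by
      intro b hb hby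
      subst hby
      rw [Bool.eq_false_iff]
      intro hbit
      have hyF : φ b ∈ F.support := hsupp _ (by simp)
      have hvF : φ v ∈ F.support := hsupp _ (List.mem_append_right _ hvm)
      have hbv : φ v ≠ φ b := fun e => hnd3 (φ b) (by simp) _ hvm e.symm
      simp only [getBit_lor, Bool.or_eq_true] at hbit
      rcases hbit with hbit | hbit | hbit | (hbit | hbit) | hbit | hbit
      · exact hfx b hb hbit List.getLast?_concat
      · exact hFS ((h.full b hbit).2 ⟨hF, hyF⟩)
      · exact hmid b hb hbit (by simp)
      · exact (h.edgeObs x (hx.trans hnv) b (hb.trans hnv)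
          ((getBit_getRow _ _ _).1 hbit).2).2.2 F hF hFS ((hcx _).2 (Or.inl rfl))
      · rw [getBit_single] at hbit
        exact ((hcx _).2 (Or.inl rfl)).ne (by rw [hbit])
      -- As `y` is not the final vertex, it is not a neighbour of `v` in `F`. If `v` and `y` lay
      -- together in a listed face they would have to be.
      · have := (h.pairObs v (hv.trans hnv) b (hb.trans hnv)
          ((getBit_getRow _ _ _).1 hbit).2).2.2 F hF hFS hvF hyF hbv
        rcases (hcv _).1 this with e | e
        · exact hnd3 (φ b) (by simp) _ hw e
        · exact hyy (by rw [e]; simp)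
      · rw [getBit_single] at hbit
        exact hbv (by rw [hbit]))
    have hmap : (x :: p₀ :: path').map ψ = (x :: p₀ :: path').map φ :=
      List.map_congr_left fun a ha => hψ a (hlt a ha)
    have hlist : (y₀ :: ys') ++ (b :: x :: p₀ :: path').map ψ =
        (y₀ :: ys' ++ [y]) ++ (x :: p₀ :: path').map φ := by
      rw [List.map_cons, hmap, hby]
      simp
    -- A label below `nv'` is an old one or denotes `y`, so properties of the masks need to be
    -- checked for these two cases only.
    have hold : ∀ c < nv', (P : V → Prop) → (c < nv → P (φ c)) → P y → P (ψ c) := by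
      intro c hc P h1 h2
      by_cases hcn : c < nv
      · rw [hψ c hcn]; exact h1 hcn
      · rw [(hnew c hc).resolve_left hcn]; exact h2
    obtain ⟨ψ', nv'', f, h'', hfn, hfl, hflt, hfF, hkf⟩ := ih nv' 0 _ b (x :: p₀ :: path')
      (b :: q) w ψ (y₀ :: ys') h' (by rw [hlist, hFp]) (by rw [hlist]; exact hnd) hlen'
      (by rw [hq]; rfl)
      (by
        intro a ha
        rcases List.mem_cons.1 ha with rfl | ha
        exacts [hb, (hlt a ha).trans_le hnv'])
      (by
        intro c hc hbit
        refine hold c hc (fun z => z ∉ y₀ :: ys') (fun hcn hm => ?_) hyy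
        simp only [getBit_lor, Bool.or_eq_true] at hbit
        rcases hbit with hbit | hbit | hbit
        · exact hmid c hcn hbit (List.mem_append_left _ hm)
        -- The neighbours of `x` in `F` are `y` and the preceding vertex of the path. A vertex to
        -- come after `y` therefore cannot lie with `x` in a listed face.
        · have hxc : φ x ≠ φ c := fun e =>
            hnd3 _ (List.mem_append_left _ hm) (φ x) (by simp) e.symm
          have := (h.pairObs x (hx.trans hnv) c (hcn.trans hnv)
            ((getBit_getRow _ _ _).1 hbit).2).2.2 F hF hFS (hsupp _ (by simp))
            (hsupp _ (List.mem_append_left _ (List.mem_append_left _ hm))) hxc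
          rcases (hcx _).1 this with e | e
          · exact hyy (e ▸ hm)
          · exact hnd3 _ (List.mem_append_left _ hm) (φ p₀) (by simp) e
        · rw [getBit_single] at hbit
          subst hbit
          exact hnd3 _ (List.mem_append_left _ hm) (φ c) (by simp) rfl)
      (by
        intro c hc hbit
        rw [getBit_zero] at hbit
        exact absurd hbit (by decide))
      (by
        intro c hc hbit
        refine hold c hc (fun z => (y₀ :: ys').head? ≠ some z) (fun hcn => ?_) ?_
        · have := hfv c hcn hbit
          simpa using this
        · intro e
          exact hyy (by simp at e; simp [e]))
      hkb
    refine ⟨ψ', nv'', f, h'', hfn, ?_, hflt, hfF, hkf⟩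
    rw [hfl]
    simp only [List.length_cons]
    omega

theorem busiest_le (cor : List (List (ℕ × ℕ × ℕ))) (nv : ℕ) (mask : ℕ → Bool) :
    busiest cor nv mask ≤ nv := by
  induction nv with
  | zero => exact le_rfl
  | succ n ih =>
    have : busiest cor (n + 1) mask = n ∨ busiest cor (n + 1) mask = busiest cor n mask := by
      unfold busiest
      simp only [force_eq]
      cases mask n
      · exact Or.inr rfl
      · simp only [cond_true]
        cases Nat.blt _ (lengthL (nth cor n))
        · exact Or.inr rfl
        · exact Or.inl rfl
    rcases this with h | h <;> omega

/-- The unlisted face `F` takes up one of the places that the cap allows for its size at the vertex.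
-/
theorem sizeFits_eq_true (h : Realizes K φ st S) (hK : K.Respects sp) {F : SimpleGraph V}
    (hF : F ∈ K.faces) (hFS : F ∉ S) {a : ℕ} (ha : a < st.nv) (haF : φ a ∈ F.support) :
    sizeFits sp (nth st.cor a) (faceSize F) = true := by
  have h1 := h.countSize_le hK ha (s := faceSize F)
    (X := {G ∈ K.facesAt (φ a) | faceSize G = faceSize F} \ {F}) (fun G hG => hG.1.1.1)
    (fun G hG haG hs => ⟨⟨⟨h.sub hG, haG⟩, hs⟩, fun e => hFS (Set.mem_singleton_iff.1 e ▸ hG)⟩)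
  have h2 := Set.ncard_sdiff_singleton_lt_of_mem
    (s := {G ∈ K.facesAt (φ a) | faceSize G = faceSize F}) (a := F) ⟨⟨hF, haF⟩, rfl⟩
    (hK.isMap.finite_faces.subset fun G hG => hG.1.1)
  have h3 := hK.cap (φ a) (faceSize F)
  have : countSize (nth st.cor a) (faceSize F) < capOf sp (faceSize F) := by omega
  unfold sizeFits
  simpa [Nat.blt] using this

/-- If `F` is the only face missing at the vertex, then the second face at its edge to `φ b` is
listed. So that edge is open, and `b` lies in the row that is complemented. -/
theorem lastFaceObs_spec (h : Realizes K φ st S) (hK : K.Respects sp) {F : SimpleGraph V}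
    (hF : F ∈ K.faces) (hFS : F ∉ S) {a b : ℕ} (ha : a < st.nv) (hb : b < st.nv)
    (hab : F.Adj (φ a) (φ b)) :
    getBit (lastFaceObs sp (nth st.cor a) (getRow st.opn a)) b = false := by
  have hnv := h.nv_lt hK
  unfold lastFaceObs
  rw [lengthL_eq, h.length_cor ha]
  by_cases hd : (S ∩ K.facesAt (φ a)).ncard + 1 = sp.deg
  · have haF : F ∈ K.facesAt (φ a) := ⟨hF, (SimpleGraph.mem_support _).2 ⟨_, hab⟩⟩
    have hfin : (K.facesAt (φ a)).Finite := hK.isMap.finite_faces.subset fun G hG => hG.1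
    have hsub : S ∩ K.facesAt (φ a) = K.facesAt (φ a) \ {F} := by
      refine Set.eq_of_subset_of_ncard_le ?_ ?_ (hfin.subset Set.sdiff_subset)
      · exact fun G hG => ⟨hG.2, fun e => hFS (Set.mem_singleton_iff.1 e ▸ hG.1)⟩
      · have := Set.ncard_sdiff_singleton_add_one haF hfin
        have := hK.deg (φ a)
        omega
    obtain ⟨G, hG, hGF, hGa, -⟩ := hK.isMap.exists_other hF hab
    have hGS : G ∈ S := by
      have : G ∈ S ∩ K.facesAt (φ a) := by
        rw [hsub]
        exact ⟨⟨hG, (SimpleGraph.mem_support _).2 ⟨_, hGa⟩⟩, hGF⟩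
      exact this.1
    have ho : getBit st.opn (16 * a + b) = true := by
      by_contra hn
      exact hFS (h.closed a ha b hb (by simpa using hn) G hGS hGa F hF hab)
    have h1 : getBit 65535 b = true := by
      have : getBit (2 ^ 16 - 1) b = true := by
        rw [getBit_eq, Nat.testBit_two_pow_sub_one]
        exact decide_eq_true (hb.trans hnv)
      exact this
    rw [show Nat.succ (S ∩ K.facesAt (φ a)).ncard = sp.deg from hd, Nat.beq_refl, cond_true,
      getBit_xor, h1,
      (getBit_getRow _ _ _).2 ⟨hb.trans hnv, ho⟩]
    rfl
  · rw [beq_eq_false (a := Nat.succ _) hd, cond_false, getBit_zero]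

theorem search_succ (sp : LocalSpec) (leaf : State → Bool) (n : ℕ) (st : State) :
    search sp leaf (n + 1) st = bif Nat.beq st.opn 0 then leaf st else
      let v := busiest st.cor st.nv fun a => !Nat.beq (getRow st.opn a) 0
      let w := busiest st.cor st.nv (getBit (getRow st.opn v))
      bif getBit (getRow st.opn v) w then
        sp.sizes.all fun s =>
          bif sizeFits sp (nth st.cor v) s && sizeFits sp (nth st.cor w) s then
            extend sp st.full st.edgeObs st.pairObs v
              (lastFaceObs sp (nth st.cor v) (getRow st.opn v)) (fun nv f =>
              addFace sp st s nv f (search sp leaf n)) (Nat.sub s 3) st.nv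
              (lastFaceObs sp (nth st.cor w) (getRow st.opn w)) 0 w [v]
          else true
      else false := by
  simp [search]

/-- At the chosen open edge `K` has a face outside of `S`, and one of the branches adds it.
Exhausted fuel counts as failure, so the amount of fuel needs no justification. -/
theorem search_sound (hK : K.Respects sp) {leaf : State → Bool} (n : ℕ) : ∀ (φ : ℕ → V)
    (st : State) (S : Set (SimpleGraph V)), Realizes K φ st S → S.Nonempty →
    search sp leaf n st = true → ∃ φ st, Realizes K φ st K.faces ∧ leaf st = true := by
  induction n with
  | zero => intro φ st S _ _ hs; exact absurd hs (by simp [search])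
  | succ n ih =>
    intro φ st S h hne hs
    have hnv := h.nv_lt hK
    rw [search_succ] at hs
    by_cases ho : st.opn = 0
    · rw [ho, Nat.beq_refl, cond_true] at hs
      have : S = K.faces := by
        refine hK.isMap.eq_faces_of_closed h.sub hne fun F hF u x hux G hG hGu => ?_
        obtain ⟨a, ha, rfl⟩ := h.label F hF u ((SimpleGraph.mem_support _).2 ⟨_, hux⟩)
        obtain ⟨b, hb, rfl⟩ := h.label F hF x ((SimpleGraph.mem_support _).2 ⟨_, hux.symm⟩)
        exact h.closed a ha b hb (by rw [ho, getBit_zero]) F hF hux G hG hGu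
      subst this
      exact ⟨φ, st, h, hs⟩
    · rw [beq_eq_false ho, cond_false] at hs
      -- The choice of `v` and `w` is a heuristic. Correctness uses only that they index bits of the
      -- matrix and that the program checks the pair to be open.
      have hv16 := (busiest_le st.cor st.nv fun a => !Nat.beq (getRow st.opn a) 0).trans_lt hnv
      dsimp only at hs
      set v := busiest st.cor st.nv fun a => !Nat.beq (getRow st.opn a) 0
      set w := busiest st.cor st.nv (getBit (getRow st.opn v))
      cases hvw : getBit (getRow st.opn v) w
      · rw [hvw, cond_false] at hs
        exact absurd hs (by decide)
      rw [hvw, cond_true] at hs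
      obtain ⟨hw16, hvw⟩ := (getBit_getRow _ _ _).1 hvw
      obtain ⟨hv, hw, -, F, hF, hFS, hFvw⟩ := h.opn v hv16 w hw16 hvw
      obtain ⟨p, hp⟩ := K.isCycle F hF
      obtain ⟨l, hnd, hlp, hl1, hFl⟩ := exists_polygon_of_adj hp hFvw
      have hsize : faceSize F = p := by
        rw [hFl, faceSize_polygon hnd (by simp; omega)]
        simp; omega
      have hvF : φ v ∈ F.support := (SimpleGraph.mem_support _).2 ⟨_, hFvw⟩
      have hwF : φ w ∈ F.support := (SimpleGraph.mem_support _).2 ⟨_, hFvw.symm⟩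
      have hs' := List.all_eq_true.1 hs _ (hK.size_mem F hF)
      rw [h.sizeFits_eq_true hK hF hFS hv hvF, h.sizeFits_eq_true hK hF hFS hw hwF,
        Bool.and_self, cond_true] at hs'
      have h3 : 3 ≤ (l ++ [φ w, φ v]).length := by simp; omega
      have hlne : l ≠ [] := by rintro rfl; simp at hl1
      have hwl : ∀ z, l.getLast? = some z → F.Adj (φ w) z := by
        intro z hz
        obtain ⟨l', rfl⟩ := List.getLast?_eq_some_iff.1 hz
        rw [hFl]
        refine (polygon_adj_of_corner hnd h3 (c := φ v) ?_).2 (Or.inl rfl)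
        have := mem_corners_append l' z (φ w) (φ v) []
        simpa using this
      have hvl : ∀ z, l.head? = some z → F.Adj (φ v) z := by
        intro z hz
        obtain ⟨l', rfl⟩ : ∃ l', l = z :: l' := List.head?_eq_some_iff.1 hz
        rw [hFl]
        exact (polygon_adj_of_corner hnd h3 (mem_corners_last z l' _ _)).2 (Or.inr rfl)
      obtain ⟨ψ, nv', f, h', hfn, hfl, hflt, hfF, hkf⟩ := extend_sound (st := st) hK hF hFS
        (Nat.sub (faceSize F) 3) st.nv _ 0 w [v] [] w φ l h hFl hnd
        (by rw [hsize]; exact (show l.length = p - 3 + 1 by omega)) rfl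
        (by simp [hv, hw])
        (by intro b _ hb; rw [getBit_zero] at hb; exact absurd hb (by decide))
        (by
          intro b hb hbit hz
          rw [h.lastFaceObs_spec hK hF hFS hw hb (hwl _ hz)] at hbit
          exact absurd hbit (by decide))
        (by
          intro b hb hbit hz
          rw [h.lastFaceObs_spec hK hF hFS hv hb (hvl _ hz)] at hbit
          exact absurd hbit (by decide)) hs'
      have hflen : f.length = faceSize F := by
        rw [hfl, hsize]
        simp only [List.length_cons, List.length_nil]
        change 0 + 1 + 1 + (p - 3 + 1) = p
        omega
      rw [← hflen] at hkf
      have hf3 : 3 ≤ f.length := by rw [hflen, hsize]; omega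
      subst hfF
      exact ih ψ _ _ (h'.pushFace_realizes hK hfn hf3 hflt hF hFS) ⟨_, Set.mem_insert _ _⟩
        (h'.addFace_eq_true hK rfl hfn hf3 hflt hF hFS hkf)

theorem realizes_empty (φ : ℕ → V) : Realizes K φ emptyState ∅ where
  inj := fun a ha => absurd ha (Nat.not_lt_zero a)
  mem_iff := by simp [emptyState]
  lt := by simp [emptyState]
  sub := Set.empty_subset _
  label := by simp
  full := fun a ha => by
    rw [show emptyState.full = 0 from rfl, getBit_zero] at ha; exact absurd ha (by decide)
  edgeObs := fun a _ b _ h => by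
    rw [show emptyState.edgeObs = 0 from rfl, getBit_zero] at h; exact absurd h (by decide)
  pairObs := fun a _ b _ h => by
    rw [show emptyState.pairObs = 0 from rfl, getBit_zero] at h; exact absurd h (by decide)
  opn := fun a _ b _ h => by
    rw [show emptyState.opn = 0 from rfl, getBit_zero] at h; exact absurd h (by decide)
  closed := by simp
  cor := fun a ha => absurd ha (Nat.not_lt_zero a)
  cor_nil := fun a _ => nth_nil a

/-- If the search succeeds then every map that respects the specification is described by a final
state that passes the test `leaf`. -/
theorem exists_of_searchAll (hK : K.Respects sp) {leaf : State → Bool} {s : ℕ}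
    (hs : searchAll sp s leaf = true) {F : SimpleGraph V} (hF : F ∈ K.faces)
    (hFs : faceSize F = s) : ∃ φ st, Realizes K φ st K.faces ∧ leaf st = true := by
  obtain ⟨p, hp⟩ := K.isCycle F hF
  obtain ⟨l, hn, h3, hlp, rfl⟩ := exists_polygon hp
  rw [faceSize_polygon hn h3] at hFs
  obtain ⟨x, -⟩ : ∃ x, x ∈ l := List.exists_mem_of_length_pos (by omega)
  have hget : ∀ a < s, l.getD a x = l[a]?.getD x := fun a _ => List.getD_eq_getElem?_getD
  have hmap : (List.range s).map (fun a => l.getD a x) = l := by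
    refine List.ext_getElem (by simp [hFs]) fun i h1 h2 => ?_
    simp [List.getD_eq_getElem?_getD, h2]
  -- The vertices of the first face receive the labels `0, …, s - 1` in their cyclic order; beyond
  -- the list `x` is a dummy value.
  have hr : Realizes K (fun a => l.getD a x) { emptyState with nv := s } ∅ := by
    refine (realizes_empty (fun a => l.getD a x)).relabel (Nat.zero_le _) (fun _ _ => rfl) ?_
    intro a ha b hb hab
    rw [← hFs] at ha hb
    rw [List.getD_eq_getElem _ _ ha, List.getD_eq_getElem _ _ hb] at hab
    exact (hn.getElem_inj_iff).1 hab
  have hlen : (List.range s).length = s := List.length_range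
  have hs' : addFace sp { emptyState with nv := s } (List.range s).length s (List.range s)
      (search sp leaf 50) = true := by
    rw [hlen]; exact hs
  have hmem : polygon ((List.range s).map fun a => l.getD a x) ∈ K.faces := by rwa [hmap]
  have hs3 : 3 ≤ (List.range s).length := by omega
  exact search_sound hK 50 _ _ _ (hr.pushFace_realizes hK List.nodup_range hs3
    (fun a ha => List.mem_range.1 ha) hmem (Set.notMem_empty _)) ⟨_, Set.mem_insert _ _⟩
    (hr.addFace_eq_true hK rfl List.nodup_range hs3 (fun a ha => List.mem_range.1 ha) hmem
      (Set.notMem_empty _) hs')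

end Realizes
end PolyhedralComplex
end SEM

/-! ### Arithmetic of face sequences -/

namespace SEM
open Function
namespace PolyhedralComplex
variable {V : Type*} {K : PolyhedralComplex V}

/-- Every vertex has an umbrella with the face sizes `a`. -/
def HasFaceSequence (K : PolyhedralComplex V) {m : ℕ} (a : ZMod m → ℕ) : Prop :=
  ∀ v, ∃ (f : ZMod m → SimpleGraph V) (w : ZMod m → V),
    K.IsUmbrella v f w ∧ ∀ i, faceSize (f i) = a i

namespace HasFaceSequence
variable {m : ℕ} {a : ZMod m → ℕ}

theorem three_le (ha : K.HasFaceSequence a) (hK : K.IsMap) : 3 ≤ m := by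
  obtain ⟨v⟩ := hK.2.1.nonempty
  obtain ⟨f, w, h, -⟩ := ha v
  exact h.1

theorem exists_face (ha : K.HasFaceSequence a) (hK : K.IsMap) (i : ZMod m) :
    ∃ F ∈ K.faces, faceSize F = a i := by
  obtain ⟨v⟩ := hK.2.1.nonempty
  obtain ⟨f, w, h, hf⟩ := ha v
  exact ⟨f i, h.mem i, hf i⟩

theorem three_le_size {F : SimpleGraph V} (hF : F ∈ K.faces) : 3 ≤ faceSize F := by
  obtain ⟨p, hp⟩ := K.isCycle F hF
  obtain ⟨l, hn, h3, -, rfl⟩ := exists_polygon hp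
  rwa [faceSize_polygon hn h3]

theorem exists_size_eq (ha : K.HasFaceSequence a) {F : SimpleGraph V} (hF : F ∈ K.faces) :
    ∃ i, faceSize F = a i := by
  obtain ⟨v, hv⟩ := exists_mem_support hF
  obtain ⟨f, w, h, hf⟩ := ha v
  obtain ⟨i, rfl⟩ := h.exists_eq hF hv
  exact ⟨i, hf i⟩

theorem ncard_facesAt (ha : K.HasFaceSequence a) (v : V) : (K.facesAt v).ncard = m := by
  obtain ⟨f, w, h, -⟩ := ha v
  exact h.ncard

theorem isEquivelar (ha : K.HasFaceSequence a) {p : ℕ} (hp : ∀ i, a i = p) : K.IsEquivelar :=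
  ⟨p, m, fun _ hF => by
    obtain ⟨i, hi⟩ := ha.exists_size_eq hF
    rw [hi, hp], ha.ncard_facesAt⟩

open scoped Classical in
/-- Double counting of the incidences of vertices and faces, weighted by the size of the face. -/
theorem sum_faces [Fintype V] [NeZero m] (ha : K.HasFaceSequence a) (hfin : K.faces.Finite)
    (g : ℕ → ℚ) :
    ∑ F ∈ hfin.toFinset, (faceSize F : ℚ) * g (faceSize F) = Fintype.card V * ∑ i, g (a i) := by
  have h1 : ∀ F : SimpleGraph V, (faceSize F : ℚ) * g (faceSize F) =
      ∑ v : V, if v ∈ F.support then g (faceSize F) else 0 := by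
    intro F
    rw [← Finset.sum_filter, Finset.sum_const, nsmul_eq_mul]
    congr 2
    rw [faceSize, ← Set.ncard_coe_finset]
    congr 1
    ext x
    simp
  simp_rw [h1]
  rw [Finset.sum_comm]
  have h2 : ∀ v : V, (∑ F ∈ hfin.toFinset, if v ∈ F.support then g (faceSize F) else 0) =
      ∑ i, g (a i) := by
    intro v
    obtain ⟨f, w, h, hf⟩ := ha v
    rw [← Finset.sum_filter]
    have : hfin.toFinset.filter (fun F => v ∈ F.support) = Finset.univ.image f := by
      ext F
      simp only [Finset.mem_filter, Set.Finite.mem_toFinset, Finset.mem_image, Finset.mem_univ,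
        true_and]
      constructor
      · rintro ⟨h1, h2⟩
        exact (h.exists_eq h1 h2).imp fun _ => Eq.symm
      · rintro ⟨i, rfl⟩
        exact ⟨h.mem i, (SimpleGraph.mem_support _).2 ⟨_, (h.2.2.2.2 i).1⟩⟩
    rw [this, Finset.sum_image fun i _ j _ hij => h.2.1 hij]
    simp_rw [hf]
  simp_rw [h2]
  rw [Finset.sum_const, nsmul_eq_mul, Finset.card_univ]

/-- With the weight `1 / s` each face contributes 1 to the double count. -/
theorem ncard_faces [NeZero m] (ha : K.HasFaceSequence a) (hK : K.IsMap) :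
    (K.faces.ncard : ℚ) = Nat.card V * ∑ i, (1 : ℚ) / a i := by
  have := hK.1
  have := Fintype.ofFinite V
  have h := ha.sum_faces hK.finite_faces fun s => 1 / (s : ℚ)
  rw [Nat.card_eq_fintype_card, ← h, Finset.sum_congr rfl (g := fun _ => (1 : ℚ)),
    Finset.sum_const, nsmul_one, Set.ncard_eq_toFinset_card _ hK.finite_faces]
  intro F hF
  have h3 := three_le_size ((Set.Finite.mem_toFinset _).1 hF)
  have : (faceSize F : ℚ) ≠ 0 := by
    have : faceSize F ≠ 0 := by omega
    exact_mod_cast this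
  field_simp

-- The weight is the indicator of size `p`: the double count then equals `p` times the number of
-- faces of size `p`.
open scoped Classical in
theorem dvd_card_mul [NeZero m] (ha : K.HasFaceSequence a) (hK : K.IsMap) (p : ℕ) :
    p ∣ Nat.card V * (Finset.univ.filter fun i => a i = p).card := by
  have := hK.1
  have := Fintype.ofFinite V
  have h := ha.sum_faces hK.finite_faces fun s => if s = p then 1 else 0
  rw [← Nat.card_eq_fintype_card] at h
  refine ⟨(hK.finite_faces.toFinset.filter fun F => faceSize F = p).card, ?_⟩
  rw [Finset.sum_boole] at h
  have h2 : ∑ F ∈ hK.finite_faces.toFinset, (faceSize F : ℚ) * (if faceSize F = p then 1 else 0) =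
      p * (hK.finite_faces.toFinset.filter fun F => faceSize F = p).card := by
    rw [← Finset.sum_boole, Finset.mul_sum]
    refine Finset.sum_congr rfl fun F _ => ?_
    split_ifs with h
    · rw [h]
    · simp
  rw [h2] at h
  exact_mod_cast h.symm

theorem two_mul_ncard_edgeSet (ha : K.HasFaceSequence a) (hK : K.IsMap) :
    2 * K.edgeGraph.edgeSet.ncard = Nat.card V * m := by
  classical
  have := hK.1
  have := Fintype.ofFinite V
  have h3 := ha.three_le hK
  have : NeZero m := ⟨by omega⟩
  have hdeg : ∀ v, K.edgeGraph.degree v = m := by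
    intro v
    obtain ⟨f, w, h, -⟩ := ha v
    have : K.edgeGraph.neighborFinset v = Finset.univ.image w := by
      ext x
      simp only [SimpleGraph.mem_neighborFinset, Finset.mem_image, Finset.mem_univ, true_and]
      rw [edgeGraph_adj]
      constructor
      · rintro ⟨F, hF, hx⟩
        obtain ⟨i, rfl, -⟩ := h.exists_of_adj hF hx
        exact ⟨i, rfl⟩
      · rintro ⟨i, rfl⟩
        exact ⟨f i, h.mem i, (h.2.2.2.2 i).1⟩
    rw [← SimpleGraph.card_neighborFinset_eq_degree, this,
      Finset.card_image_of_injective _ h.2.2.1, Finset.card_univ, ZMod.card]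
  have h := K.edgeGraph.sum_degrees_eq_twice_card_edges
  simp_rw [hdeg] at h
  rw [Finset.sum_const, Finset.card_univ, smul_eq_mul] at h
  rw [Nat.card_eq_fintype_card, h, ← SimpleGraph.coe_edgeFinset, Set.ncard_coe_finset]

theorem two_mul_eulerChar [NeZero m] (ha : K.HasFaceSequence a) (hK : K.IsMap) :
    (2 * K.eulerChar : ℚ) = Nat.card V * (2 - m + 2 * ∑ i, (1 : ℚ) / a i) := by
  have h1 : (2 * K.edgeGraph.edgeSet.ncard : ℚ) = Nat.card V * m := by
    exact_mod_cast ha.two_mul_ncard_edgeSet hK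
  have h2 := ha.ncard_faces hK
  unfold eulerChar
  push_cast
  rw [h2]
  linear_combination -h1

theorem sum_inv_of_eulerChar_eq_zero [NeZero m] (ha : K.HasFaceSequence a) (hK : K.IsMap)
    (h0 : K.eulerChar = 0) : 2 * ∑ i, (1 : ℚ) / a i = m - 2 := by
  have h := ha.two_mul_eulerChar hK
  rw [h0] at h
  have := hK.1
  have := hK.2.1.nonempty
  have hV : (Nat.card V : ℚ) ≠ 0 := by exact_mod_cast Nat.card_pos.ne'
  have h2 : (2 - m + 2 * ∑ i, (1 : ℚ) / a i) = 0 := by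
    have h3 : (Nat.card V : ℚ) * (2 - m + 2 * ∑ i, (1 : ℚ) / a i) = 0 := by
      rw [← h]; simp
    exact (mul_eq_zero.1 h3).resolve_left hV
  linarith

/-- The faces at a vertex have no other vertices in common than their common edges require. -/
theorem sum_sub_two_lt [NeZero m] (ha : K.HasFaceSequence a) (hK : K.IsMap) :
    ∑ i, (a i - 2) < Nat.card V := by
  classical
  have := hK.1
  have := Fintype.ofFinite V
  obtain ⟨v⟩ := hK.2.1.nonempty
  obtain ⟨f, w, h, hf⟩ := ha v
  have hmem : ∀ i, v ∈ (f i).support ∧ w i ∈ (f i).support := fun i =>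
    ⟨(SimpleGraph.mem_support _).2 ⟨_, (h.2.2.2.2 i).1⟩,
      (SimpleGraph.mem_support _).2 ⟨_, (h.2.2.2.2 i).1.symm⟩⟩
  -- Each neighbour of `v` lies in two faces of the umbrella. Removing `w i` along with `v` leaves
  -- `w (i + 1)` to the face `f i` alone, which makes these sets disjoint.
  let T : ZMod m → Finset V := fun i => ((f i).support.toFinset.erase (w i)).erase v
  have hcard : ∀ i, (T i).card = a i - 2 := by
    intro i
    have h1 : w i ∈ (f i).support.toFinset := Set.mem_toFinset.2 (hmem i).2
    have h2 : v ∈ (f i).support.toFinset.erase (w i) :=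
      Finset.mem_erase.2 ⟨(h.2.2.2.2 i).1.ne, Set.mem_toFinset.2 (hmem i).1⟩
    rw [Finset.card_erase_of_mem h2, Finset.card_erase_of_mem h1, ← hf i, faceSize,
      Set.ncard_eq_toFinset_card']
    omega
  have hdisj : ∀ i ∈ (Finset.univ : Finset (ZMod m)), ∀ j ∈ Finset.univ, i ≠ j →
      Disjoint (T i) (T j) := by
    intro i _ j _ hij
    rw [Finset.disjoint_left]
    intro x hi hj
    simp only [T, Finset.mem_erase, Set.mem_toFinset] at hi hj
    obtain ⟨h1, h2⟩ := adj_of_common (h.mem i) (h.mem j) (fun e => hij (h.2.1 e)) hi.1.symm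
      (hmem i).1 hi.2.2 (hmem j).1 hj.2.2
    have e1 := (h.adj_iff.1 h1).resolve_left hi.2.1
    have e2 := (h.adj_iff.1 h2).resolve_left hj.2.1
    exact hij (by simpa using h.2.2.1 (e1.symm.trans e2))
  have hsub : Finset.univ.biUnion T ⊆ Finset.univ.erase v := by
    intro x hx
    simp only [T, Finset.mem_biUnion, Finset.mem_erase] at hx
    obtain ⟨i, -, hx, -⟩ := hx
    exact Finset.mem_erase.2 ⟨hx, Finset.mem_univ _⟩
  have := Finset.card_le_card hsub
  rw [Finset.card_biUnion hdisj, Finset.card_erase_of_mem (Finset.mem_univ _), Finset.card_univ,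
    ← Nat.card_eq_fintype_card] at this
  simp_rw [hcard] at this
  have : 0 < Nat.card V := by
    have : Nonempty V := ⟨v⟩
    exact Nat.card_pos
  omega

/-- The terms `1 / 3 - 1 / a i` are nonnegative and add up to `m / 3 - (m - 2) / 2 = (6 - m) / 6`.
For `m ≥ 6` all of them vanish, so all faces are triangles. -/
theorem le_five [NeZero m] (ha : K.HasFaceSequence a) (hK : K.IsMap) (h0 : K.eulerChar = 0)
    (hne : ¬K.IsEquivelar) : m ≤ 5 := by
  by_contra hm
  refine hne (ha.isEquivelar (p := 3) ?_)
  have h3 : ∀ i, 3 ≤ a i := fun i => by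
    obtain ⟨F, hF, hi⟩ := ha.exists_face hK i
    rw [← hi]
    exact three_le_size hF
  have hle : ∀ i, 0 ≤ 1 / 3 - (1 : ℚ) / a i := by
    intro i
    have : (3 : ℚ) ≤ a i := by exact_mod_cast h3 i
    have : (1 : ℚ) / a i ≤ 1 / 3 := one_div_le_one_div_of_le (by norm_num) this
    linarith
  have hs := ha.sum_inv_of_eulerChar_eq_zero hK h0
  have hsum : ∑ i, (1 / 3 - (1 : ℚ) / a i) = m / 3 - ∑ i, (1 : ℚ) / a i := by
    rw [Finset.sum_sub_distrib, Finset.sum_const, Finset.card_univ, ZMod.card, nsmul_eq_mul]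
    ring
  have hm' : (6 : ℚ) ≤ m := by exact_mod_cast (show 6 ≤ m by omega)
  have hz : ∑ i, (1 / 3 - (1 : ℚ) / a i) = 0 := by
    refine le_antisymm ?_ (Finset.sum_nonneg fun i _ => hle i)
    rw [hsum]
    linarith
  intro i
  have := (Finset.sum_eq_zero_iff_of_nonneg fun i _ => hle i).1 hz i (Finset.mem_univ i)
  have h3i := h3 i
  have hpos : (a i : ℚ) ≠ 0 := by
    have : a i ≠ 0 := by omega
    exact_mod_cast this
  field_simp at this
  have h4 : (a i : ℚ) = 3 := by linarith
  exact_mod_cast h4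

/-- The local conditions of the search follow from a comparison with the face sequence. -/
theorem respects [NeZero m] (ha : K.HasFaceSequence a) (hK : K.IsMap) {sp : LocalSpec}
    (hn : Nat.card V ≤ sp.bound) (hb : sp.bound ≤ 15) (hd : m = sp.deg) (hs : ∀ i, a i ∈ sp.sizes)
    (hcap : ∀ i, (Finset.univ.filter fun j => a j = a i).card ≤ capOf sp (a i))
    (htr : ∀ i, ∀ p q, (p = 0 ∨ p = a (i - 1)) → (q = 0 ∨ q = a (i + 1)) →
      getBit sp.triples (tripleCode p (a i) q) = true ∧
      getBit sp.triples (tripleCode q (a i) p) = true) : K.Respects sp where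
  isMap := hK
  card_le := hn
  bound_le := hb
  deg v := (ha.ncard_facesAt v).trans hd
  size_mem F hF := by
    obtain ⟨i, hi⟩ := ha.exists_size_eq hF
    rw [hi]
    exact hs i
  cap v s := by
    classical
    obtain ⟨f, w, h, hf⟩ := ha v
    have hset : {F ∈ K.facesAt v | faceSize F = s} =
        ((Finset.univ.filter fun j => a j = s).image f : Finset (SimpleGraph V)) := by
      ext F
      simp only [Finset.coe_image, Finset.coe_filter, Finset.mem_univ, true_and, Set.mem_image,
        Set.mem_ofPred_eq]
      constructor
      · rintro ⟨⟨h1, h2⟩, h3⟩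
        obtain ⟨i, rfl⟩ := h.exists_eq h1 h2
        exact ⟨i, (hf i).symm.trans h3, rfl⟩
      · rintro ⟨i, hi, rfl⟩
        exact ⟨⟨h.mem i, (SimpleGraph.mem_support _).2 ⟨_, (h.2.2.2.2 i).1⟩⟩, (hf i).trans hi⟩
    rw [hset, Set.ncard_coe_finset, Finset.card_image_of_injective _ h.2.1]
    by_cases hi : ∃ i, a i = s
    · obtain ⟨i, rfl⟩ := hi
      exact hcap i
    · push Not at hi
      rw [Finset.filter_false_of_mem fun i _ => hi i]
      exact Nat.zero_le _
  triple F hF G hG H hH v x y hxy hFx hFy hGF hGx hHF hHy p q hp hq := by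
    obtain ⟨f, w, h, hf⟩ := ha v
    obtain ⟨i, rfl⟩ := h.exists_eq hF ((SimpleGraph.mem_support _).2 ⟨_, hFx⟩)
    rw [h.adj_iff] at hFx hFy
    have key1 : ∀ D ∈ K.faces, D ≠ f i → D.Adj v (w i) → faceSize D = a (i - 1) := by
      intro D hD hne hadj
      rw [((h.adj_edge_iff hD).1 hadj).resolve_left hne, hf]
    have key2 : ∀ D ∈ K.faces, D ≠ f i → D.Adj v (w (i + 1)) → faceSize D = a (i + 1) := by
      intro D hD hne hadj
      rw [((h.adj_edge_iff hD).1 hadj).resolve_right (by simpa using hne), hf]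
    rw [hf i]
    -- The edges to `x` and `y` are the two edges of `f i` at `v`, in either order. This is why the
    -- hypothesis on triples covers both directions.
    rcases hFx with rfl | rfl <;> rcases hFy with rfl | rfl
    · exact absurd rfl hxy
    · rw [key1 G hG hGF hGx] at hp
      rw [key2 H hH hHF hHy] at hq
      exact (htr i p q hp hq).1
    · rw [key2 G hG hGF hGx] at hp
      rw [key1 H hH hHF hHy] at hq
      exact (htr i q p hq hp).2
    · exact absurd rfl hxy

end HasFaceSequence
end PolyhedralComplex
end SEM

/-! ### Reduction to seven face sequences -/

namespace SEM

/-- The lists of length `m` of numbers `≥ 3` such that the numbers `a - 2` add up to at most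
`b`. -/
def listsOf : ℕ → ℕ → List (List ℕ)
  | 0, _ => [[]]
  | m + 1, b => (List.range b).flatMap fun d => (listsOf m (b - d - 1)).map ((d + 3) :: ·)

theorem mem_listsOf {l : List ℕ} (h3 : ∀ a ∈ l, 3 ≤ a) {b : ℕ} (hb : (l.map (· - 2)).sum ≤ b) :
    l ∈ listsOf l.length b := by
  induction l generalizing b with
  | nil => exact List.mem_singleton.2 rfl
  | cons a t ih =>
    have ha := h3 a List.mem_cons_self
    rw [List.map_cons, List.sum_cons] at hb
    rw [List.length_cons, listsOf, List.mem_flatMap]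
    refine ⟨a - 3, List.mem_range.2 (by omega), List.mem_map.2 ⟨t, ih (fun x hx => h3 x
      (List.mem_cons_of_mem _ hx)) (by omega), ?_⟩⟩
    rw [show a - 3 + 3 = a by omega]

/-- The face sequences and the numbers of vertices to be searched, and the size of a first face. -/
def searchTypes : List (List ℕ × ℕ × ℕ) :=
  [([3, 3, 3, 4, 4], 14, 4), ([3, 3, 4, 3, 4], 14, 4), ([3, 6, 3, 6], 15, 6), ([3, 3, 6, 6], 15, 6),
    ([3, 3, 3, 3, 6], 12, 6), ([3, 4, 6, 4], 12, 6), ([3, 4, 4, 6], 12, 6)]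

def codesIn (mask : ℕ) (c : ℕ × ℕ × ℕ) : Bool :=
  [0, c.1].all fun p => [0, c.2.2].all fun q =>
    getBit mask (tripleCode p c.2.1 q) && getBit mask (tripleCode q c.2.1 p)

/-- Whether maps with `n` vertices and face sequence `l` are among those of type `t`. -/
def covers (n : ℕ) (l : List ℕ) (t : List ℕ × ℕ × ℕ) : Bool :=
  l.length == t.1.length && Nat.ble n t.2.1 && l.contains t.2.2 &&
    (l.all fun a => t.1.dedup.contains a && Nat.ble (l.count a) (capOf (specOf t.2.1 t.1) a)) &&
    (corners l).all (codesIn (triplesOf t.1))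

/-- The arithmetic conditions on face sequences at `n` vertices leave only the searched types. -/
def typesCovered (m : ℕ) : Bool :=
  (listsOf m 14).all fun l =>
    2 * (l.map (l.prod / ·)).sum != (m - 2) * l.prod || l.all (· == l.headI) ||
    (List.range 16).all fun n =>
      Nat.ble n (l.map (· - 2)).sum || !(l.all fun a => n * l.count a % a == 0) ||
      searchTypes.any (covers n l)

theorem typesCovered_three : typesCovered 3 = true := by decide +kernel
theorem typesCovered_four : typesCovered 4 = true := by decide +kernel
theorem typesCovered_five : typesCovered 5 = true := by decide +kernel

section listOf
variable {k : ℕ} (a : ZMod (k + 1) → ℕ)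

theorem curveOf_listOf (i : ZMod (k + 1)) : curveOf (listOf a) (length_listOf a) i = a i :=
  List.getElem_ofFn _

theorem mem_listOf {x : ℕ} : x ∈ listOf a ↔ ∃ i, a i = x := by
  rw [← mem_range_curveOf (length_listOf a)]
  simp only [Set.mem_range, curveOf_listOf]

theorem sum_map_listOf {M : Type*} [AddCommMonoid M] (g : ℕ → M) :
    ((listOf a).map g).sum = ∑ i, g (a i) := by
  rw [listOf, List.map_ofFn, List.sum_ofFn]
  rfl

theorem count_eq_sum (l : List ℕ) (x : ℕ) :
    l.count x = (l.map fun y => if y = x then 1 else 0).sum := by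
  induction l with
  | nil => rfl
  | cons b t ih => rw [List.count_cons, ih, List.map_cons, List.sum_cons, add_comm]; simp

theorem count_listOf (x : ℕ) :
    (listOf a).count x = (Finset.univ.filter fun i => a i = x).card := by
  rw [count_eq_sum, sum_map_listOf, Finset.card_filter]

end listOf

namespace PolyhedralComplex.HasFaceSequence
variable {V : Type*} {K : PolyhedralComplex V} {m : ℕ} {a : ZMod m → ℕ}

theorem respects_of_covers {k : ℕ} {a : ZMod (k + 1) → ℕ} (ha : K.HasFaceSequence a) (hK : K.IsMap)
    {t : List ℕ × ℕ × ℕ} (hb : t.2.1 ≤ 15) (ht : covers (Nat.card V) (listOf a) t = true) :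
    K.Respects (specOf t.2.1 t.1) ∧ ∃ F ∈ K.faces, faceSize F = t.2.2 := by
  simp only [covers, Bool.and_eq_true, beq_iff_eq, Nat.ble_eq, List.contains_iff_mem,
    List.all_eq_true] at ht
  obtain ⟨⟨⟨⟨hlen, hn⟩, hs⟩, hsz⟩, hc⟩ := ht
  refine ⟨ha.respects hK hn hb ((length_listOf a).symm.trans hlen)
    (fun i => (hsz _ ((mem_listOf a).2 ⟨i, rfl⟩)).1)
    (fun i => ?_) (fun i p q hp hq => ?_), ?_⟩
  · convert (hsz _ ((mem_listOf a).2 ⟨i, rfl⟩)).2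
    rw [count_listOf]
  · have h := hc _ ((mem_corners_iff (length_listOf a)).2 ⟨i, rfl⟩)
    simp only [codesIn, List.all_eq_true, curveOf_listOf, Bool.and_eq_true] at h
    exact h p (by simpa using hp) q (by simpa using hq)
  · obtain ⟨i, hi⟩ := (mem_listOf a).1 hs
    obtain ⟨F, hF, h⟩ := ha.exists_face hK i
    exact ⟨F, hF, h.trans hi⟩

/-- The condition for Euler characteristic 0 with denominators cleared, as `typesCovered` tests it
with the product of the sequence for `P`. -/
theorem sum_div_eq [NeZero m] (ha : K.HasFaceSequence a) (hK : K.IsMap) (h0 : K.eulerChar = 0)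
    {P : ℕ} (hP : ∀ i, a i ∣ P) : 2 * ∑ i, P / a i = (m - 2) * P := by
  have h := congrArg (· * (P : ℚ)) (ha.sum_inv_of_eulerChar_eq_zero hK h0)
  simp only [mul_assoc, Finset.sum_mul] at h
  have hm := ha.three_le hK
  have h2 : ((m - 2 : ℕ) : ℚ) = m - 2 := by
    rw [Nat.cast_sub (by omega)]
    rfl
  rw [← Nat.cast_inj (R := ℚ), Nat.cast_mul, Nat.cast_mul, h2, ← h, Nat.cast_sum]
  congr 1
  refine Finset.sum_congr rfl fun i _ => ?_
  have hi : (a i : ℚ) ≠ 0 := by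
    obtain ⟨F, hF, hi⟩ := ha.exists_face hK i
    have := three_le_size hF
    exact_mod_cast (show a i ≠ 0 by omega)
  rw [Nat.cast_div (hP i) hi]
  ring

theorem exists_searchType (ha : K.HasFaceSequence a) (hK : K.IsMap) (hn : Nat.card V ≤ 15)
    (h0 : K.eulerChar = 0) (hne : ¬K.IsEquivelar) :
    ∃ t ∈ searchTypes, K.Respects (specOf t.2.1 t.1) ∧ ∃ F ∈ K.faces, faceSize F = t.2.2 := by
  have hm := ha.three_le hK
  obtain ⟨k, rfl⟩ : ∃ k, m = k + 1 := ⟨m - 1, by omega⟩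
  have hlt := ha.sum_sub_two_lt hK
  have h5 := ha.le_five hK h0 hne
  have hcov : typesCovered (k + 1) = true := by
    obtain rfl | rfl | rfl : k = 2 ∨ k = 3 ∨ k = 4 := by omega
    exacts [typesCovered_three, typesCovered_four, typesCovered_five]
  have hsum : ((listOf a).map (· - 2)).sum = ∑ i, (a i - 2) := sum_map_listOf a _
  -- The bound 14 comes from `∑ (a i - 2) < n ≤ 15`.
  have hmem : listOf a ∈ listsOf (k + 1) 14 := by
    rw [← length_listOf a]
    refine mem_listsOf (fun x hx => ?_) (by omega)
    obtain ⟨i, rfl⟩ := (mem_listOf a).1 hx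
    obtain ⟨F, hF, hi⟩ := ha.exists_face hK i
    rw [← hi]
    exact three_le_size hF
  have h := List.all_eq_true.1 hcov _ hmem
  simp only [Bool.or_eq_true, bne_iff_ne, ne_eq, List.all_eq_true, beq_iff_eq, List.mem_range,
    Nat.ble_eq, Bool.not_eq_true', List.any_eq_true] at h
  rcases h with (h | h) | h
  · refine absurd ?_ h
    rw [sum_map_listOf a]
    exact ha.sum_div_eq hK h0 fun i => List.dvd_prod ((mem_listOf a).2 ⟨i, rfl⟩)
  · exact absurd (ha.isEquivelar fun i => h _ ((mem_listOf a).2 ⟨i, rfl⟩)) hne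
  · rcases h (Nat.card V) (by omega) with (h | h) | ⟨t, ht, h⟩
    · omega
    · rw [List.all_eq_false] at h
      obtain ⟨x, -, h⟩ := h
      refine absurd ?_ h
      rw [beq_iff_eq, count_listOf]
      convert Nat.mod_eq_zero_of_dvd (ha.dvd_card_mul hK x)
    · have h15 : ∀ t ∈ searchTypes, t.2.1 ≤ 15 := by decide
      exact ⟨t, ht, ha.respects_of_covers hK (h15 t ht) h⟩

end PolyhedralComplex.HasFaceSequence
end SEM

/-! ### Polyhedral complexes given by lists of polygons -/

namespace SEM
open Function

section Polygon
variable {V W : Type*}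

theorem exists_corner_center_iff {l : List V} {u w : V} :
    (∃ c ∈ corners l, c.2.1 = u ∧ (w = c.1 ∨ w = c.2.2)) ↔
      (∃ p, (p, u, w) ∈ corners l) ∨ ∃ p, (p, w, u) ∈ corners l := by
  rcases l with _ | ⟨x, t⟩
  · simp [corners]
  have hl : (x :: t).length = t.length + 1 := rfl
  rw [exists_corner_iff hl, exists_corner_iff hl]
  simp only [mem_corners_iff hl]
  constructor
  · rintro ⟨_, ⟨i, rfl⟩, rfl, rfl | rfl⟩
    · exact Or.inr ⟨i - 1, rfl, by rw [sub_add_cancel]⟩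
    · exact Or.inl ⟨i, rfl, rfl⟩
  · rintro (⟨i, rfl, rfl⟩ | ⟨i, rfl, rfl⟩)
    · exact ⟨_, ⟨i, rfl⟩, rfl, Or.inr rfl⟩
    · exact ⟨_, ⟨i + 1, rfl⟩, rfl, Or.inl (by rw [add_sub_cancel_right])⟩

theorem polygon_adj {l : List V} {u w : V} :
    (polygon l).Adj u w ↔ u ≠ w ∧ ∃ c ∈ corners l, c.2.1 = u ∧ (w = c.1 ∨ w = c.2.2) := by
  rw [polygon, SimpleGraph.fromRel_adj, exists_corner_center_iff]

theorem polygon_map_congr (g : W → V) {l l' : List W}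
    (h : ∀ u w, (∃ c ∈ corners l, c.2.1 = u ∧ (w = c.1 ∨ w = c.2.2)) ↔
      ∃ c ∈ corners l', c.2.1 = u ∧ (w = c.1 ∨ w = c.2.2)) :
    polygon (l.map g) = polygon (l'.map g) := by
  have key : ∀ l : List W, ∀ x y, (∃ c ∈ corners (l.map g), c.2.1 = x ∧ (y = c.1 ∨ y = c.2.2)) ↔
      ∃ u w, (∃ c ∈ corners l, c.2.1 = u ∧ (w = c.1 ∨ w = c.2.2)) ∧ g u = x ∧ g w = y := by
    intro l x y
    rw [corners_map]
    constructor
    · rintro ⟨_, h, rfl, hy⟩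
      obtain ⟨c, hc, rfl⟩ := List.mem_map.1 h
      rcases hy with rfl | rfl
      · exact ⟨c.2.1, c.1, ⟨c, hc, rfl, Or.inl rfl⟩, rfl, rfl⟩
      · exact ⟨c.2.1, c.2.2, ⟨c, hc, rfl, Or.inr rfl⟩, rfl, rfl⟩
    · rintro ⟨_, _, ⟨c, hc, rfl, rfl | rfl⟩, rfl, rfl⟩
      · exact ⟨_, List.mem_map_of_mem hc, rfl, Or.inl rfl⟩
      · exact ⟨_, List.mem_map_of_mem hc, rfl, Or.inr rfl⟩
  ext x y
  simp only [polygon_adj, key, h]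

/-- The mask is the adjacency matrix of the polygon, so comparing masks compares cycles regardless
of starting point and direction. -/
theorem polygon_map_eq_of_edgeMask_eq (g : ℕ → V) {l l' : List ℕ} (hl : ∀ a ∈ l, a < 16)
    (hl' : ∀ a ∈ l', a < 16) (h : edgeMask (corners l) = edgeMask (corners l')) :
    polygon (l.map g) = polygon (l'.map g) := by
  have lt : ∀ l : List ℕ, (∀ a ∈ l, a < 16) → ∀ c ∈ corners l, c.1 < 16 ∧ c.2.2 < 16 :=
    fun l hl c hc => ⟨hl _ (mem_of_corner hc).1, hl _ (mem_of_corner hc).2.2⟩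
  refine polygon_map_congr g fun u w => ?_
  by_cases hw : w < 16
  · rw [← getBit_edgeMask (lt l hl) hw, h, getBit_edgeMask (lt l' hl') hw]
  · have : ∀ l : List ℕ, (∀ a ∈ l, a < 16) →
        ¬∃ c ∈ corners l, c.2.1 = u ∧ (w = c.1 ∨ w = c.2.2) := by
      rintro l hl ⟨c, hc, -, rfl | rfl⟩
      exacts [hw (lt l hl c hc).1, hw (lt l hl c hc).2]
    exact iff_of_false (this l hl) (this l' hl')

end Polygon

section Atlas
variable {V : Type*} [DecidableEq V]

/-- Whether `u` and `w` are neighbours on the polygon `l`. -/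
def adjacent (l : List V) (u w : V) : Bool :=
  (corners l).any fun c => c.2.1 == u && (w == c.1 || w == c.2.2)

def interOK (l l' : List V) : Bool :=
  match l.filter l'.contains with
  | [] => true
  | [_] => true
  | [a, b] => adjacent l a b && adjacent l' a b
  | _ => false

/-- Whether the polygons of a list are the faces of a polyhedral complex. -/
def isComplex (D : List (List V)) : Bool :=
  D.all fun l => decide l.Nodup && Nat.ble 3 l.length && D.all fun l' => l == l' || interOK l l'

variable {D : List (List V)}

theorem polygon_adj_iff {l : List V} (hn : l.Nodup) (h3 : 3 ≤ l.length) {u w : V} :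
    (polygon l).Adj u w ↔ adjacent l u w = true := by
  simp only [polygon_adj, adjacent, List.any_eq_true, Bool.and_eq_true, Bool.or_eq_true, beq_iff_eq]
  refine and_iff_right_of_imp ?_
  rintro ⟨⟨a, b, c⟩, hc, rfl, rfl | rfl⟩
  · exact ((polygon_adj_of_corner hn h3 hc).2 (Or.inl rfl)).ne
  · exact ((polygon_adj_of_corner hn h3 hc).2 (Or.inr rfl)).ne

section
variable (hD : isComplex D = true)
include hD

theorem nodup_of_isComplex {l : List V} (hl : l ∈ D) : l.Nodup := by
  simp only [isComplex, List.all_eq_true, Bool.and_eq_true, decide_eq_true_iff] at hD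
  exact (hD l hl).1.1

theorem three_le_of_isComplex {l : List V} (hl : l ∈ D) : 3 ≤ l.length := by
  simp only [isComplex, List.all_eq_true, Bool.and_eq_true, Nat.ble_eq] at hD
  exact (hD l hl).1.2

theorem interOK_of_isComplex {l l' : List V} (hl : l ∈ D) (hl' : l' ∈ D) (h : l ≠ l') :
    interOK l l' = true := by
  simp only [isComplex, List.all_eq_true, Bool.and_eq_true, Bool.or_eq_true, beq_iff_eq] at hD
  exact ((hD l hl).2 l' hl').resolve_left h

/-- Different polygons of the list have at most two common vertices, while a polygon shares at least
three with itself. In particular the list does not repeat a cycle in another notation. -/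
theorem polygon_injOn {l l' : List V} (hl : l ∈ D) (hl' : l' ∈ D) (h : polygon l = polygon l') :
    l = l' := by
  by_contra hne
  have h1 := interOK_of_isComplex hD hl hl' hne
  have h3 := three_le_of_isComplex hD hl
  have h2 : l.filter l'.contains = l := by
    refine List.filter_eq_self.2 fun x hx => ?_
    rw [List.contains_iff_mem,
      ← mem_support_polygon (nodup_of_isComplex hD hl') (three_le_of_isComplex hD hl'), ← h]
    exact (mem_support_polygon (nodup_of_isComplex hD hl) h3).2 hx
  rw [interOK, h2] at h1
  rcases l with _ | ⟨a, _ | ⟨b, _ | ⟨c, t⟩⟩⟩ <;> simp at h1 h3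

end

/-- The polyhedral complex with the polygons of a list as faces. -/
def complexOf (D : List (List V)) (hD : isComplex D = true) : PolyhedralComplex V where
  faces := {F | ∃ l ∈ D, F = polygon l}
  isCycle := by
    rintro _ ⟨l, hl, rfl⟩
    exact ⟨_, isCycle_polygon (nodup_of_isComplex hD hl) (three_le_of_isComplex hD hl)⟩
  inter := by
    rintro _ ⟨l, hl, rfl⟩ _ ⟨l', hl', rfl⟩ hne
    have hn := nodup_of_isComplex hD hl
    have hn' := nodup_of_isComplex hD hl'
    have h3 := three_le_of_isComplex hD hl
    have h3' := three_le_of_isComplex hD hl'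
    have h := interOK_of_isComplex hD hl hl' (by rintro rfl; exact hne rfl)
    have hset : (polygon l).support ∩ (polygon l').support = {x | x ∈ l.filter l'.contains} := by
      ext x
      simp only [Set.mem_inter_iff, mem_support_polygon hn h3, mem_support_polygon hn' h3',
        Set.mem_ofPred_eq, List.mem_filter, List.contains_iff_mem]
    rw [hset]
    rw [interOK] at h
    split at h
    · next he => left; rw [he]; ext; simp
    · next a he => right; left; refine ⟨a, ?_⟩; rw [he]; ext; simp
    · next a b he =>
      right; right
      rw [Bool.and_eq_true, ← polygon_adj_iff hn h3, ← polygon_adj_iff hn' h3'] at h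
      refine ⟨a, b, h.1, h.2, ?_⟩
      rw [he]; ext; simp
    · exact absurd h (by simp)

/-- The faces and neighbours around `v`, when the neighbours are `ws` in cyclic order. -/
def starOf (D : List (List V)) (v : V) (ws : List V) : List (List V × V) :=
  (corners ws).map fun c =>
    ((D.find? fun l => adjacent l v c.2.1 && adjacent l v c.2.2).getD [], c.2.1)

/-- Whether `ws` are the neighbours of `v` in cyclic order, with face sizes `t`. -/
def isLink (D : List (List V)) (t : List ℕ) (v : V) (ws : List V) : Bool :=
  let s := starOf D v ws
  decide (s.map Prod.fst).Nodup && decide (s.map Prod.snd).Nodup &&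
    ((corners s).all fun c => D.contains c.2.1.1 && adjacent c.2.1.1 v c.2.1.2 &&
      adjacent c.2.1.1 v c.2.2.2) &&
    (D.all fun l => !l.contains v || (s.map Prod.fst).contains l) && s.map (·.1.length) == t

theorem map_snd_starOf (D : List (List V)) (v : V) (ws : List V) :
    (starOf D v ws).map Prod.snd = ws := by
  rw [starOf, List.map_map]
  exact map_center_corners ws

/-- The pairs of face and neighbour in `starOf` form a closed list whose corners are exactly the
incidences that an umbrella requires. -/
theorem exists_umbrella (hD : isComplex D = true) {k : ℕ} {t : List ℕ} (ht : t.length = k + 1)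
    (h3 : 3 ≤ k + 1) {v : V} {ws : List V} (h : isLink D t v ws = true) :
    ∃ (f : ZMod (k + 1) → SimpleGraph V) (w : ZMod (k + 1) → V),
      (complexOf D hD).IsUmbrella v f w ∧
      (∀ i, PolyhedralComplex.faceSize (f i) = curveOf t ht i) ∧ Set.range w = {x | x ∈ ws} := by
  simp only [isLink, Bool.and_eq_true, decide_eq_true_iff, List.all_eq_true, Bool.or_eq_true,
    Bool.not_eq_true', beq_iff_eq, List.contains_iff_mem] at h
  obtain ⟨⟨⟨⟨h1, h2⟩, hadj⟩, hall⟩, rfl⟩ := h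
  set s := starOf D v ws with hs
  have hl : s.length = k + 1 := by rwa [List.length_map] at ht
  have hc : ∀ i, (curveOf s hl i).1 ∈ D ∧ adjacent (curveOf s hl i).1 v (curveOf s hl i).2 = true ∧
      adjacent (curveOf s hl i).1 v (curveOf s hl (i + 1)).2 = true := fun i => by
    have := hadj _ ((mem_corners_iff hl).2 ⟨i, rfl⟩)
    exact ⟨this.1.1, this.1.2, this.2⟩
  have hcur : ∀ x, x ∈ s ↔ ∃ i, curveOf s hl i = x := fun x => (mem_range_curveOf hl).symm
  have hinj := curveOf_injective hl (h2.of_map _)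
  have hws : Set.range (fun i => (curveOf s hl i).2) = {x | x ∈ ws} := by
    ext x
    rw [Set.mem_ofPred_eq, ← map_snd_starOf D v ws, ← hs, List.mem_map]
    constructor
    · rintro ⟨i, rfl⟩
      exact ⟨_, (hcur _).2 ⟨i, rfl⟩, rfl⟩
    · rintro ⟨y, hy, rfl⟩
      obtain ⟨i, rfl⟩ := (hcur y).1 hy
      exact ⟨i, rfl⟩
  refine ⟨fun i => polygon (curveOf s hl i).1, fun i => (curveOf s hl i).2,
    ⟨h3, ?_, ?_, ?_, ?_⟩, ?_, hws⟩
  · intro i j hij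
    exact hinj (List.inj_on_of_nodup_map h1 ((hcur _).2 ⟨i, rfl⟩) ((hcur _).2 ⟨j, rfl⟩)
      (polygon_injOn hD (hc i).1 (hc j).1 hij))
  · intro i j hij
    exact hinj (List.inj_on_of_nodup_map h2 ((hcur _).2 ⟨i, rfl⟩) ((hcur _).2 ⟨j, rfl⟩) hij)
  · ext F
    constructor
    · rintro ⟨i, rfl⟩
      have hi := (hc i).1
      refine ⟨⟨_, hi, rfl⟩, (SimpleGraph.mem_support _).2 ⟨_, (polygon_adj_iff
        (nodup_of_isComplex hD hi) (three_le_of_isComplex hD hi)).2 (hc i).2.1⟩⟩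
    · rintro ⟨⟨l, hlD, rfl⟩, hv⟩
      rw [mem_support_polygon (nodup_of_isComplex hD hlD) (three_le_of_isComplex hD hlD)] at hv
      rcases hall l hlD with h | h
      · rw [← Bool.not_eq_true, List.contains_iff_mem] at h
        exact absurd hv h
      · obtain ⟨x, hx, rfl⟩ := List.mem_map.1 h
        obtain ⟨i, rfl⟩ := (hcur x).1 hx
        exact ⟨i, rfl⟩
  · intro i
    have hi := (hc i).1
    have hn := nodup_of_isComplex hD hi
    have hi3 := three_le_of_isComplex hD hi
    exact ⟨(polygon_adj_iff hn hi3).2 (hc i).2.1, (polygon_adj_iff hn hi3).2 (hc i).2.2⟩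
  · intro i
    have hi := (hc i).1
    rw [faceSize_polygon (nodup_of_isComplex hD hi) (three_le_of_isComplex hD hi)]
    simp only [curveOf, List.getElem_map, hs]

end Atlas
end SEM

/-! ### Orientability -/

namespace SEM
open Function

section Orientation
variable {V : Type*} {F : SimpleGraph V} {d : V → V → Prop}

/-- The curve has length at least 3, so `i + 1` and `i - 1` differ and an edge is traversed in one
direction only. -/
theorem IsCycleOrientation.iff_not (h : IsCycleOrientation F d) {u w : V} (hF : F.Adj u w) :
    d u w ↔ ¬d w u := by
  obtain ⟨p, hp, c, hc, rfl, hd⟩ := h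
  have hd' : ∀ i j, d (c i) (c j) ↔ j = i + 1 := fun i j => by
    rw [hd]
    exact ⟨fun ⟨k, h1, h2⟩ => by rw [hc h1, hc h2], fun h => ⟨i, rfl, by rw [h]⟩⟩
  have h2 := zmod_two_ne_zero hp
  obtain ⟨i, ⟨rfl, rfl⟩ | ⟨rfl, rfl⟩⟩ := (closedCurve_adj hp hc).1 hF
  · simp only [hd', true_iff]
    intro h
    exact h2 (by linear_combination -h)
  · simp only [hd', sub_add_cancel, not_true, iff_false]
    intro h
    exact h2 (by linear_combination -h)

theorem IsCycleOrientation.iff_next (h : IsCycleOrientation F d) {u v w : V} (hu : F.Adj v u)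
    (hw : F.Adj v w) (hne : u ≠ w) : d u v ↔ d v w := by
  obtain ⟨p, hp, c, hc, rfl, hd⟩ := h
  have hd' : ∀ i j, d (c i) (c j) ↔ j = i + 1 := fun i j => by
    rw [hd]
    exact ⟨fun ⟨k, h1, h2⟩ => by rw [hc h1, hc h2], fun h => ⟨i, rfl, by rw [h]⟩⟩
  have h2 := zmod_two_ne_zero hp
  obtain ⟨i, rfl⟩ := (mem_support_closedCurve hp hc).1 ((SimpleGraph.mem_support _).2 ⟨_, hu⟩)
  rw [closedCurve_adj_apply hp hc] at hu hw
  rcases hu with rfl | rfl <;> rcases hw with rfl | rfl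
  · exact absurd rfl hne
  · simp only [hd']
    exact ⟨fun h => absurd (by linear_combination -h) h2,
      fun h => absurd (by linear_combination -h) h2⟩
  · simp only [hd', sub_add_cancel]
  · exact absurd rfl hne

end Orientation

section ComplexOf
variable {V : Type*} [DecidableEq V] {D : List (List V)}

/-- Whether the polygons, traversed as listed, have no directed edge in common. -/
def isCoherent (D : List (List V)) : Bool :=
  D.all fun l => D.all fun l' => l == l' || (corners l).all fun c => (corners l').all fun c' =>
    !(c.2 == c'.2)

theorem isOrientable_complexOf (hD : isComplex D = true) (h : isCoherent D = true) :
    (complexOf D hD).IsOrientable := by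
  simp only [isCoherent, List.all_eq_true, Bool.or_eq_true, Bool.not_eq_true', beq_iff_eq,
    beq_eq_false_iff_ne] at h
  -- Each face is traversed as its polygon is listed. By `polygon_injOn` the polygon is determined
  -- by the face.
  refine ⟨fun F u w => ∃ l ∈ D, F = polygon l ∧ ∃ p, (p, u, w) ∈ corners l, ?_, ?_⟩
  · rintro _ ⟨l, hl, rfl⟩
    convert isCycleOrientation_polygon (nodup_of_isComplex hD hl) (three_le_of_isComplex hD hl)
      using 4 with u w
    constructor
    · rintro ⟨l', hl', he, h'⟩
      rwa [polygon_injOn hD hl hl' he]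
    · exact fun h' => ⟨l, hl, rfl, h'⟩
  · rintro _ - _ - hne u w ⟨l, hl, rfl, p, hp⟩ ⟨l', hl', rfl, p', hp'⟩
    rcases h l hl l' hl' with rfl | h
    · exact hne rfl
    · exact h _ hp _ hp' rfl

/-- Whether in every coherent orientation two directed edges of faces, given with the index of
the face, are both positive or both negative for an evident reason. -/
def sameSide (D : List (List V)) (x y : ℕ × V × V) : Bool :=
  let l := nth D x.1
  let l' := nth D y.1
  D.contains l && D.contains l' &&
    (l == l' && x.2.2 == y.2.1 && adjacent l x.2.2 x.2.1 && adjacent l x.2.2 y.2.2 &&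
        !(x.2.1 == y.2.2) ||
      !(l == l') && x.2.1 == y.2.2 && x.2.2 == y.2.1 && adjacent l x.2.1 x.2.2 &&
        adjacent l' x.2.2 x.2.1)

/-- Whether a walk through directed edges on the same side leads to the reversal of `x`. -/
def reverses (D : List (List V)) (x : ℕ × V × V) : ℕ × V × V → List (ℕ × V × V) → Bool
  | y, [] => adjacent (nth D x.1) x.2.1 x.2.2 && D.contains (nth D x.1) &&
      y == (x.1, x.2.2, x.2.1)
  | y, z :: t => sameSide D y z && reverses D x z t

/-- In a coherent orientation consecutive directed edges of the walk are both traversed or both not.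
They either follow each other in one face or are opposite directions of an edge in two faces. The
walk ends at the reversal of its first edge in the same face, where the answer is the opposite one.
-/
theorem not_isOrientable_complexOf (hD : isComplex D = true) {x : ℕ × V × V}
    {t : List (ℕ × V × V)} (h : reverses D x x t = true) : ¬(complexOf D hD).IsOrientable := by
  rintro ⟨d, hd, hd'⟩
  have hmem : ∀ l ∈ D, polygon l ∈ (complexOf D hD).faces := fun l hl => ⟨l, hl, rfl⟩
  have hadj : ∀ l ∈ D, ∀ u w, adjacent l u w = true → (polygon l).Adj u w := fun l hl u w h =>
    (polygon_adj_iff (nodup_of_isComplex hD hl) (three_le_of_isComplex hD hl)).2 h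
  set side : ℕ × V × V → Prop := fun x => d (polygon (nth D x.1)) x.2.1 x.2.2
  have step : ∀ x y, sameSide D x y = true → (side x ↔ side y) := by
    rintro ⟨i, u, w⟩ ⟨j, u', w'⟩ h
    simp only [sameSide, Bool.and_eq_true, Bool.or_eq_true, Bool.not_eq_true', beq_iff_eq,
      beq_eq_false_iff_ne, List.contains_iff_mem] at h
    obtain ⟨⟨hi, hj⟩, ⟨⟨⟨⟨he, rfl⟩, h1⟩, h2⟩, h3⟩ | ⟨⟨⟨⟨hne, rfl⟩, rfl⟩, h1⟩, h2⟩⟩ := h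
    · change d (polygon (nth D i)) u w ↔ d (polygon (nth D j)) w w'
      rw [← he]
      exact (hd _ (hmem _ hi)).iff_next (hadj _ hi _ _ h1) (hadj _ hi _ _ h2) h3
    · change d (polygon (nth D i)) u w ↔ d (polygon (nth D j)) w u
      have hne' : polygon (nth D i) ≠ polygon (nth D j) := fun h => hne (polygon_injOn hD hi hj h)
      constructor
      · intro h
        exact ((hd _ (hmem _ hj)).iff_not (hadj _ hj _ _ h2)).2
          (hd' _ (hmem _ hi) _ (hmem _ hj) hne' _ _ h)
      · intro h
        exact ((hd _ (hmem _ hi)).iff_not (hadj _ hi _ _ h1)).2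
          (hd' _ (hmem _ hj) _ (hmem _ hi) hne'.symm _ _ h)
  have key : ∀ t y, reverses D x y t = true → (side y ↔ ¬side x) := by
    intro t
    induction t with
    | nil =>
      intro y h
      simp only [reverses, Bool.and_eq_true, beq_iff_eq, List.contains_iff_mem] at h
      obtain ⟨⟨h1, h2⟩, rfl⟩ := h
      exact (hd _ (hmem _ h2)).iff_not (hadj _ h2 _ _ h1).symm
    | cons z t ih =>
      intro y h
      simp only [reverses, Bool.and_eq_true] at h
      rw [step y z h.1, ih z h.2]
  exact iff_not_self (key t x h)

end ComplexOf

/-! ### Verification of an explicitly given map -/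

/-- A polyhedral map given by its faces and its vertex links, with a walk as in `reverses` if it
is not orientable. -/
structure Atlas where
  n : ℕ
  type : List ℕ
  faces : List (List (Fin n))
  links : List (List (Fin n))
  walk : List (ℕ × Fin n × Fin n)

namespace Atlas
variable (A : Atlas)

def link (v : Fin A.n) : List (Fin A.n) := nth A.links v

/-- Apart from `0`, each vertex has a neighbour with a smaller number, so the edge graph is
connected by descent to `0`. Two faces of different lengths exclude equivelar maps. -/
def isValid : Bool :=
  Nat.blt 0 A.n && Nat.ble 3 A.type.length && isComplex A.faces &&
    ((List.finRange A.n).all fun v => isLink A.faces A.type v (A.link v) &&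
      (v.val == 0 || (A.link v).any (· < v))) &&
    A.faces.any fun l => A.faces.any fun l' => l.length != l'.length

variable {A}

theorem isComplex_of_isValid (hA : A.isValid = true) : isComplex A.faces = true := by
  simp only [isValid, Bool.and_eq_true] at hA
  exact hA.1.1.2

variable (A) in
def complex (hA : A.isValid = true) : PolyhedralComplex (Fin A.n) :=
  complexOf A.faces (isComplex_of_isValid hA)

variable (A) in
def isTwisted : Bool :=
  match A.walk with
  | [] => false
  | x :: t => reverses A.faces x x t

section
variable (hA : A.isValid = true)

theorem isOrientable (h : isCoherent A.faces = true) : (A.complex hA).IsOrientable :=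
  isOrientable_complexOf _ h

theorem not_isOrientable (h : A.isTwisted = true) : ¬(A.complex hA).IsOrientable := by
  rw [isTwisted] at h
  split at h
  · exact absurd h Bool.false_ne_true
  · exact not_isOrientable_complexOf _ h

theorem exists_umbrella {k : ℕ} (hk : A.type.length = k + 1) (v : Fin A.n) :
    ∃ (f : ZMod (k + 1) → SimpleGraph (Fin A.n)) (w : ZMod (k + 1) → Fin A.n),
      (A.complex hA).IsUmbrella v f w ∧
      (∀ i, PolyhedralComplex.faceSize (f i) = curveOf A.type hk i) ∧
      Set.range w = {x | x ∈ A.link v} := by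
  have h := hA
  simp only [isValid, Bool.and_eq_true, List.all_eq_true, List.mem_finRange, forall_true_left,
    Nat.ble_eq] at h
  exact SEM.exists_umbrella _ hk (hk ▸ h.1.1.1.2) (h.1.2 v).1

theorem exists_length_eq (hA : A.isValid = true) : ∃ k, A.type.length = k + 1 := by
  simp only [isValid, Bool.and_eq_true, Nat.ble_eq] at hA
  exact ⟨A.type.length - 1, by omega⟩

theorem edgeGraph_adj_iff {u v : Fin A.n} : (A.complex hA).edgeGraph.Adj u v ↔ v ∈ A.link u := by
  obtain ⟨k, hk⟩ := exists_length_eq hA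
  obtain ⟨f, w, h, -, hw⟩ := exists_umbrella hA hk u
  have : v ∈ A.link u ↔ v ∈ Set.range w := by rw [hw]; rfl
  rw [PolyhedralComplex.edgeGraph_adj, this]
  constructor
  · rintro ⟨F, hF, hadj⟩
    obtain ⟨i, rfl, -⟩ := h.exists_of_adj hF hadj
    exact ⟨i, rfl⟩
  · rintro ⟨i, rfl⟩
    exact ⟨f i, h.mem i, (h.2.2.2.2 i).1⟩

theorem connected : (A.complex hA).edgeGraph.Connected := by
  have h := hA
  simp only [isValid, Bool.and_eq_true, List.all_eq_true, List.mem_finRange, forall_true_left,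
    Nat.blt_eq, Bool.or_eq_true, beq_iff_eq, List.any_eq_true, decide_eq_true_iff] at h
  have h0 := h.1.1.1.1
  have key : ∀ m, ∀ v : Fin A.n, v.val = m → (A.complex hA).edgeGraph.Reachable v ⟨0, h0⟩ := by
    intro m
    induction m using Nat.strong_induction_on with
    | _ m ih =>
      intro v hv
      rcases (h.1.2 v).2 with h' | ⟨w, hw, hlt⟩
      · rw [show v = ⟨0, h0⟩ from Fin.ext h']
      · exact ((edgeGraph_adj_iff hA).2 hw).reachable.trans (ih w.val (hv ▸ hlt) w rfl)
  have : Nonempty (Fin A.n) := ⟨⟨0, h0⟩⟩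
  exact ⟨fun u v => (key _ u rfl).trans (key _ v rfl).symm⟩

theorem isMap : (A.complex hA).IsMap := by
  obtain ⟨k, hk⟩ := exists_length_eq hA
  refine ⟨inferInstance, connected hA, fun v => ?_⟩
  obtain ⟨f, w, h, -⟩ := exists_umbrella hA hk v
  exact ⟨_, f, w, h⟩

theorem hasFaceSequence {k : ℕ} (hk : A.type.length = k + 1) :
    (A.complex hA).HasFaceSequence (curveOf A.type hk) := fun v => by
  obtain ⟨f, w, h, hs, -⟩ := exists_umbrella hA hk v
  exact ⟨f, w, h, hs⟩

theorem isSemiEquivelar : (A.complex hA).IsSemiEquivelar := by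
  obtain ⟨k, hk⟩ := exists_length_eq hA
  exact ⟨_, _, hasFaceSequence hA hk⟩

theorem not_isEquivelar : ¬(A.complex hA).IsEquivelar := by
  rintro ⟨p, -, hp, -⟩
  have hD := isComplex_of_isValid hA
  have h := hA
  simp only [isValid, Bool.and_eq_true, List.any_eq_true, bne_iff_ne] at h
  obtain ⟨-, l, hl, l', hl', hne⟩ := h
  have key : ∀ l ∈ A.faces, l.length = p := fun l hl => by
    rw [← hp _ ⟨l, hl, rfl⟩,
      faceSize_polygon (nodup_of_isComplex hD hl) (three_le_of_isComplex hD hl)]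
  exact hne ((key l hl).trans (key l' hl').symm)

theorem listOf_curveOf {k : ℕ} {l : List ℕ} (hl : l.length = k + 1) : listOf (curveOf l hl) = l :=
  List.ext_getElem (by rw [length_listOf, hl]) fun _ _ _ => List.getElem_ofFn _

/-- The formula for the Euler characteristic in terms of the face sequence, now read in the other
direction. -/
theorem eulerChar_eq_zero
    (ht : 2 * (A.type.map fun x : ℕ => 1 / (x : ℚ)).sum = A.type.length - 2) :
    (A.complex hA).eulerChar = 0 := by
  obtain ⟨k, hk⟩ := exists_length_eq hA
  have h := (hasFaceSequence hA hk).two_mul_eulerChar (isMap hA)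
  rw [← sum_map_listOf _ fun x => 1 / (x : ℚ), listOf_curveOf, ← hk] at h
  have h0 : (2 * (A.complex hA).eulerChar : ℚ) = 0 := by
    rw [h, ht]
    ring
  exact_mod_cast (mul_eq_zero.1 h0).resolve_left two_ne_zero

end
end Atlas

/-! ### An isomorphism invariant -/

section Invariant

/-- The number of ordered pairs of different nonadjacent vertices with `c` common neighbours. -/
def coNeighbours {V : Type*} [Fintype V] [DecidableEq V] (adj : V → V → Bool) (c : ℕ) : ℕ :=
  ((Finset.univ : Finset (V × V)).filter fun p => p.1 ≠ p.2 ∧ adj p.1 p.2 = false ∧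
    (Finset.univ.filter fun x => adj p.1 x = true ∧ adj p.2 x = true).card = c).card

theorem coNeighbours_congr {V W : Type*} [Fintype V] [DecidableEq V] [Fintype W] [DecidableEq W]
    {adj : V → V → Bool} {adj' : W → W → Bool} (e : V ≃ W)
    (h : ∀ u w, adj u w = adj' (e u) (e w)) (c : ℕ) :
    coNeighbours adj c = coNeighbours adj' c := by
  refine Finset.card_equiv (e.prodCongr e) fun p => ?_
  have hc : (Finset.univ.filter fun x => adj p.1 x = true ∧ adj p.2 x = true).card =
      (Finset.univ.filter fun x => adj' (e p.1) x = true ∧ adj' (e p.2) x = true).card :=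
    Finset.card_equiv e fun x => by simp [h]
  rw [Finset.mem_filter, Finset.mem_filter, hc, h]
  simp

namespace PolyhedralComplex

theorem edgeGraph_adj_of_isomorphic {V W : Type*} {K : PolyhedralComplex V}
    {L : PolyhedralComplex W} {e : V ≃ W}
    (he : ∀ F : SimpleGraph V, F ∈ K.faces ↔ F.map e.toEmbedding ∈ L.faces) {u v : V} :
    K.edgeGraph.Adj u v ↔ L.edgeGraph.Adj (e u) (e v) := by
  rw [edgeGraph_adj, edgeGraph_adj]
  constructor
  · rintro ⟨F, hF, h⟩
    exact ⟨_, (he F).1 hF, (SimpleGraph.map_adj_apply (f := e.toEmbedding)).2 h⟩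
  · rintro ⟨G, hG, h⟩
    have hG' : (G.map e.symm.toEmbedding).map e.toEmbedding = G := by
      rw [SimpleGraph.map_map]
      convert SimpleGraph.map_id (G := G)
      ext x
      simp
    refine ⟨_, (he _).2 (hG'.symm ▸ hG), ?_⟩
    rw [← SimpleGraph.map_adj_apply (f := e.toEmbedding), hG']
    exact h

end PolyhedralComplex

namespace Atlas

def coNum (A : Atlas) (c : ℕ) : ℕ := coNeighbours (fun u v => (A.link u).contains v) c

/-- An isomorphism preserves the edge graph, hence also adjacency and common neighbours. -/
theorem coNum_eq_of_isomorphic {A B : Atlas} {hA : A.isValid = true} {hB : B.isValid = true}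
    (h : (A.complex hA).Isomorphic (B.complex hB)) : A.n = B.n ∧ ∀ c, A.coNum c = B.coNum c := by
  obtain ⟨e, he⟩ := h
  refine ⟨by simpa using Fintype.card_congr e, coNeighbours_congr e fun u v => ?_⟩
  rw [Bool.eq_iff_iff, List.contains_iff_mem, List.contains_iff_mem, ← edgeGraph_adj_iff hA,
    ← edgeGraph_adj_iff hB, PolyhedralComplex.edgeGraph_adj_of_isomorphic he]

end Atlas
end Invariant
end SEM

/-! ### The eleven maps -/

namespace SEM

/-- The maps: six orientable ones with coherently listed faces, then five non-orientable ones. -/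
def catalogue : List Atlas := [
  ⟨10, [3, 3, 3, 4, 4], [[0, 1, 2, 3], [1, 0, 4], [2, 1, 5, 6], [3, 2, 7], [0, 3, 8, 9], [4, 0,
  6], [1, 4, 8], [5, 1, 8], [6, 5, 7, 4], [2, 6, 9], [7, 2, 9], [3, 7, 5], [8, 3, 5], [9, 8, 4,
  7], [0, 9, 6]], [[9, 6, 4, 1, 3], [5, 8, 4, 0, 2], [6, 9, 7, 3, 1], [8, 5, 7, 2, 0], [8, 1, 0,
  6, 7], [7, 3, 8, 1, 6], [2, 9, 0, 4, 5], [5, 3, 2, 9, 4], [3, 5, 1, 4, 9], [0, 6, 2, 7, 8]],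
  []⟩,
  ⟨12, [3, 3, 3, 4, 4], [[0, 1, 2, 3], [1, 0, 4], [2, 1, 5, 6], [3, 2, 7], [0, 3, 8, 9], [4, 0,
  6], [1, 4, 10], [5, 1, 10], [6, 5, 11, 4], [2, 6, 9], [7, 2, 9], [3, 7, 11], [8, 3, 11], [9, 8,
  10, 7], [0, 9, 6], [10, 4, 11, 7], [5, 10, 8], [11, 5, 8]], [[9, 6, 4, 1, 3], [5, 10, 4, 0, 2],
  [6, 9, 7, 3, 1], [8, 11, 7, 2, 0], [10, 1, 0, 6, 11], [11, 8, 10, 1, 6], [2, 9, 0, 4, 5], [11,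
  3, 2, 9, 10], [10, 5, 11, 3, 9], [0, 6, 2, 7, 8], [8, 5, 1, 4, 7], [5, 8, 3, 7, 4]], []⟩,
  ⟨12, [3, 3, 3, 4, 4], [[0, 1, 2, 3], [1, 0, 4], [2, 1, 5, 6], [3, 2, 7], [0, 3, 6, 5], [4, 0,
  8], [1, 4, 9], [5, 1, 9], [2, 6, 10], [7, 2, 10], [3, 7, 11], [6, 3, 11], [0, 5, 8], [4, 8, 7,
  10], [9, 4, 10, 11], [5, 9, 8], [10, 6, 11], [11, 7, 8, 9]], [[5, 8, 4, 1, 3], [5, 9, 4, 0, 2],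
  [6, 10, 7, 3, 1], [6, 11, 7, 2, 0], [9, 1, 0, 8, 10], [0, 8, 9, 1, 6], [3, 11, 10, 2, 5], [11,
  3, 2, 10, 8], [9, 5, 0, 4, 7], [8, 5, 1, 4, 11], [11, 6, 2, 7, 4], [10, 6, 3, 7, 9]], []⟩,
  ⟨12, [3, 3, 3, 4, 4], [[0, 1, 2, 3], [1, 0, 4], [2, 1, 5, 6], [3, 2, 7], [0, 3, 6, 5], [4, 0,
  8], [1, 4, 9], [5, 1, 9], [2, 6, 10], [7, 2, 10], [3, 7, 11], [6, 3, 11], [0, 5, 8], [4, 8, 11,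
  7], [9, 4, 7, 10], [5, 9, 8], [10, 6, 11], [11, 8, 9, 10]], [[5, 8, 4, 1, 3], [5, 9, 4, 0, 2],
  [6, 10, 7, 3, 1], [6, 11, 7, 2, 0], [9, 1, 0, 8, 7], [0, 8, 9, 1, 6], [3, 11, 10, 2, 5], [11, 3,
  2, 10, 4], [9, 5, 0, 4, 11], [8, 5, 1, 4, 10], [11, 6, 2, 7, 9], [10, 6, 3, 7, 8]], []⟩,
  ⟨14, [3, 3, 3, 4, 4], [[0, 1, 2, 3], [1, 0, 4], [2, 1, 5, 6], [3, 2, 7], [0, 3, 8, 9], [4, 0,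
  6], [1, 4, 10], [5, 1, 10], [6, 5, 11, 4], [2, 6, 9], [7, 2, 9], [3, 7, 12], [8, 3, 12], [9, 8,
  13, 7], [0, 9, 6], [10, 4, 11, 12], [5, 10, 13], [11, 5, 13], [12, 7, 13, 10], [8, 12, 11], [13,
  8, 11]], [[9, 6, 4, 1, 3], [5, 10, 4, 0, 2], [6, 9, 7, 3, 1], [8, 12, 7, 2, 0], [10, 1, 0, 6,
  11], [11, 13, 10, 1, 6], [2, 9, 0, 4, 5], [12, 3, 2, 9, 13], [13, 11, 12, 3, 9], [0, 6, 2, 7,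
  8], [13, 5, 1, 4, 12], [12, 8, 13, 5, 4], [11, 8, 3, 7, 10], [8, 11, 5, 10, 7]], []⟩,
  ⟨14, [3, 3, 3, 4, 4], [[0, 1, 2, 3], [1, 0, 4], [2, 1, 5, 6], [3, 2, 7], [0, 3, 8, 9], [4, 0,
  10], [1, 4, 11], [5, 1, 11], [6, 5, 12, 10], [2, 6, 13], [7, 2, 13], [3, 7, 12], [8, 3, 12], [9,
  8, 11, 13], [0, 9, 10], [4, 10, 12, 7], [11, 4, 7, 13], [5, 11, 8], [12, 5, 8], [6, 10, 9], [13,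
  6, 9]], [[9, 10, 4, 1, 3], [5, 11, 4, 0, 2], [6, 13, 7, 3, 1], [8, 12, 7, 2, 0], [11, 1, 0, 10,
  7], [12, 8, 11, 1, 6], [10, 9, 13, 2, 5], [12, 3, 2, 13, 4], [11, 5, 12, 3, 9], [13, 6, 10, 0,
  8], [6, 9, 0, 4, 12], [8, 5, 1, 4, 13], [5, 8, 3, 7, 10], [9, 6, 2, 7, 11]], []⟩,
  ⟨10, [3, 3, 3, 4, 4], [[0, 1, 2, 3], [1, 0, 4], [2, 1, 5, 6], [3, 2, 7], [0, 3, 8, 9], [4, 0,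
  5], [1, 4, 9], [5, 1, 9], [6, 5, 4, 7], [2, 6, 8], [7, 2, 8], [3, 7, 6], [8, 3, 6], [9, 8, 7,
  4], [0, 9, 5]], [[9, 5, 4, 1, 3], [5, 9, 4, 0, 2], [6, 8, 7, 3, 1], [8, 6, 7, 2, 0], [9, 1, 0,
  5, 7], [1, 9, 0, 4, 6], [7, 3, 8, 2, 5], [6, 3, 2, 8, 4], [3, 6, 2, 7, 9], [0, 5, 1, 4, 8]],
  [(0, 0, 1), (0, 1, 2), (2, 2, 1), (2, 1, 5), (2, 5, 6), (8, 6, 5), (8, 5, 4), (5, 4, 5), (5, 5,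
  0), (5, 0, 4), (1, 4, 0), (1, 0, 1), (0, 1, 0)]⟩,
  ⟨12, [3, 3, 3, 4, 4], [[0, 1, 2, 3], [1, 0, 4], [2, 1, 5, 6], [3, 2, 7], [0, 3, 5, 6], [4, 0,
  8], [1, 4, 9], [5, 1, 9], [2, 6, 10], [7, 2, 10], [3, 7, 11], [5, 3, 11], [0, 6, 8], [4, 8, 11,
  7], [9, 4, 7, 10], [5, 9, 11], [10, 6, 8], [11, 8, 10, 9]], [[6, 8, 4, 1, 3], [5, 9, 4, 0, 2],
  [6, 10, 7, 3, 1], [5, 11, 7, 2, 0], [9, 1, 0, 8, 7], [3, 11, 9, 1, 6], [0, 8, 10, 2, 5], [11, 3,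
  2, 10, 4], [10, 6, 0, 4, 11], [11, 5, 1, 4, 10], [8, 6, 2, 7, 9], [9, 5, 3, 7, 8]], [(0, 0, 1),
  (0, 1, 2), (0, 2, 3), (0, 3, 0), (4, 0, 3), (4, 3, 5), (4, 5, 6), (2, 6, 5), (2, 5, 1), (2, 1,
  2), (0, 2, 1), (0, 1, 0)]⟩,
  ⟨12, [3, 3, 3, 4, 4], [[0, 1, 2, 3], [1, 0, 4], [2, 1, 5, 6], [3, 2, 7], [0, 3, 6, 5], [4, 0,
  8], [1, 4, 9], [5, 1, 9], [2, 6, 10], [7, 2, 10], [3, 7, 11], [6, 3, 11], [0, 5, 8], [4, 8, 7,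
  11], [9, 4, 11, 10], [5, 9, 8], [10, 6, 11], [7, 10, 9, 8]], [[5, 8, 4, 1, 3], [5, 9, 4, 0, 2],
  [6, 10, 7, 3, 1], [6, 11, 7, 2, 0], [9, 1, 0, 8, 11], [0, 8, 9, 1, 6], [3, 11, 10, 2, 5], [11,
  3, 2, 10, 8], [9, 5, 0, 4, 7], [8, 5, 1, 4, 10], [11, 6, 2, 7, 9], [10, 6, 3, 7, 4]], [(0, 0,
  1), (0, 1, 2), (0, 2, 3), (3, 3, 2), (3, 2, 7), (3, 7, 3), (10, 3, 7), (10, 7, 11), (13, 11, 7),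
  (13, 7, 8), (13, 8, 4), (5, 4, 8), (5, 8, 0), (5, 0, 4), (1, 4, 0), (1, 0, 1), (0, 1, 0)]⟩,
  ⟨14, [3, 3, 3, 4, 4], [[0, 1, 2, 3], [1, 0, 4], [2, 1, 5, 6], [3, 2, 7], [0, 3, 8, 9], [4, 0,
  10], [1, 4, 11], [5, 1, 11], [6, 5, 10, 12], [2, 6, 13], [7, 2, 13], [3, 7, 12], [8, 3, 12], [9,
  8, 13, 11], [0, 9, 10], [4, 10, 12, 7], [11, 4, 7, 13], [5, 11, 9], [10, 5, 9], [6, 12, 8], [13,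
  6, 8]], [[9, 10, 4, 1, 3], [5, 11, 4, 0, 2], [6, 13, 7, 3, 1], [8, 12, 7, 2, 0], [11, 1, 0, 10,
  7], [10, 9, 11, 1, 6], [12, 8, 13, 2, 5], [12, 3, 2, 13, 4], [13, 6, 12, 3, 9], [11, 5, 10, 0,
  8], [5, 9, 0, 4, 12], [9, 5, 1, 4, 13], [6, 8, 3, 7, 10], [8, 6, 2, 7, 11]], [(0, 0, 1), (0, 1,
  2), (2, 2, 1), (2, 1, 5), (2, 5, 6), (8, 6, 5), (8, 5, 10), (8, 10, 12), (15, 12, 10), (15, 10,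
  4), (5, 4, 10), (5, 10, 0), (5, 0, 4), (1, 4, 0), (1, 0, 1), (0, 1, 0)]⟩,
  ⟨12, [3, 3, 4, 3, 4], [[0, 1, 2, 3], [1, 0, 4], [2, 1, 5], [3, 2, 6], [0, 3, 7], [4, 0, 5, 8],
  [1, 4, 9], [5, 1, 9, 7], [2, 5, 8], [6, 2, 8, 10], [3, 6, 11], [7, 3, 11, 10], [0, 7, 5], [4, 8,
  11], [9, 4, 11, 6], [7, 9, 10], [10, 8, 11], [6, 10, 9]], [[5, 7, 3, 1, 4], [9, 4, 0, 2, 5], [8,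
  5, 1, 3, 6], [11, 6, 2, 0, 7], [9, 1, 0, 8, 11], [8, 2, 1, 7, 0], [11, 3, 2, 10, 9], [5, 0, 3,
  10, 9], [10, 11, 4, 5, 2], [6, 10, 7, 1, 4], [6, 9, 7, 11, 8], [10, 8, 4, 6, 3]], [(0, 0, 1),
  (0, 1, 2), (2, 2, 1), (2, 1, 5), (2, 5, 2), (8, 2, 5), (8, 5, 8), (5, 8, 5), (5, 5, 0), (5, 0,
  4), (1, 4, 0), (1, 0, 1), (0, 1, 0)]⟩]

def atlas (i : Fin 11) : Atlas := catalogue.get i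

theorem isValid_atlas (i : Fin 11) : (atlas i).isValid = true := by
  have h : catalogue.all Atlas.isValid = true := by decide +kernel
  exact List.all_eq_true.1 h _ (List.get_mem _ _)

def atlasMap (i : Fin 11) : PolyhedralComplex (Fin (atlas i).n) :=
  (atlas i).complex (isValid_atlas i)

theorem n_atlas_le (i : Fin 11) : (atlas i).n ≤ 15 := by
  revert i
  decide +kernel

theorem eulerChar_atlasMap (i : Fin 11) : (atlasMap i).eulerChar = 0 := by
  refine Atlas.eulerChar_eq_zero _ ?_
  have h : ∀ i, (atlas i).type = [3, 3, 3, 4, 4] ∨ (atlas i).type = [3, 3, 4, 3, 4] := by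
    decide +kernel
  rcases h i with h | h <;> rw [h] <;> norm_num

theorem eq_of_isomorphic_atlasMap {i j : Fin 11} (h : (atlasMap i).Isomorphic (atlasMap j)) :
    i = j := by
  -- For each map: the number of vertices, and the numbers of ordered nonadjacent pairs with two and
  -- with four common neighbours. The eleven triples are different.
  have h1 : (List.finRange 11).map (fun i => ((atlas i).n, (atlas i).coNum 2, (atlas i).coNum 4)) =
      [
        (10, 0, 20), (12, 60, 12), (12, 36, 12), (12, 48, 12), (14, 56, 14), (14, 84, 0), (10, 40,
        0), (12, 48, 0), (12, 40, 12), (14, 56, 0), (12, 36, 0)] := by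
    decide +kernel
  have h2 : ((List.finRange 11).map
      fun i => ((atlas i).n, (atlas i).coNum 2, (atlas i).coNum 4)).Nodup := by
    rw [h1]
    decide
  obtain ⟨hn, hc⟩ := Atlas.coNum_eq_of_isomorphic h
  exact List.inj_on_of_nodup_map h2 (List.mem_finRange i) (List.mem_finRange j)
    (by rw [hn, hc 2, hc 4])

theorem isOrientable_atlasMap_iff (i : Fin 11) : (atlasMap i).IsOrientable ↔ i.val < 6 := by
  have h : ∀ i : Fin 11, (if i.val < 6 then isCoherent (atlas i).faces else (atlas i).isTwisted) =
      true := by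
    decide +kernel
  specialize h i
  split_ifs at h with hi
  · exact iff_of_true (Atlas.isOrientable _ h) hi
  · exact iff_of_false (Atlas.not_isOrientable _ h) hi

/-- The maps found by the search, with the labels of their vertices. -/
def labellings : List (Fin 11 × List ℕ) := [
  (0, [9, 8, 7, 4, 3, 1, 2, 0, 5, 6]), (0, [9, 8, 6, 7, 1, 5, 4, 0, 2, 3]), (1, [9, 7, 11, 8, 6,
  4, 10, 3, 1, 2, 0, 5]), (1, [5, 8, 11, 6, 9, 4, 10, 2, 0, 3, 1, 7]), (1, [10, 7, 8, 9, 5, 6, 11,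
  1, 3, 2, 0, 4]), (1, [11, 6, 9, 8, 3, 7, 10, 1, 5, 4, 0, 2]), (2, [9, 11, 8, 7, 2, 10, 4, 6, 5,
  3, 1, 0]), (2, [11, 9, 7, 8, 3, 10, 4, 6, 5, 2, 0, 1]), (2, [11, 7, 10, 8, 5, 6, 9, 2, 3, 0, 4,
  1]), (2, [9, 8, 7, 11, 1, 10, 6, 5, 4, 2, 0, 3]), (3, [9, 11, 8, 7, 5, 10, 4, 6, 3, 2, 1, 0]),
  (3, [11, 7, 9, 10, 5, 6, 8, 4, 3, 0, 1, 2]), (4, [13, 7, 11, 12, 6, 4, 10, 2, 8, 9, 0, 5, 3,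
  1]), (4, [13, 8, 11, 12, 9, 4, 10, 3, 6, 5, 1, 7, 2, 0]), (4, [13, 7, 11, 8, 5, 6, 12, 2, 9, 10,
  0, 4, 1, 3]), (4, [12, 9, 13, 6, 4, 8, 11, 3, 7, 10, 1, 5, 0, 2]), (5, [5, 8, 13, 6, 10, 4, 12,
  9, 0, 3, 11, 1, 7, 2]), (5, [5, 12, 13, 4, 11, 8, 6, 10, 1, 0, 7, 2, 9, 3]), (6, [9, 8, 7, 4, 3,
  2, 1, 0, 6, 5]), (6, [6, 7, 9, 8, 0, 3, 2, 1, 4, 5]), (7, [11, 7, 9, 8, 6, 4, 10, 5, 2, 0, 3,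
  1]), (7, [10, 7, 9, 11, 5, 6, 8, 4, 2, 0, 1, 3]), (8, [9, 11, 8, 7, 3, 10, 4, 6, 5, 2, 1, 0]),
  (8, [10, 11, 8, 4, 3, 9, 7, 1, 2, 5, 6, 0]), (8, [11, 9, 7, 8, 2, 10, 4, 6, 5, 3, 0, 1]), (8,
  [8, 9, 11, 6, 1, 10, 7, 3, 2, 4, 5, 0]), (8, [9, 8, 11, 7, 1, 10, 6, 5, 4, 2, 3, 0]), (8, [11,
  7, 8, 10, 5, 6, 9, 2, 3, 0, 1, 4]), (9, [5, 13, 8, 6, 9, 12, 4, 10, 0, 3, 11, 2, 7, 1]), (9, [4,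
  12, 13, 5, 11, 8, 6, 10, 0, 1, 9, 2, 7, 3]), (10, [2, 9, 5, 11, 1, 3, 7, 10, 0, 8, 6, 4]), (10,
  [11, 9, 6, 4, 2, 10, 0, 8, 7, 3, 5, 1]), (10, [11, 5, 9, 10, 3, 7, 1, 6, 8, 0, 4, 2]), (10, [9,
  10, 11, 5, 1, 8, 3, 7, 4, 2, 6, 0]), (10, [11, 9, 8, 4, 3, 10, 1, 6, 5, 2, 7, 0]), (10, [3, 5,
  9, 10, 0, 2, 6, 11, 1, 7, 8, 4]), (10, [11, 9, 7, 5, 2, 10, 0, 8, 6, 1, 4, 3]), (10, [7, 5, 11,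
  9, 0, 6, 2, 10, 4, 3, 8, 1])]

/-- Whether the faces of a state are those of the map `A` with vertices labelled by `σ`. -/
def isLabelling (st : State) (A : Atlas) (σ : List ℕ) : Bool :=
  Nat.beq A.n st.nv &&
    (let D := A.faces.map (·.map fun v : Fin A.n => σ.getD v 0)
     let D' := D.map fun l => edgeMask (corners l)
     let S' := st.faces.map fun l => edgeMask (corners l)
     D'.all S'.contains && S'.all D'.contains &&
      ((D.all fun l => l.all (Nat.blt · 16)) && decide σ.Nodup && Nat.beq σ.length A.n &&
        σ.all (Nat.blt · st.nv) && (List.range st.nv).all σ.contains))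

def isKnown (st : State) : Bool :=
  labellings.any fun x => isLabelling st (atlas x.1) x.2

namespace PolyhedralComplex
variable {V : Type*} {K : PolyhedralComplex V}

/-- The isomorphism is `e.symm`. The two hypotheses say that `e` carries the listed polygons onto
the faces of `K`. -/
theorem isomorphic_complexOf {W : Type*} [DecidableEq W] {D : List (List W)}
    (hD : isComplex D = true) (e : W ≃ V) (h1 : ∀ l ∈ D, polygon (l.map e) ∈ K.faces)
    (h2 : ∀ F ∈ K.faces, ∃ l ∈ D, F = polygon (l.map e)) : K.Isomorphic (complexOf D hD) := by
  have key : ∀ l : List W, (polygon (l.map e)).map e.symm.toEmbedding = polygon l := fun l => by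
    rw [map_polygon, List.map_map]
    congr 1
    convert List.map_id l
    ext x
    simp
  refine ⟨e.symm, fun F => ⟨fun hF => ?_, ?_⟩⟩
  · obtain ⟨l, hl, rfl⟩ := h2 F hF
    exact ⟨l, hl, key l⟩
  · rintro ⟨l, hl, h⟩
    rw [← key l] at h
    rw [SimpleGraph.map_injective _ h]
    exact h1 l hl

/-- The list `σ` is a bijection from the vertices of the catalogued map to the labels in use, and
`φ` is one from these labels to the vertices of `K`. The composite carries faces to faces because
the edge masks agree. -/
theorem Realizes.exists_isomorphic {sp : LocalSpec} (hK : K.Respects sp) {φ : ℕ → V} {st : State}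
    (h : Realizes K φ st K.faces) (hst : isKnown st = true) : ∃ i, K.Isomorphic (atlasMap i) := by
  obtain ⟨⟨i, σ⟩, -, hx⟩ := List.any_eq_true.1 hst
  simp only [isLabelling, Bool.and_eq_true, Nat.beq_eq, List.all_eq_true, List.mem_map,
    List.contains_iff_mem, forall_exists_index, and_imp, forall_apply_eq_imp_iff₂,
    decide_eq_true_iff, Nat.blt_eq, List.mem_range] at hx
  obtain ⟨hn, ⟨hDS, hSD⟩, ⟨⟨⟨hlt, hnd⟩, hlen⟩, hσ⟩, hall⟩ := hx
  have h16 : ∀ l ∈ st.faces, ∀ a ∈ l, a < 16 := fun l hl a ha =>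
    (h.lt l hl a ha).trans (h.nv_lt hK)
  set g : Fin (atlas i).n → V := fun v => φ (σ.getD v 0) with hg
  have hget : ∀ v : Fin (atlas i).n, σ.getD v 0 = σ[v.val]'(v.2.trans_eq hlen.symm) := fun v =>
    List.getD_eq_getElem _ _ _
  have hmap : ∀ l : List (Fin (atlas i).n), l.map g =
      (l.map fun v : Fin (atlas i).n => σ.getD v 0).map φ :=
    fun l => by rw [List.map_map]; rfl
  have hbij : Function.Bijective g := by
    constructor
    · intro v w hvw
      simp only [hg, hget] at hvw
      exact Fin.ext ((hnd.getElem_inj_iff).1 (h.inj _ (hσ _ (List.getElem_mem _)) _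
        (hσ _ (List.getElem_mem _)) hvw))
    · intro x
      -- Every vertex of `K` has a label, since it lies in a face and all faces are listed.
      obtain ⟨F, hF, hx⟩ : ∃ F ∈ K.faces, x ∈ F.support := by
        obtain ⟨m, f, w, hu⟩ := hK.isMap.2.2 x
        exact ⟨f 0, hu.mem 0, (SimpleGraph.mem_support _).2 ⟨_, (hu.2.2.2.2 0).1⟩⟩
      obtain ⟨a, ha, rfl⟩ := h.label F hF x hx
      obtain ⟨k, hk, rfl⟩ := List.mem_iff_getElem.1 (hall a ha)
      exact ⟨⟨k, hk.trans_eq hlen⟩, by simp only [hg, hget]⟩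
  refine ⟨i, isomorphic_complexOf (Atlas.isComplex_of_isValid (isValid_atlas i))
    (Equiv.ofBijective g hbij) (fun l hl => ?_) fun F hF => ?_⟩
  · obtain ⟨l', hl', he⟩ := hDS l hl
    change polygon (l.map g) ∈ K.faces
    rw [hmap, h.mem_iff]
    refine ⟨l', hl', ?_⟩
    exact (polygon_map_eq_of_edgeMask_eq φ (h16 l' hl') (List.forall_mem_map.2 (hlt l hl)) he).symm
  · obtain ⟨l, hl, rfl⟩ := (h.mem_iff F).1 hF
    obtain ⟨_, ⟨l', hl', rfl⟩, he⟩ := hSD l hl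
    refine ⟨l', hl', ?_⟩
    change polygon (l.map φ) = polygon (l'.map g)
    rw [hmap]
    exact polygon_map_eq_of_edgeMask_eq φ (h16 l hl) (List.forall_mem_map.2 (hlt l' hl')) he.symm

end PolyhedralComplex
end SEM

/-! ### Running the search and conclusion -/

namespace SEM
open PolyhedralComplex

theorem searchAll_33344 : searchAll (specOf 14 [3, 3, 3, 4, 4]) 4 isKnown = true := by
  decide +kernel

theorem searchAll_33434 : searchAll (specOf 14 [3, 3, 4, 3, 4]) 4 isKnown = true := by
  decide +kernel

/-- These searches begin with a hexagon, whereas the catalogued maps have only triangles and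
quadrangles. The check succeeds because every branch ends in a conflict: the five sequences with
hexagons contribute no map. -/
theorem searchAll_sparse : ∀ t ∈ searchTypes.drop 2,
    searchAll (specOf t.2.1 t.1) t.2.2 isKnown = true := by
  decide +kernel

theorem searchAll_of_mem {t : List ℕ × ℕ × ℕ} (ht : t ∈ searchTypes) :
    searchAll (specOf t.2.1 t.1) t.2.2 isKnown = true := by
  rw [← List.take_append_drop 2 searchTypes, List.mem_append] at ht
  rcases ht with ht | ht
  · obtain rfl | rfl : t = ([3, 3, 3, 4, 4], 14, 4) ∨ t = ([3, 3, 4, 3, 4], 14, 4) := by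
      simpa [searchTypes] using ht
    exacts [searchAll_33344, searchAll_33434]
  · exact searchAll_sparse t ht

end SEM

theorem theorem1 :
    ∃ (n : Fin 11 → ℕ) (M : ∀ i, SEM.PolyhedralComplex (Fin (n i))),
      (∀ i, n i ≤ 15 ∧ (M i).IsMap ∧ (M i).IsSemiEquivelar ∧ ¬ (M i).IsEquivelar ∧
        (M i).eulerChar = 0) ∧
      (∀ i j, (M i).Isomorphic (M j) → i = j) ∧
      {i | (M i).IsOrientable}.ncard = 6 ∧
      {i | ¬ (M i).IsOrientable}.ncard = 5 ∧
      ∀ (V : Type*) (K : SEM.PolyhedralComplex V),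
        K.IsMap → Nat.card V ≤ 15 → K.IsSemiEquivelar → ¬ K.IsEquivelar → K.eulerChar = 0 →
          ∃ i, K.Isomorphic (M i) := by
  have hor : {i | (SEM.atlasMap i).IsOrientable} =
      (Finset.univ.filter fun i : Fin 11 => i.val < 6) := by
    ext i
    simp [SEM.isOrientable_atlasMap_iff]
  have hnor : {i | ¬(SEM.atlasMap i).IsOrientable} =
      (Finset.univ.filter fun i : Fin 11 => ¬i.val < 6) := by
    ext i
    simp [SEM.isOrientable_atlasMap_iff]
  refine ⟨fun i => (SEM.atlas i).n, SEM.atlasMap, fun i => ⟨SEM.n_atlas_le i, SEM.Atlas.isMap _,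
    SEM.Atlas.isSemiEquivelar _, SEM.Atlas.not_isEquivelar _, SEM.eulerChar_atlasMap i⟩,
    fun _ _ => SEM.eq_of_isomorphic_atlasMap, ?_, ?_, ?_⟩
  · rw [hor, Set.ncard_coe_finset]
    decide
  · rw [hnor, Set.ncard_coe_finset]
    decide
  · rintro V K hK hV ⟨m, a, ha⟩ hne h0
    have ha : K.HasFaceSequence a := ha
    have : NeZero m := ⟨by have := ha.three_le hK; omega⟩
    obtain ⟨t, ht, hr, F, hF, hs⟩ := ha.exists_searchType hK hV h0 hne
    obtain ⟨φ, st, hst, hl⟩ :=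
      SEM.PolyhedralComplex.Realizes.exists_of_searchAll hr (SEM.searchAll_of_mem ht) hF hs
    exact hst.exists_isomorphic hr hl
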